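/- Let $(\mathbf X,\mathbf Y_1,\mathbf Y_2)$ be zero-mean jointly Gaussian random vectors in $\mathbb R^k\times\mathbb R^{k_1}\times\mathbb R^{k_2}$ (possibly degenerate). For a random vector $\mathbf Z$, write $K_{\mathbf X|\mathbf Z}=E[(\mathbf X-E[\mathbf X|\mathbf Z])(\mathbf X-E[\mathbf X|\mathbf Z])^T]$, and assume that $K_{\mathbf X|\mathbf Y_1}$ and $K_{\mathbf X|\mathbf Y_2}$ are invertible. Let $\Gamma_1,\Gamma_2$ be maps from the $k\times k$ positive semidefinite matrices to the $k_0\times k_0$ positive semidefinite matrices that are linear (additive and homogeneous for nonnegative scalars) and monotone for the Loewner order $\preceq$, and let $D_1,D_2$ be positive definite $k_0\times k_0$ matrices. Let $S_G$ be the set of (joint laws with $(\mathbf X,\mathbf Y_1,\mathbf Y_2)$ of) random vectors $\mathbf Y$, of any finite dimension, that are zero-mean jointly Gaussian with $(\mathbf X,\mathbf Y_1,\mathbf Y_2)$ and satisfy the Markov chain $\mathbf X\leftrightarrow\mathbf Y\leftrightarrow(\mathbf Y_1,\mathbf Y_2)$; let $S_G'\subseteq S_G$ consist of those with $K_{\mathbf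 X|\mathbf Y}$ invertible. For random vectors $\mathbf W,\mathbf U,\mathbf V$ of any finite dimensions put $$R_{lo1}=I(\mathbf X;\mathbf W,\mathbf U|\mathbf Y_1)+I(\mathbf X;\mathbf V|\mathbf W,\mathbf U,\mathbf Y),\qquad R_{lo2}=I(\mathbf X;\mathbf W,\mathbf V|\mathbf Y_2)+I(\mathbf X;\mathbf U|\mathbf W,\mathbf V,\mathbf Y),$$ with values in $[0,\infty]$. For $\mathbf Y\in S_G$ define the following sets of (joint laws of) triples $(\mathbf W,\mathbf U,\mathbf V)$ with $(\mathbf W,\mathbf U,\mathbf V)\leftrightarrow\mathbf X\leftrightarrow(\mathbf Y_1,\mathbf Y_2,\mathbf Y)$: - $\widetilde C_{l1}$: those with $\Gamma_1(K_{\mathbf X|\mathbf W,\mathbf U,\mathbf Y_1})\preceq D_1$ and $\Gamma_2(K_{\mathbf X|\mathbf W,\mathbf U,\mathbf V,\mathbf Y})\preceq D_2$; - $\widetilde C_{l2}$: those with $\Gamma_1(K_{\mathbf X|\mathbf W,\mathbf U,\mathbf V,\mathbf Y})\preceq D_1$ and $\Gamma_2(K_{\mathbf X|\mathbf W,\mathbf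 V,\mathbf Y_2})\preceq D_2$; and for $\mathbf Y\in S_G'$, with $\widetilde K=K_{\mathbf X|\mathbf Y}^{-1}-K_{\mathbf X|\mathbf Y_2}^{-1}$ and $\widehat K=K_{\mathbf X|\mathbf Y}^{-1}-K_{\mathbf X|\mathbf Y_1}^{-1}$, - $\bar C_{l1}$: those with $K_{\mathbf X|\mathbf W,\mathbf U,\mathbf V,\mathbf Y}$ invertible, $\Gamma_1(K_{\mathbf X|\mathbf W,\mathbf U,\mathbf Y_1})\preceq D_1$ and $\Gamma_2\big((K_{\mathbf X|\mathbf W,\mathbf U,\mathbf V,\mathbf Y}^{-1}-\widetilde K)^{-1}\big)\preceq D_2$; - $\bar C_{l2}$: those with $K_{\mathbf X|\mathbf W,\mathbf U,\mathbf V,\mathbf Y}$ invertible, $\Gamma_1\big((K_{\mathbf X|\mathbf W,\mathbf U,\mathbf V,\mathbf Y}^{-1}-\widehat K)^{-1}\big)\preceq D_1$ and $\Gamma_2(K_{\mathbf X|\mathbf W,\mathbf V,\mathbf Y_2})\preceq D_2$. The Enhancement bound and the Enhanced-Enhancement bound are $$R_{\mathrm{ELB}}=\max\Big\{\sup_{S_G}\inf_{\widetilde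 C_{l1}}R_{lo1},\ \sup_{S_G}\inf_{\widetilde C_{l2}}R_{lo2}\Big\},\qquad R_{\mathrm{E^2LB}}=\max\Big\{\sup_{S_G'}\inf_{\bar C_{l1}}R_{lo1},\ \sup_{S_G'}\inf_{\bar C_{l2}}R_{lo2}\Big\},$$ with $\inf\emptyset=\infty$ and $\sup\emptyset=0$. Then one may add the constraint that $(\mathbf W,\mathbf U,\mathbf V)$ is zero-mean jointly Gaussian with $(\mathbf X,\mathbf Y_1,\mathbf Y_2,\mathbf Y)$ to the sets $\widetilde C_{l1},\widetilde C_{l2},\bar C_{l1},\bar C_{l2}$ without affecting the optimal values: for each fixed $\mathbf Y\in S_G$ (respectively $\mathbf Y\in S_G'$) each of the two corresponding infima is unchanged, and the values $R_{\mathrm{ELB}}$ and $R_{\mathrm{E^2LB}}$ are unchanged. -/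

import Mathlib

open MeasureTheory ProbabilityTheory InformationTheory
open scoped ENNReal MatrixOrder

noncomputable section

namespace SideInfo

/-- Real column vectors with `n` components. -/
abbrev Vec (n : ℕ) : Type := EuclideanSpace ℝ (Fin n)

/-! ### Information measures and conditional covariances of random vectors -/

section General

variable {Ω : Type*} [MeasurableSpace Ω]

/-- The Markov chain `A ↔ B ↔ C`: `A` and `C` are conditionally independent given `B`. -/
def IsMarkovChain [StandardBorelSpace Ω] {α β γ : Type*}
    [MeasurableSpace α] [MeasurableSpace β] [MeasurableSpace γ]
    (μ : Measure Ω) [IsFiniteMeasure μ] (A : Ω → α) (B : Ω → β) (C : Ω → γ) : Prop :=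
  ∃ hB : Measurable B,
    CondIndepFun (MeasurableSpace.comap B inferInstance) hB.comap_le A C μ

/-- The conditional mutual information `I(A; B | C)` (in nats): the Kullback-Leibler divergence
of the joint law of `(C, A, B)` from the law under which `C` has its own law and, given `C`, the
variables `A` and `B` are independent with their own conditional laws. -/
def condMutualInfo {α β γ : Type*}
    [MeasurableSpace α] [StandardBorelSpace α] [Nonempty α]
    [MeasurableSpace β] [StandardBorelSpace β] [Nonempty β] [MeasurableSpace γ]
    (μ : Measure Ω) [IsFiniteMeasure μ] (A : Ω → α) (B : Ω → β) (C : Ω → γ) : ℝ≥0∞ :=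
  klDiv (μ.map fun ω => (C ω, A ω, B ω))
    ((μ.map C).compProd ((condDistrib A C μ).prod (condDistrib B C μ)))

/-- The (averaged) conditional covariance matrix
`K_{X|Z} = E[(X - E[X|Z]) (X - E[X|Z])ᵀ]` of the random vector `X` given `Z`. -/
def condCov {k : ℕ} {γ : Type*} [MeasurableSpace γ]
    (μ : Measure Ω) (X : Ω → Vec k) (Z : Ω → γ) : Matrix (Fin k) (Fin k) ℝ :=
  Matrix.of fun i j =>
    ∫ ω, (X ω i - (μ[fun ω' => X ω' i | MeasurableSpace.comap Z inferInstance]) ω) *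
      (X ω j - (μ[fun ω' => X ω' j | MeasurableSpace.comap Z inferInstance]) ω) ∂μ

/-- Zero-mean (possibly degenerate) Gaussian laws. -/
def IsCenteredGaussian {E : Type*} [NormedAddCommGroup E] [NormedSpace ℝ E] [MeasurableSpace E]
    (μ : Measure E) : Prop :=
  IsGaussian μ ∧ ∫ x, x ∂μ = 0

end General

/-- A distortion map: a map from `k × k` positive semidefinite matrices to `k₀ × k₀` positive
semidefinite matrices that is linear and monotone for the Loewner order. Its values at other
matrices are irrelevant. -/
structure IsDistortionMap {k k₀ : ℕ}
    (Γ : Matrix (Fin k) (Fin k) ℝ → Matrix (Fin k₀) (Fin k₀) ℝ) : Prop where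
  posSemidef : ∀ A, A.PosSemidef → (Γ A).PosSemidef
  map_add : ∀ A B, A.PosSemidef → B.PosSemidef → Γ (A + B) = Γ A + Γ B
  map_smul : ∀ (c : ℝ) A, 0 ≤ c → A.PosSemidef → Γ (c • A) = c • Γ A
  monotone : ∀ A B, A.PosSemidef → B.PosSemidef → A ≤ B → Γ A ≤ Γ B

/-! ### Sample spaces and coordinates

Optimization over random vectors is carried out over their joint laws, the random vectors being the
coordinates of the following spaces. -/

/-- Values of `(X, Y₁, Y₂)`. -/
abbrev SourceSpace (k k₁ k₂ : ℕ) : Type := Vec k × Vec k₁ × Vec k₂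

/-- Values of `((X, Y₁, Y₂), Y)`. -/
abbrev EnhSpace (k k₁ k₂ m : ℕ) : Type := SourceSpace k k₁ k₂ × Vec m

/-- Values of `(((X, Y₁, Y₂), Y), (W, U, V))`. -/
abbrev FullSpace (k k₁ k₂ m a b c : ℕ) : Type :=
  EnhSpace k k₁ k₂ m × (Vec a × Vec b × Vec c)

instance {k k₁ k₂ m a b c : ℕ} : StandardBorelSpace (FullSpace k k₁ k₂ m a b c) :=
  have : StandardBorelSpace (EnhSpace k k₁ k₂ m) := inferInstance
  have : StandardBorelSpace (Vec a × Vec b × Vec c) := inferInstance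
  StandardBorelSpace.prod

section Coordinates

variable {k k₁ k₂ m a b c : ℕ}

def cX (ω : FullSpace k k₁ k₂ m a b c) : Vec k := ω.1.1.1
def cY₁ (ω : FullSpace k k₁ k₂ m a b c) : Vec k₁ := ω.1.1.2.1
def cY₂ (ω : FullSpace k k₁ k₂ m a b c) : Vec k₂ := ω.1.1.2.2
def cY (ω : FullSpace k k₁ k₂ m a b c) : Vec m := ω.1.2
def cW (ω : FullSpace k k₁ k₂ m a b c) : Vec a := ω.2.1
def cU (ω : FullSpace k k₁ k₂ m a b c) : Vec b := ω.2.2.1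
def cV (ω : FullSpace k k₁ k₂ m a b c) : Vec c := ω.2.2.2

end Coordinates

section Bounds

variable {k k₁ k₂ k₀ : ℕ}

/-- `K_{X|Y₁}` under the law `P` of `(X, Y₁, Y₂)`. -/
def covXgivenY₁ (P : ProbabilityMeasure (SourceSpace k k₁ k₂)) : Matrix (Fin k) (Fin k) ℝ :=
  condCov (P : Measure (SourceSpace k k₁ k₂)) (fun ω => ω.1) (fun ω => ω.2.1)

/-- `K_{X|Y₂}` under the law `P` of `(X, Y₁, Y₂)`. -/
def covXgivenY₂ (P : ProbabilityMeasure (SourceSpace k k₁ k₂)) : Matrix (Fin k) (Fin k) ℝ :=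
  condCov (P : Measure (SourceSpace k k₁ k₂)) (fun ω => ω.1) (fun ω => ω.2.2)

/-- `K_{X|Y}` under the law `Q` of `((X, Y₁, Y₂), Y)`. -/
def covXgivenY {m : ℕ} (Q : ProbabilityMeasure (EnhSpace k k₁ k₂ m)) : Matrix (Fin k) (Fin k) ℝ :=
  condCov (Q : Measure (EnhSpace k k₁ k₂ m)) (fun ω => ω.1.1) (fun ω => ω.2)

/-- The set `S_G`: the laws of `((X, Y₁, Y₂), Y)` with `(X, Y₁, Y₂) ∼ P`, with `Y` an
`m`-dimensional vector that is jointly Gaussian with `(X, Y₁, Y₂)`, and with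
`X ↔ Y ↔ (Y₁, Y₂)`. -/
def SG (P : ProbabilityMeasure (SourceSpace k k₁ k₂)) (m : ℕ) :
    Set (ProbabilityMeasure (EnhSpace k k₁ k₂ m)) :=
  {Q | (Q : Measure (EnhSpace k k₁ k₂ m)).map Prod.fst = P ∧
    IsCenteredGaussian (Q : Measure (EnhSpace k k₁ k₂ m)) ∧
    IsMarkovChain (Q : Measure (EnhSpace k k₁ k₂ m))
      (fun ω => ω.1.1) (fun ω => ω.2) (fun ω => ω.1.2)}

/-- The members of `S_G` for which `K_{X|Y}` is invertible, that is, those for which the matrices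
`K_{X|Y}⁻¹ - K_{X|Yᵢ}⁻¹` are defined. -/
def SGInv (P : ProbabilityMeasure (SourceSpace k k₁ k₂)) (m : ℕ) :
    Set (ProbabilityMeasure (EnhSpace k k₁ k₂ m)) :=
  {Q | Q ∈ SG P m ∧ IsUnit (covXgivenY Q)}

section Fixed

variable {m a b c : ℕ}

/-- `R_lo1 = I(X; W, U | Y₁) + I(X; V | W, U, Y)`. -/
def Rlo1 (ν : ProbabilityMeasure (FullSpace k k₁ k₂ m a b c)) : ℝ≥0∞ :=
  condMutualInfo (ν : Measure (FullSpace k k₁ k₂ m a b c)) cX (fun ω => (cW ω, cU ω)) cY₁ +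
  condMutualInfo (ν : Measure (FullSpace k k₁ k₂ m a b c)) cX cV (fun ω => (cW ω, cU ω, cY ω))

/-- `R_lo2 = I(X; W, V | Y₂) + I(X; U | W, V, Y)`. -/
def Rlo2 (ν : ProbabilityMeasure (FullSpace k k₁ k₂ m a b c)) : ℝ≥0∞ :=
  condMutualInfo (ν : Measure (FullSpace k k₁ k₂ m a b c)) cX (fun ω => (cW ω, cV ω)) cY₂ +
  condMutualInfo (ν : Measure (FullSpace k k₁ k₂ m a b c)) cX cU (fun ω => (cW ω, cV ω, cY ω))

/-- `K_{X|W,U,Y₁}`. -/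
def covWUY₁ (ν : ProbabilityMeasure (FullSpace k k₁ k₂ m a b c)) : Matrix (Fin k) (Fin k) ℝ :=
  condCov (ν : Measure (FullSpace k k₁ k₂ m a b c)) cX (fun ω => (cW ω, cU ω, cY₁ ω))

/-- `K_{X|W,V,Y₂}`. -/
def covWVY₂ (ν : ProbabilityMeasure (FullSpace k k₁ k₂ m a b c)) : Matrix (Fin k) (Fin k) ℝ :=
  condCov (ν : Measure (FullSpace k k₁ k₂ m a b c)) cX (fun ω => (cW ω, cV ω, cY₂ ω))

/-- `K_{X|W,U,V,Y}`. -/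
def covWUVY (ν : ProbabilityMeasure (FullSpace k k₁ k₂ m a b c)) : Matrix (Fin k) (Fin k) ℝ :=
  condCov (ν : Measure (FullSpace k k₁ k₂ m a b c)) cX (fun ω => (cW ω, cU ω, cV ω, cY ω))

/-- `(W, U, V)` are auxiliary vectors for `((X, Y₁, Y₂), Y) ∼ Q`, with
`(W, U, V) ↔ X ↔ (Y₁, Y₂, Y)`. -/
def IsAuxiliary (Q : ProbabilityMeasure (EnhSpace k k₁ k₂ m))
    (ν : ProbabilityMeasure (FullSpace k k₁ k₂ m a b c)) : Prop :=
  (ν : Measure (FullSpace k k₁ k₂ m a b c)).map Prod.fst = Q ∧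
  IsMarkovChain (ν : Measure (FullSpace k k₁ k₂ m a b c))
    (fun ω => (cW ω, cU ω, cV ω)) cX (fun ω => (cY₁ ω, cY₂ ω, cY ω))

/-- `(W, U, V)` is jointly Gaussian with `(X, Y₁, Y₂, Y)`. -/
def JointlyGaussian : Set (ProbabilityMeasure (FullSpace k k₁ k₂ m a b c)) :=
  {ν | IsCenteredGaussian (ν : Measure (FullSpace k k₁ k₂ m a b c))}

end Fixed

section Optimization

variable (P : ProbabilityMeasure (SourceSpace k k₁ k₂))
  (Γ₁ Γ₂ : Matrix (Fin k) (Fin k) ℝ → Matrix (Fin k₀) (Fin k₀) ℝ)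
  (D₁ D₂ : Matrix (Fin k₀) (Fin k₀) ℝ)

/-- First feasible set of the Enhancement bound, for given `Y`. -/
def Ctilde1 {m : ℕ} (Q : ProbabilityMeasure (EnhSpace k k₁ k₂ m)) (a b c : ℕ) :
    Set (ProbabilityMeasure (FullSpace k k₁ k₂ m a b c)) :=
  {ν | IsAuxiliary Q ν ∧ Γ₁ (covWUY₁ ν) ≤ D₁ ∧ Γ₂ (covWUVY ν) ≤ D₂}

/-- Second feasible set of the Enhancement bound, for given `Y`. -/
def Ctilde2 {m : ℕ} (Q : ProbabilityMeasure (EnhSpace k k₁ k₂ m)) (a b c : ℕ) :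
    Set (ProbabilityMeasure (FullSpace k k₁ k₂ m a b c)) :=
  {ν | IsAuxiliary Q ν ∧ Γ₁ (covWUVY ν) ≤ D₁ ∧ Γ₂ (covWVY₂ ν) ≤ D₂}

/-- First feasible set of the Enhanced-Enhancement bound, for given `Y`; here
`K̃ = K_{X|Y}⁻¹ - K_{X|Y₂}⁻¹`. -/
def Cbar1 {m : ℕ} (Q : ProbabilityMeasure (EnhSpace k k₁ k₂ m)) (a b c : ℕ) :
    Set (ProbabilityMeasure (FullSpace k k₁ k₂ m a b c)) :=
  {ν | IsAuxiliary Q ν ∧ Γ₁ (covWUY₁ ν) ≤ D₁ ∧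
    IsUnit (covWUVY ν) ∧
    Γ₂ (((covWUVY ν)⁻¹ - ((covXgivenY Q)⁻¹ - (covXgivenY₂ P)⁻¹))⁻¹) ≤ D₂}

/-- Second feasible set of the Enhanced-Enhancement bound, for given `Y`; here
`K̂ = K_{X|Y}⁻¹ - K_{X|Y₁}⁻¹`. -/
def Cbar2 {m : ℕ} (Q : ProbabilityMeasure (EnhSpace k k₁ k₂ m)) (a b c : ℕ) :
    Set (ProbabilityMeasure (FullSpace k k₁ k₂ m a b c)) :=
  {ν | IsAuxiliary Q ν ∧ IsUnit (covWUVY ν) ∧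
    Γ₁ (((covWUVY ν)⁻¹ - ((covXgivenY Q)⁻¹ - (covXgivenY₁ P)⁻¹))⁻¹) ≤ D₁ ∧
    Γ₂ (covWVY₂ ν) ≤ D₂}

/-- The infimum of the objective `R` over a family of feasible sets `C a b c` (the dimensions
`a, b, c` of `W, U, V` are free); it is `∞` if there is no feasible point. -/
def infOver {m : ℕ} (R : ∀ {a b c : ℕ}, ProbabilityMeasure (FullSpace k k₁ k₂ m a b c) → ℝ≥0∞)
    (C : ∀ a b c : ℕ, Set (ProbabilityMeasure (FullSpace k k₁ k₂ m a b c))) : ℝ≥0∞ :=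
  ⨅ (a : ℕ) (b : ℕ) (c : ℕ) (ν ∈ C a b c), R ν

/-- The Enhancement lower bound. -/
def RELB : ℝ≥0∞ :=
  max (⨆ (m : ℕ) (Q ∈ SG P m), infOver Rlo1 (Ctilde1 Γ₁ Γ₂ D₁ D₂ Q))
    (⨆ (m : ℕ) (Q ∈ SG P m), infOver Rlo2 (Ctilde2 Γ₁ Γ₂ D₁ D₂ Q))

/-- The Enhancement lower bound with `(W, U, V)` jointly Gaussian with `(X, Y₁, Y₂, Y)`. -/
def RELBGauss : ℝ≥0∞ :=
  max (⨆ (m : ℕ) (Q ∈ SG P m),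
      infOver Rlo1 fun a b c => Ctilde1 Γ₁ Γ₂ D₁ D₂ Q a b c ∩ JointlyGaussian)
    (⨆ (m : ℕ) (Q ∈ SG P m),
      infOver Rlo2 fun a b c => Ctilde2 Γ₁ Γ₂ D₁ D₂ Q a b c ∩ JointlyGaussian)

/-- The Enhanced-Enhancement lower bound. -/
def RE2LB : ℝ≥0∞ :=
  max (⨆ (m : ℕ) (Q ∈ SGInv P m), infOver Rlo1 (Cbar1 P Γ₁ Γ₂ D₁ D₂ Q))
    (⨆ (m : ℕ) (Q ∈ SGInv P m), infOver Rlo2 (Cbar2 P Γ₁ Γ₂ D₁ D₂ Q))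

/-- The Enhanced-Enhancement lower bound with `(W, U, V)` jointly Gaussian with
`(X, Y₁, Y₂, Y)`. -/
def RE2LBGauss : ℝ≥0∞ :=
  max (⨆ (m : ℕ) (Q ∈ SGInv P m),
      infOver Rlo1 fun a b c => Cbar1 P Γ₁ Γ₂ D₁ D₂ Q a b c ∩ JointlyGaussian)
    (⨆ (m : ℕ) (Q ∈ SGInv P m),
      infOver Rlo2 fun a b c => Cbar2 P Γ₁ Γ₂ D₁ D₂ Q a b c ∩ JointlyGaussian)

end Optimization

end Bounds

end SideInfo

end

/-! Fix `Y` and write G₁ = (W, U), G₂ = V for the first problem; the second exchanges U with V and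
Y₁ with Y₂. The constraints see a triple only through Ka = K_{X|G₁,Y₁} and Kb = K_{X|G₁,G₂,Y}. It
therefore suffices to replace every triple of finite rate by a Gaussian one with the same Ka and Kb
and no larger rate (`exists_gaussian₁`, `exists_gaussian₂`).

Lower bound on the rate. The chains X - Y - Y₁ and (G₁, G₂) - X - (Y₁, Y) turn the objective into
I(Y; G₁ | Y₁) + I(X; G₁, G₂ | Y) (`condMutualInfo_add_eq`), where only source variables are
conditioned on. Each term is then the mutual information between a standard Gaussian innovation and
the observation. The Donsker-Varadhan inequality, applied to a Gaussian log-likelihood ratio, bounds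
it below by -½ Σ log τᵢ, where the τᵢ are the variances of the diagonalized estimation error
(`le_klDiv_of_errorVariance`). Equality holds when the error is Gaussian and independent of the
observation (`klDiv_eq_of_gaussian_error`). The error of X has covariance Kb, and that of Y has
covariance A Ka Aᵀ plus a fixed noise covariance, so the bound is a function of Ka and Kb alone.

Existence of the Gaussian triple. Precisions add in Gaussian estimation. A channel H X + n producing
Ka needs Hᵀ H = Ka⁻¹ - K_{X|Y₁}⁻¹, and a second channel must supply the rest of the precision gain
of Kb over K_{X|Y}, taken on the range of K_{X|Y}. Both matrices are positive semidefinite for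
arbitrary triples, because they are second moment matrices of explicit vectors (`cc_gain`,
`posSemidef_gain`). Their square roots give Gaussian test channels with the prescribed errors, which
attain the bound (`rate_eq_rateSpec`). -/

noncomputable section

namespace SideInfo

/-! ### Conditional mutual information: kernel form, chain rule, decomposition of the objective. -/

section Info

variable {Ω : Type*} {mΩ : MeasurableSpace Ω}

/-- Data processing in both directions, since `f` undoes `g`. -/
lemma klDiv_map_of_leftInverse {α β : Type*} [MeasurableSpace α] [MeasurableSpace β]
    (μ ν : Measure α) [IsFiniteMeasure μ] [IsFiniteMeasure ν] {g : α → β} {f : β → α}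
    (hg : Measurable g) (hf : Measurable f) (hfg : Function.LeftInverse f g) :
    klDiv (μ.map g) (ν.map g) = klDiv μ ν := by
  apply le_antisymm (klDiv_map_le μ ν hg)
  have h := klDiv_map_le (μ.map g) (ν.map g) hf
  rwa [Measure.map_map hf hg, Measure.map_map hf hg, hfg.comp_eq_id, Measure.map_id,
    Measure.map_id] at h

variable {α β γ δ : Type*}
  [MeasurableSpace α] [MeasurableSpace β] [MeasurableSpace γ] [MeasurableSpace δ]

lemma compProd_map_prod (μ : Measure γ) [SFinite μ] (κ : Kernel γ α) [IsSFiniteKernel κ]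
    (e : γ ≃ᵐ δ) :
    (μ ⊗ₘ κ).map (Prod.map e id) = μ.map e ⊗ₘ κ.comap e.symm e.symm.measurable := by
  refine Measure.ext_of_lintegral _ fun f hf => ?_
  rw [lintegral_map hf (by fun_prop), Measure.lintegral_compProd (by fun_prop),
    Measure.lintegral_compProd hf, lintegral_map (by fun_prop) e.measurable]
  simp [Kernel.comap_apply]

/-- The kernel sending `d` to the law of `φ (d, N)`, where `N` has law `ρ`. -/
def funKernel (φ : δ × γ → α) (ρ : Measure γ) : Kernel δ α :=
  (Kernel.id ×ₖ Kernel.const δ ρ).map φ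

instance (φ : δ × γ → α) (ρ : Measure γ) [IsFiniteMeasure ρ] :
    IsFiniteKernel (funKernel φ ρ) := by
  unfold funKernel; infer_instance

lemma lintegral_funKernel {φ : δ × γ → α} (hφ : Measurable φ) (ρ : Measure γ) [IsFiniteMeasure ρ]
    (d : δ) {f : α → ℝ≥0∞} (hf : Measurable f) :
    ∫⁻ a, f a ∂(funKernel φ ρ d) = ∫⁻ n, f (φ (d, n)) ∂ρ := by
  rw [funKernel, Kernel.lintegral_map _ hφ _ hf, Kernel.lintegral_id_prod (by fun_prop)]
  simp

lemma compProd_funKernel (ν : Measure δ) [SFinite ν] {φ : δ × γ → α} (hφ : Measurable φ)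
    (ρ : Measure γ) [IsFiniteMeasure ρ] :
    ν ⊗ₘ funKernel φ ρ = (ν.prod ρ).map fun p => (p.1, φ p) := by
  refine Measure.ext_of_lintegral _ fun f hf => ?_
  rw [lintegral_map hf (by fun_prop), Measure.lintegral_compProd hf,
    lintegral_prod _ (by fun_prop)]
  refine lintegral_congr fun d => ?_
  rw [lintegral_funKernel hφ ρ d (by fun_prop)]

/-- By uniqueness of disintegrations this identifies the conditional law of `A` given `D` with
`funKernel φ (μ.map N)`. -/
lemma map_prodMk_eq_compProd_funKernel {μ : Measure Ω} [IsFiniteMeasure μ] {A : Ω → α} {D : Ω → δ}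
    {N : Ω → γ} (hD : Measurable D) (hN : Measurable N) {φ : δ × γ → α} (hφ : Measurable φ)
    (hA : ∀ᵐ ω ∂μ, A ω = φ (D ω, N ω)) (hind : IndepFun D N μ) :
    μ.map (fun ω => (D ω, A ω)) = μ.map D ⊗ₘ funKernel φ (μ.map N) := by
  rw [compProd_funKernel _ hφ, ← hind.map_prod_eq_prod_map_map hD.aemeasurable hN.aemeasurable,
    Measure.map_map (by fun_prop) (by fun_prop)]
  refine Measure.map_congr ?_
  filter_upwards [hA] with ω h
  simp [h]

/-- Conditional laws given `C` are determined only up to null sets of the law of `C`. That law is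
the first marginal of the law of (C, B), so the exceptional set stays null. -/
lemma ae_prodMkRight (μ : Measure Ω) {κ η : Kernel γ α} {B : Ω → β} {C : Ω → γ} (hB : Measurable B)
    (hC : Measurable C) (h : κ =ᵐ[μ.map C] η) :
    κ.prodMkRight β =ᵐ[μ.map fun ω => (C ω, B ω)] η.prodMkRight β := by
  have h1 : Filter.Tendsto Prod.fst (ae (μ.map fun ω => (C ω, B ω))) (ae (μ.map C)) := by
    have : μ.map C = (μ.map fun ω => (C ω, B ω)).map Prod.fst := by
      rw [Measure.map_map (by fun_prop) (by fun_prop)]; rfl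
    rw [this]
    exact Measure.tendsto_ae_map (by fun_prop)
  filter_upwards [h1.eventually h] with p hp
  ext s
  simp [Kernel.prodMkRight_apply, hp]

variable [StandardBorelSpace α] [Nonempty α] [StandardBorelSpace β] [Nonempty β]
  (μ : Measure Ω) [IsProbabilityMeasure μ]

lemma map_compProd_prod_swap {A : Ω → α} {B : Ω → β} {C : Ω → γ}
    (hB : Measurable B) :
    ((μ.map C).compProd ((condDistrib A C μ).prod (condDistrib B C μ))).map
        (fun p => ((p.1, p.2.2), p.2.1)) =
      (μ.map fun ω => (C ω, B ω)) ⊗ₘ (condDistrib A C μ).prodMkRight β := by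
  rw [← compProd_map_condDistrib hB.aemeasurable]
  refine Measure.ext_of_lintegral _ fun f hf => ?_
  rw [lintegral_map hf (by fun_prop), Measure.lintegral_compProd (by fun_prop),
    Measure.lintegral_compProd hf, Measure.lintegral_compProd]
  · refine lintegral_congr fun c => ?_
    rw [Kernel.lintegral_prod_symm _ _ _ (by fun_prop)]
    rfl
  · exact hf.lintegral_kernel_prod_right'

/-- An asymmetric form of the definition: the law of `A` given (C, B) is compared with its law given
`C` alone. It has the composition-product shape to which `klDiv_compProd_eq_add` applies. -/
lemma condMutualInfo_eq_klDiv {A : Ω → α} {B : Ω → β} {C : Ω → γ}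
    (hA : Measurable A) (hB : Measurable B) (hC : Measurable C) :
    condMutualInfo μ A B C = klDiv (μ.map fun ω => ((C ω, B ω), A ω))
      ((μ.map fun ω => (C ω, B ω)) ⊗ₘ (condDistrib A C μ).prodMkRight β) := by
  rw [condMutualInfo, ← map_compProd_prod_swap μ hB]
  have : (μ.map fun ω => ((C ω, B ω), A ω)) =
      (μ.map fun ω => (C ω, A ω, B ω)).map (fun p => ((p.1, p.2.2), p.2.1)) := by
    rw [Measure.map_map (by fun_prop) (by fun_prop)]; rfl
  have := Measure.isProbabilityMeasure_map (μ := μ) hC.aemeasurable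
  rw [‹(μ.map fun ω => ((C ω, B ω), A ω)) = _›, klDiv_map_of_leftInverse
    (f := fun p => (p.1.1, p.2, p.1.2)) _ _ (by fun_prop) (by fun_prop) (fun _ => rfl)]

lemma condMutualInfo_comm {A : Ω → α} {B : Ω → β} {C : Ω → γ}
    (hA : Measurable A) (hB : Measurable B) (hC : Measurable C) :
    condMutualInfo μ A B C = condMutualInfo μ B A C := by
  have := Measure.isProbabilityMeasure_map (μ := μ) hC.aemeasurable
  rw [condMutualInfo, condMutualInfo,
    ← klDiv_map_of_leftInverse (g := fun p : γ × α × β => (p.1, p.2.2, p.2.1))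
      (f := fun p => (p.1, p.2.2, p.2.1)) _ _ (by fun_prop) (by fun_prop) (fun _ => rfl)]
  congr 1
  · rw [Measure.map_map (by fun_prop) (by fun_prop)]; rfl
  · refine Measure.ext_of_lintegral _ fun f hf => ?_
    rw [lintegral_map hf (by fun_prop), Measure.lintegral_compProd (by fun_prop),
      Measure.lintegral_compProd hf]
    refine lintegral_congr fun c => ?_
    rw [Kernel.lintegral_prod_symm _ _ _ (by fun_prop), Kernel.lintegral_prod _ _ _ (by fun_prop)]

lemma condDistrib_prod_ae_eq {A : Ω → α} {B : Ω → β} {C : Ω → γ}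
    (hA : Measurable A) (hB : Measurable B) (hC : Measurable C) :
    condDistrib (fun ω => (A ω, B ω)) C μ =ᵐ[μ.map C]
      condDistrib A C μ ⊗ₖ condDistrib B (fun ω => (C ω, A ω)) μ := by
  refine condDistrib_ae_eq_of_measure_eq_compProd C (by fun_prop) ?_
  rw [← Measure.compProd_assoc', compProd_map_condDistrib hA.aemeasurable,
    compProd_map_condDistrib hB.aemeasurable, Measure.map_map (by fun_prop) (by fun_prop)]
  rfl

/-- Invariance of the conditional mutual information under recodings of the condition. -/
lemma condMutualInfo_equiv_cond {A : Ω → α} {B : Ω → β} {C : Ω → γ}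
    (hA : Measurable A) (hB : Measurable B) (hC : Measurable C) (e : γ ≃ᵐ δ) :
    condMutualInfo μ A B (fun ω => e (C ω)) = condMutualInfo μ A B C := by
  rw [condMutualInfo_eq_klDiv μ hA hB (by fun_prop), condMutualInfo_eq_klDiv μ hA hB hC]
  have h1 : condDistrib A (fun ω => e (C ω)) μ =ᵐ[μ.map fun ω => e (C ω)]
      (condDistrib A C μ).comap e.symm e.symm.measurable := by
    refine condDistrib_ae_eq_of_measure_eq_compProd _ hA.aemeasurable ?_
    have : (μ.map fun ω => e (C ω)) = (μ.map C).map e := by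
      rw [Measure.map_map (by fun_prop) (by fun_prop)]; rfl
    rw [this, ← compProd_map_prod, compProd_map_condDistrib hA.aemeasurable,
      Measure.map_map (by fun_prop) (by fun_prop)]
    rfl
  rw [Measure.compProd_congr (ae_prodMkRight μ hB (by fun_prop) h1)]
  rw [← klDiv_map_of_leftInverse (g := fun p : (γ × β) × α => ((e p.1.1, p.1.2), p.2))
    (f := fun p => ((e.symm p.1.1, p.1.2), p.2)) _ _ (by fun_prop) (by fun_prop)
    (fun _ => by simp)]
  congr 1
  · rw [Measure.map_map (by fun_prop) (by fun_prop)]; rfl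
  · have := compProd_map_prod (μ.map fun ω => (C ω, B ω)) ((condDistrib A C μ).prodMkRight β)
      (e.prodCongr (MeasurableEquiv.refl β))
    rw [Measure.map_map (by fun_prop) (by fun_prop)] at this
    exact this.symm

/-- Invariance of the conditional mutual information under recodings of an argument. -/
lemma condMutualInfo_equiv_left {α' : Type*} [MeasurableSpace α'] [StandardBorelSpace α']
    [Nonempty α'] {A : Ω → α} {B : Ω → β} {C : Ω → γ}
    (hA : Measurable A) (hB : Measurable B) (hC : Measurable C) (e : α ≃ᵐ α') :
    condMutualInfo μ (fun ω => e (A ω)) B C = condMutualInfo μ A B C := by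
  rw [condMutualInfo_eq_klDiv μ (by fun_prop) hB hC, condMutualInfo_eq_klDiv μ hA hB hC]
  have h1 := ae_prodMkRight μ hB hC (condDistrib_comp (μ := μ) C hA.aemeasurable e.measurable)
  rw [Measure.compProd_congr (κ := (condDistrib (fun ω => e (A ω)) C μ).prodMkRight β) h1,
    ← Kernel.map_prodMkRight, Measure.compProd_map e.measurable,
    ← klDiv_map_of_leftInverse (g := (Prod.map id e : (γ × β) × α → (γ × β) × α'))
      (f := Prod.map id e.symm)
      (μ.map fun ω => ((C ω, B ω), A ω)) _ (by fun_prop) (by fun_prop)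
      (fun p => Prod.ext rfl (e.symm_apply_apply p.2)),
    Measure.map_map (by fun_prop) (by fun_prop)]
  rfl

/-- Chain rule for the conditional mutual information. -/
lemma condMutualInfo_chain {α' : Type*} [MeasurableSpace α'] [StandardBorelSpace α']
    [Nonempty α'] {A : Ω → α} {A' : Ω → α'} {B : Ω → β} {C : Ω → γ}
    (hA : Measurable A) (hA' : Measurable A') (hB : Measurable B) (hC : Measurable C) :
    condMutualInfo μ (fun ω => (A ω, A' ω)) B C =
      condMutualInfo μ A B C + condMutualInfo μ A' B (fun ω => (C ω, A ω)) := by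
  have := Measure.isProbabilityMeasure_map (μ := μ) (hC.prodMk hB).aemeasurable
  rw [condMutualInfo_eq_klDiv μ (by fun_prop) hB hC, condMutualInfo_eq_klDiv μ hA hB hC,
    condMutualInfo_eq_klDiv μ hA' hB (by fun_prop)]
  have h1 := ae_prodMkRight μ hB hC (condDistrib_prod_ae_eq μ hA hA' hC)
  rw [Measure.compProd_congr h1]
  let e : (γ × β) × α × α' → ((γ × β) × α) × α' := MeasurableEquiv.prodAssoc.symm
  let κ : Kernel ((γ × β) × α) α' :=
    (condDistrib A' (fun ω => (C ω, A ω)) μ).comap (fun p => (p.1.1, p.2)) (by fun_prop)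
  have he : Measurable e := MeasurableEquiv.prodAssoc.symm.measurable
  have h2 : ((μ.map fun ω => (C ω, B ω)) ⊗ₘ
      (condDistrib A C μ ⊗ₖ condDistrib A' (fun ω => (C ω, A ω)) μ).prodMkRight β).map e =
      ((μ.map fun ω => (C ω, B ω)) ⊗ₘ (condDistrib A C μ).prodMkRight β) ⊗ₘ κ := by
    rw [← Measure.compProd_assoc]
    congr 2
    ext p s hs
    rw [Kernel.prodMkRight_apply, Kernel.compProd_apply hs, Kernel.compProd_apply hs]
    rfl
  have h3 : (μ.map fun ω => ((C ω, B ω), (A ω, A' ω))).map e =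
      (μ.map fun ω => ((C ω, B ω), A ω)) ⊗ₘ
        condDistrib A' (fun ω => ((C ω, B ω), A ω)) μ := by
    rw [compProd_map_condDistrib hA'.aemeasurable, Measure.map_map he (by fun_prop)]
    rfl
  -- After reassociation both laws are composition products over ((C, B), A), so the divergence
  -- splits. The first summand is the information of `A`; the second becomes that of `A'` after the
  -- reordering `r`.
  rw [← klDiv_map_of_leftInverse (g := e) (f := MeasurableEquiv.prodAssoc) _ _ he
    MeasurableEquiv.prodAssoc.measurable (fun _ => rfl), h2, h3, klDiv_compProd_eq_add]
  congr 1
  rw [compProd_map_condDistrib hA'.aemeasurable]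
  let r : (γ × β) × α ≃ᵐ (γ × α) × β :=
    { toFun := fun p => ((p.1.1, p.2), p.1.2)
      invFun := fun p => ((p.1.1, p.2), p.1.2)
      left_inv := fun _ => rfl
      right_inv := fun _ => rfl
      measurable_toFun := by
        change Measurable fun p : (γ × β) × α => ((p.1.1, p.2), p.1.2)
        fun_prop
      measurable_invFun := by
        change Measurable fun p : (γ × α) × β => ((p.1.1, p.2), p.1.2)
        fun_prop }
  rw [← klDiv_map_of_leftInverse (g := Prod.map r id) (f := Prod.map r.symm id) _ _
    (by fun_prop) (by fun_prop) (fun _ => rfl), compProd_map_prod,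
    Measure.map_map (by fun_prop) (by fun_prop), Measure.map_map (by fun_prop) (by fun_prop)]
  rfl

/-- `I(A; B | C) = 0` if `A` is a function of `C` and of a noise independent of `(C, B)`. -/
lemma condMutualInfo_eq_zero {A : Ω → α} {B : Ω → β} {C : Ω → γ} {N : Ω → δ}
    (hA : Measurable A) (hB : Measurable B) (hC : Measurable C) (hN : Measurable N)
    {φ : γ × δ → α} (hφ : Measurable φ) (h : ∀ᵐ ω ∂μ, A ω = φ (C ω, N ω))
    (hind : IndepFun (fun ω => (C ω, B ω)) N μ) : condMutualInfo μ A B C = 0 := by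
  have := Measure.isProbabilityMeasure_map (μ := μ) (hC.prodMk hB).aemeasurable
  have h1 : condDistrib A C μ =ᵐ[μ.map C] funKernel φ (μ.map N) :=
    condDistrib_ae_eq_of_measure_eq_compProd _ hA.aemeasurable
      (map_prodMk_eq_compProd_funKernel hC hN hφ h (hind.comp measurable_fst measurable_id))
  rw [condMutualInfo_eq_klDiv μ hA hB hC, Measure.compProd_congr (ae_prodMkRight μ hB hC h1)]
  -- The same kernel disintegrates `A` over (C, B), because the noise is independent of the pair.
  have h2 := map_prodMk_eq_compProd_funKernel (hC.prodMk hB) hN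
    (φ := fun p => φ (p.1.1, p.2)) (by fun_prop) h hind
  rw [h2]
  have h3 : (funKernel φ (μ.map N)).prodMkRight β =
      funKernel (fun p : (γ × β) × δ => φ (p.1.1, p.2)) (μ.map N) := by
    ext p s hs
    rw [Kernel.prodMkRight_apply, ← lintegral_indicator_one hs, ← lintegral_indicator_one hs,
      lintegral_funKernel hφ _ _ (measurable_one.indicator hs),
      lintegral_funKernel (by fun_prop) _ _ (measurable_one.indicator hs)]
  rw [h3, klDiv_self]

/-- If, given `C = c`, the variable `A` is an injective function of a variable `Z` independent of
`C`, then `I(A; B | C)` is the mutual information of `Z` and `(C, B)`. -/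
lemma condMutualInfo_eq_klDiv_prod {A : Ω → α} {B : Ω → β} {C : Ω → γ} {Z : Ω → δ}
    (hA : Measurable A) (hB : Measurable B) (hC : Measurable C) (hZ : Measurable Z)
    {φ : γ × δ → α} (hφ : Measurable φ) {ψ : γ × α → δ} (hψ : Measurable ψ)
    (hψφ : ∀ c z, ψ (c, φ (c, z)) = z)
    (h : ∀ᵐ ω ∂μ, A ω = φ (C ω, Z ω)) (hind : IndepFun C Z μ) :
    condMutualInfo μ A B C = klDiv (μ.map fun ω => ((C ω, B ω), Z ω))
      ((μ.map fun ω => (C ω, B ω)).prod (μ.map Z)) := by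
  have := Measure.isProbabilityMeasure_map (μ := μ) (hC.prodMk hB).aemeasurable
  have h1 : condDistrib A C μ =ᵐ[μ.map C] funKernel φ (μ.map Z) :=
    condDistrib_ae_eq_of_measure_eq_compProd _ hA.aemeasurable
      (map_prodMk_eq_compProd_funKernel hC hZ hφ h hind)
  rw [condMutualInfo_eq_klDiv μ hA hB hC, Measure.compProd_congr (ae_prodMkRight μ hB hC h1)]
  have h3 : (funKernel φ (μ.map Z)).prodMkRight β =
      funKernel (fun p : (γ × β) × δ => φ (p.1.1, p.2)) (μ.map Z) := by
    ext p s hs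
    rw [Kernel.prodMkRight_apply, ← lintegral_indicator_one hs, ← lintegral_indicator_one hs,
      lintegral_funKernel hφ _ _ (measurable_one.indicator hs),
      lintegral_funKernel (by fun_prop) _ _ (measurable_one.indicator hs)]
  rw [h3, compProd_funKernel _ (by fun_prop)]
  have h4 : (μ.map fun ω => ((C ω, B ω), A ω)) =
      (μ.map fun ω => ((C ω, B ω), Z ω)).map (fun p => (p.1, φ (p.1.1, p.2))) := by
    rw [Measure.map_map (by fun_prop) (by fun_prop)]
    refine Measure.map_congr ?_
    filter_upwards [h] with ω h
    simp [h]
  -- `ψ` recovers z from (c, a), so exchanging `A` for `Z` loses nothing.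
  rw [h4, klDiv_map_of_leftInverse (f := fun p => (p.1, ψ (p.1.1, p.2))) _ _ (by fun_prop)
    (by fun_prop) (fun p => by simp [hψφ])]

/-- The decomposition of the objective into two mutual informations in which the conditioning
variables have no auxiliary component. -/
lemma condMutualInfo_add_eq {α' β' β'' : Type*} [MeasurableSpace α'] [MeasurableSpace β']
    [MeasurableSpace β''] [StandardBorelSpace α'] [Nonempty α'] [StandardBorelSpace β']
    [Nonempty β'] [StandardBorelSpace β''] [Nonempty β'']
    {X : Ω → α} {Y : Ω → α'} {Y₁ : Ω → β} {G₁ : Ω → β'} {G₂ : Ω → β''}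
    (hX : Measurable X) (hY : Measurable Y) (hY₁ : Measurable Y₁) (hG₁ : Measurable G₁)
    (hG₂ : Measurable G₂)
    (h1 : condMutualInfo μ Y G₁ (fun ω => (Y₁ ω, X ω)) = 0)
    (h2 : condMutualInfo μ Y₁ X (fun ω => (Y ω, G₁ ω)) = 0)
    (h3 : condMutualInfo μ Y₁ X Y = 0) :
    condMutualInfo μ X G₁ Y₁ + condMutualInfo μ X G₂ (fun ω => (Y ω, G₁ ω)) =
      condMutualInfo μ Y G₁ Y₁ + condMutualInfo μ X (fun ω => (G₁ ω, G₂ ω)) Y := by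
  -- `e1` and `e2` expand I(X, Y; G₁ | Y₁) in the two orders, `e4` and `e5` do the same for I(G₁,
  -- Y₁; X | Y). Dropping the vanishing terms leaves I(X; G₁ | Y₁) = I(Y; G₁ | Y₁) + I(X; G₁ | Y),
  -- and `e8` merges the last term with that of `G₂`.
  have e1 := condMutualInfo_chain μ hX hY hG₁ hY₁
  have e2 := condMutualInfo_chain μ hY hX hG₁ hY₁
  have e3 : condMutualInfo μ (fun ω => (X ω, Y ω)) G₁ Y₁ =
      condMutualInfo μ (fun ω => (Y ω, X ω)) G₁ Y₁ :=
    condMutualInfo_equiv_left μ (hY.prodMk hX) hG₁ hY₁ MeasurableEquiv.prodComm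
  have e4 := condMutualInfo_chain μ hG₁ hY₁ hX hY
  have e5 := condMutualInfo_chain μ hY₁ hG₁ hX hY
  have e6 : condMutualInfo μ (fun ω => (G₁ ω, Y₁ ω)) X Y =
      condMutualInfo μ (fun ω => (Y₁ ω, G₁ ω)) X Y :=
    condMutualInfo_equiv_left μ (hY₁.prodMk hG₁) hX hY MeasurableEquiv.prodComm
  have e7 : condMutualInfo μ G₁ X (fun ω => (Y ω, Y₁ ω)) =
      condMutualInfo μ G₁ X (fun ω => (Y₁ ω, Y ω)) :=
    condMutualInfo_equiv_cond μ hG₁ hX (hY₁.prodMk hY) MeasurableEquiv.prodComm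
  have e8 := condMutualInfo_chain μ hG₁ hG₂ hX hY
  rw [h1, add_zero] at e1
  rw [h2, add_zero] at e4
  rw [h3, zero_add] at e5
  rw [condMutualInfo_comm μ hX (hG₁.prodMk hG₂) hY, e8, ← e1, e3, e2,
    condMutualInfo_comm μ hX hG₁ (hY₁.prodMk hY), ← e7, ← e5, ← e6, e4,
    condMutualInfo_comm μ hX hG₂ (hY.prodMk hG₁), add_assoc]

end Info

/-! ### Mutual information with a standard Gaussian vector, bounded by error variances. -/

section GaussianKL

open Real NNReal

/-- The logarithm of the density of `N(t, τ)` with respect to `N(0, 1)`. -/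
def gaussianLogRatio (t τ x : ℝ) : ℝ := x ^ 2 / 2 - (x - t) ^ 2 / (2 * τ) - log τ / 2

lemma measurable_gaussianLogRatio {α : Type*} [MeasurableSpace α] {f g : α → ℝ} (τ : ℝ)
    (hf : Measurable f) (hg : Measurable g) :
    Measurable fun a => gaussianLogRatio (f a) τ (g a) := by
  unfold gaussianLogRatio; fun_prop

lemma withDensity_gaussianLogRatio (t : ℝ) {τ : ℝ≥0} (hτ : τ ≠ 0) :
    (gaussianReal 0 1).withDensity (fun x => ENNReal.ofReal (exp (gaussianLogRatio t τ x))) =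
      gaussianReal t τ := by
  have hτ' : 0 < (τ : ℝ) := by positivity
  rw [gaussianReal_of_var_ne_zero 0 one_ne_zero, gaussianReal_of_var_ne_zero t hτ,
    ← withDensity_mul _ (measurable_gaussianPDF 0 1)
      (measurable_gaussianLogRatio _ measurable_const measurable_id').exp.ennreal_ofReal]
  congr 1
  ext x
  rw [Pi.mul_apply, gaussianPDF, gaussianPDF, ← ENNReal.ofReal_mul (gaussianPDFReal_nonneg _ _ _)]
  congr 1
  rw [gaussianPDFReal, gaussianPDFReal, mul_assoc, ← exp_add, gaussianLogRatio]
  have h1 : √(2 * π * τ) = √(2 * π) * √τ := by rw [Real.sqrt_mul (by positivity)]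
  have h2 : √(τ : ℝ) = exp (log τ / 2) := by
    rw [Real.sqrt_eq_rpow, Real.rpow_def_of_pos hτ']; ring_nf
  rw [h1, h2, mul_inv, ← Real.exp_neg, mul_assoc (√(2 * π))⁻¹, ← exp_add]
  simp only [NNReal.coe_one, mul_one]
  congr 2
  ring

variable {ι : Type*} [Fintype ι]

lemma lintegral_pi_prod {ρ : ι → Measure ℝ} [∀ i, IsProbabilityMeasure (ρ i)]
    {f : ι → ℝ → ℝ≥0∞} (hf : ∀ i, Measurable (f i)) :
    ∫⁻ x, ∏ i, f i (x i) ∂(Measure.pi ρ) = ∏ i, ∫⁻ x, f i x ∂(ρ i) := by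
  have h1 : iIndepFun (fun i (x : ι → ℝ) => f i (x i)) (Measure.pi ρ) :=
    iIndepFun_pi (X := f) fun i => (hf i).aemeasurable
  rw [lintegral_prod_eq_prod_lintegral_of_indepFun _ _ h1
    (fun i => (hf i).comp (measurable_pi_apply i))]
  refine Finset.prod_congr rfl fun i _ => ?_
  exact (measurePreserving_eval ρ i).lintegral_comp (hf i)

lemma withDensity_pi_gaussianLogRatio (t : ι → ℝ) {τ : ι → ℝ≥0} (hτ : ∀ i, τ i ≠ 0) :
    (Measure.pi fun _ : ι => gaussianReal 0 1).withDensity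
        (fun x => ENNReal.ofReal (exp (∑ i, gaussianLogRatio (t i) (τ i) (x i)))) =
      Measure.pi fun i => gaussianReal (t i) (τ i) := by
  symm
  refine Measure.pi_eq fun s hs => ?_
  rw [withDensity_apply _ (MeasurableSet.univ_pi hs),
    ← lintegral_indicator (MeasurableSet.univ_pi hs)]
  have h1 : ∀ x : ι → ℝ, (Set.univ.pi s).indicator
      (fun x => ENNReal.ofReal (exp (∑ i, gaussianLogRatio (t i) (τ i) (x i)))) x =
      ∏ i, (s i).indicator (fun y => ENNReal.ofReal (exp (gaussianLogRatio (t i) (τ i) y)))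
        (x i) := by
    intro x
    by_cases hx : x ∈ Set.univ.pi s
    · rw [Set.indicator_of_mem hx, exp_sum, ENNReal.ofReal_prod_of_nonneg fun i _ => (exp_pos _).le]
      refine Finset.prod_congr rfl fun i _ => ?_
      rw [Set.indicator_of_mem (hx i trivial)]
    · rw [Set.indicator_of_notMem hx]
      simp only [Set.mem_univ_pi, not_forall] at hx
      obtain ⟨i, hi⟩ := hx
      rw [Finset.prod_eq_zero (Finset.mem_univ i) (Set.indicator_of_notMem hi _)]
  have hm : ∀ i, Measurable fun y => ENNReal.ofReal (exp (gaussianLogRatio (t i) (τ i) y)) :=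
    fun i => (measurable_gaussianLogRatio _ measurable_const measurable_id).exp.ennreal_ofReal
  simp_rw [h1]
  rw [lintegral_pi_prod fun i => (hm i).indicator (hs i)]
  refine Finset.prod_congr rfl fun i _ => ?_
  rw [lintegral_indicator (hs i), ← withDensity_apply _ (hs i),
    withDensity_gaussianLogRatio _ (hτ i)]

variable {𝒢 : Type*} [MeasurableSpace 𝒢]

lemma map_const_add_pi_gaussianReal (t : ι → ℝ) (τ : ι → ℝ≥0) :
    (Measure.pi fun i => gaussianReal 0 (τ i)).map (fun n => t + n) =
      Measure.pi fun i => gaussianReal (t i) (τ i) := by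
  have h := Measure.pi_map_pi (μ := fun i => gaussianReal 0 (τ i))
    (f := fun i x => t i + x) (fun i => by fun_prop)
  simp_rw [gaussianReal_map_const_add, zero_add] at h
  exact h

lemma measurable_exp_sum_gaussianLogRatio {t : 𝒢 → ι → ℝ} (ht : Measurable t) (τ : ι → ℝ≥0) :
    Measurable fun p : 𝒢 × (ι → ℝ) =>
      ENNReal.ofReal (exp (∑ i, gaussianLogRatio (t p.1 i) (τ i) (p.2 i))) :=
  (Finset.measurable_sum _ fun i _ => measurable_gaussianLogRatio _ (by fun_prop)
    (by fun_prop)).exp.ennreal_ofReal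

lemma lintegral_pi_gaussianLogRatio (t : ι → ℝ) {τ : ι → ℝ≥0} (hτ : ∀ i, τ i ≠ 0)
    {f : (ι → ℝ) → ℝ≥0∞} (hf : Measurable f) :
    ∫⁻ x, ENNReal.ofReal (exp (∑ i, gaussianLogRatio (t i) (τ i) (x i))) * f x
        ∂(Measure.pi fun _ : ι => gaussianReal 0 1) =
      ∫⁻ n, f (t + n) ∂(Measure.pi fun i => gaussianReal 0 (τ i)) := by
  have hm : Measurable fun x : ι → ℝ =>
      ENNReal.ofReal (exp (∑ i, gaussianLogRatio (t i) (τ i) (x i))) :=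
    (Finset.measurable_sum _ fun i _ => measurable_gaussianLogRatio _ measurable_const
      (measurable_pi_apply i)).exp.ennreal_ofReal
  have h2 := lintegral_withDensity_eq_lintegral_mul
    (Measure.pi fun _ : ι => gaussianReal 0 1) hm hf
  have h3 := lintegral_map (μ := Measure.pi fun i => gaussianReal 0 (τ i)) hf
    (g := fun n => t + n) (by fun_prop)
  rw [withDensity_pi_gaussianLogRatio _ hτ, ← map_const_add_pi_gaussianReal, h3] at h2
  exact h2.symm

/-- Relative to the product law, the exponential of the summed log ratio is the density of (g, t(g)
+ N) with `N` independent of g. In particular it integrates to one whatever `t` is. -/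
lemma withDensity_prod_gaussianLogRatio (ρ : Measure 𝒢) [IsProbabilityMeasure ρ]
    {t : 𝒢 → ι → ℝ} (ht : Measurable t) {τ : ι → ℝ≥0} (hτ : ∀ i, τ i ≠ 0) :
    (ρ.prod (Measure.pi fun _ : ι => gaussianReal 0 1)).withDensity
        (fun p => ENNReal.ofReal (exp (∑ i, gaussianLogRatio (t p.1 i) (τ i) (p.2 i)))) =
      (ρ.prod (Measure.pi fun i => gaussianReal 0 (τ i))).map (fun p => (p.1, t p.1 + p.2)) := by
  have hm := measurable_exp_sum_gaussianLogRatio ht τ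
  have hg : Measurable fun p : 𝒢 × (ι → ℝ) => (p.1, t p.1 + p.2) := by fun_prop
  refine Measure.ext_of_lintegral _ fun f hf => ?_
  have hfg : Measurable fun p : 𝒢 × (ι → ℝ) => f (p.1, t p.1 + p.2) := hf.comp hg
  rw [lintegral_map hf hg, lintegral_withDensity_eq_lintegral_mul _ hm hf,
    lintegral_prod _ (hm.mul hf).aemeasurable, lintegral_prod _ hfg.aemeasurable]
  refine lintegral_congr fun g => ?_
  exact lintegral_pi_gaussianLogRatio (t g) hτ (hf.comp measurable_prodMk_left)

/-- Converts the normalization of a density e^F into the hypotheses of the Donsker-Varadhan bound,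
and identifies tilting by `F` with that density. -/
lemma integrable_exp_and_tilted {α : Type*} [MeasurableSpace α] {Q : Measure α} {F : α → ℝ}
    (hF : Measurable F)
    (h : IsProbabilityMeasure (Q.withDensity fun x => ENNReal.ofReal (exp (F x)))) :
    Integrable (fun x => exp (F x)) Q ∧ ∫ x, exp (F x) ∂Q = 1 ∧
      Q.tilted F = Q.withDensity fun x => ENNReal.ofReal (exp (F x)) := by
  have h1 : ∫⁻ x, ENNReal.ofReal (exp (F x)) ∂Q = 1 := by
    have := h.measure_univ
    rwa [withDensity_apply _ MeasurableSet.univ, Measure.restrict_univ] at this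
  have h2 : Integrable (fun x => exp (F x)) Q :=
    ⟨hF.exp.aestronglyMeasurable, by
      rw [hasFiniteIntegral_iff_ofReal (Filter.Eventually.of_forall fun x => (exp_pos _).le), h1]
      exact ENNReal.one_lt_top⟩
  have h3 : ∫ x, exp (F x) ∂Q = 1 := by
    rw [integral_eq_lintegral_of_nonneg_ae (Filter.Eventually.of_forall fun x => (exp_pos _).le)
      hF.exp.aestronglyMeasurable, h1, ENNReal.toReal_one]
  refine ⟨h2, h3, ?_⟩
  rw [Measure.tilted, h3]
  simp

/-- The Donsker-Varadhan lower bound. -/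
lemma integral_le_klDiv_of_integral_exp {α : Type*} [MeasurableSpace α] {P Q : Measure α}
    [IsProbabilityMeasure P] [IsProbabilityMeasure Q] {F : α → ℝ} (hFP : Integrable F P)
    (hFQ : Integrable (fun x => exp (F x)) Q) (h1 : ∫ x, exp (F x) ∂Q = 1) :
    ENNReal.ofReal (∫ x, F x ∂P) ≤ klDiv P Q := by
  by_cases h : klDiv P Q = ∞
  · simp [h]
  obtain ⟨hac, hint⟩ := klDiv_ne_top_iff.1 h
  have := isProbabilityMeasure_tilted hFQ
  have h2 := integral_llr_tilted_right hac hFP hFQ hint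
  have h3 := integral_llr_add_sub_measure_univ_nonneg
    (hac.trans (absolutelyContinuous_tilted hFQ))
    (integrable_llr_tilted_right hac hFP hint hFQ)
  rw [klDiv_of_ac_of_integrable hac hint]
  apply ENNReal.ofReal_le_ofReal
  simp only [probReal_univ] at h3 ⊢
  rw [h1, log_one] at h2
  linarith

/-- The case of equality in the Donsker-Varadhan bound: `F` is the log-likelihood ratio itself. -/
lemma klDiv_tilted_self {α : Type*} [MeasurableSpace α] {Q : Measure α}
    [IsProbabilityMeasure Q] {F : α → ℝ}
    (hFQ : Integrable (fun x => exp (F x)) Q) (h1 : ∫ x, exp (F x) ∂Q = 1)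
    (hF : Integrable F (Q.tilted F)) :
    klDiv (Q.tilted F) Q = ENNReal.ofReal (∫ x, F x ∂(Q.tilted F)) := by
  have := isProbabilityMeasure_tilted hFQ
  have hac := tilted_absolutelyContinuous Q F
  have h2 : llr (Q.tilted F) Q =ᵐ[Q.tilted F] F := by
    filter_upwards [hac.ae_le (log_rnDeriv_tilted_left_self hFQ)] with x hx
    rw [llr, hx, h1, log_one, sub_zero]
  rw [klDiv_of_ac_of_integrable hac ((integrable_congr h2).2 hF), integral_congr_ae h2]
  simp

variable {Ω : Type*} {mΩ : MeasurableSpace Ω} {μ : Measure Ω}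

lemma memLp_of_law_pi {Z : Ω → ι → ℝ} (hZ : Measurable Z) {ρ : ι → ℝ≥0}
    (hlaw : μ.map Z = Measure.pi fun i => gaussianReal 0 (ρ i)) (i : ι) :
    MemLp (fun ω => Z ω i) 2 μ ∧ ∫ ω, Z ω i ∂μ = 0 ∧ ∫ ω, Z ω i ^ 2 ∂μ = ρ i ∧
      μ.map (fun ω => Z ω i) = gaussianReal 0 (ρ i) := by
  have h1 : μ.map (fun ω => Z ω i) = gaussianReal 0 (ρ i) := by
    have := (measurePreserving_eval (fun i => gaussianReal 0 (ρ i)) i).map_eq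
    rw [← hlaw, Measure.map_map (by fun_prop) hZ] at this
    exact this
  have hm : Measurable fun ω => Z ω i := by fun_prop
  have h0 : ∫ ω, Z ω i ∂μ = 0 := by
    rw [← integral_map (f := fun x : ℝ => x) hm.aemeasurable (by fun_prop), h1,
      integral_id_gaussianReal]
  refine ⟨?_, h0, ?_, h1⟩
  · have := memLp_id_gaussianReal' (μ := 0) (v := ρ i) 2 (by simp)
    rw [← h1, memLp_map_measure_iff (by fun_prop) hm.aemeasurable] at this
    exact this
  · have := variance_fun_id_gaussianReal (μ := 0) (v := ρ i)
    rw [← h1, variance_map (by fun_prop) hm.aemeasurable] at this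
    rw [← this]
    exact (variance_of_integral_eq_zero hm.aemeasurable h0).symm

variable [IsProbabilityMeasure μ]

/-- Only the second moments E[Zᵢ²] = 1 and E[(Zᵢ - tᵢ)²] = τᵢ enter: each summand has mean 1/2 - 1/2
- (log τᵢ)/2. Gaussian and non-Gaussian laws with the same error variances thus give the same value.
-/
lemma integral_sum_gaussianLogRatio {G : Ω → 𝒢} {Z : Ω → ι → ℝ} (hG : Measurable G)
    (hZ : Measurable Z) (hlaw : μ.map Z = Measure.pi fun _ => gaussianReal 0 1)
    {t : 𝒢 → ι → ℝ} (ht : Measurable t) {τ : ι → ℝ≥0}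
    (hL : ∀ i, MemLp (fun ω => t (G ω) i) 2 μ)
    (hτ : ∀ i, ∫ ω, (Z ω i - t (G ω) i) ^ 2 ∂μ = τ i) (hτ0 : ∀ i, τ i ≠ 0) :
    Integrable (fun p : 𝒢 × (ι → ℝ) => ∑ i, gaussianLogRatio (t p.1 i) (τ i) (p.2 i))
        (μ.map fun ω => (G ω, Z ω)) ∧
      ∫ p, ∑ i, gaussianLogRatio (t p.1 i) (τ i) (p.2 i) ∂(μ.map fun ω => (G ω, Z ω)) =
        ∑ i, -(log (τ i) / 2) := by
  have hm : Measurable fun p : 𝒢 × (ι → ℝ) => ∑ i, gaussianLogRatio (t p.1 i) (τ i) (p.2 i) :=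
    Finset.measurable_sum _ fun i _ => measurable_gaussianLogRatio _ (by fun_prop) (by fun_prop)
  have hZL := memLp_of_law_pi hZ (ρ := fun _ => 1) hlaw
  have h1 : ∀ i, Integrable (fun ω => Z ω i ^ 2 / 2) μ := fun i =>
    (hZL i).1.integrable_sq.div_const 2
  have h2 : ∀ i, Integrable (fun ω => (Z ω i - t (G ω) i) ^ 2 / (2 * (τ i : ℝ))) μ := fun i =>
    ((hZL i).1.sub (hL i)).integrable_sq.div_const _
  have h3 : ∀ i, Integrable (fun ω => gaussianLogRatio (t (G ω) i) (τ i) (Z ω i)) μ := fun i =>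
    ((h1 i).sub (h2 i)).sub (integrable_const _)
  constructor
  · rw [integrable_map_measure hm.aestronglyMeasurable (by fun_prop)]
    exact integrable_finsetSum _ fun i _ => h3 i
  · rw [integral_map (by fun_prop) hm.aestronglyMeasurable, integral_finsetSum _ fun i _ => h3 i]
    refine Finset.sum_congr rfl fun i _ => ?_
    have hτ' : (τ i : ℝ) ≠ 0 := by exact_mod_cast hτ0 i
    simp only [gaussianLogRatio]
    have h12 : Integrable (fun ω => Z ω i ^ 2 / 2 - (Z ω i - t (G ω) i) ^ 2 / (2 * (τ i : ℝ))) μ :=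
      (h1 i).sub (h2 i)
    rw [integral_sub h12 (integrable_const _), integral_sub (h1 i) (h2 i),
      integral_div, integral_div, (hZL i).2.2.1, hτ i]
    simp
    field_simp
    ring

/-- Among all joint laws with the same error variances, the Gaussian one minimizes the mutual
information with a standard Gaussian vector. -/
lemma le_klDiv_of_errorVariance {G : Ω → 𝒢} {Z : Ω → ι → ℝ} (hG : Measurable G)
    (hZ : Measurable Z) (hlaw : μ.map Z = Measure.pi fun _ => gaussianReal 0 1)
    {t : 𝒢 → ι → ℝ} (ht : Measurable t) {τ : ι → ℝ≥0}
    (hL : ∀ i, MemLp (fun ω => t (G ω) i) 2 μ)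
    (hτ : ∀ i, ∫ ω, (Z ω i - t (G ω) i) ^ 2 ∂μ = τ i) (hτ0 : ∀ i, τ i ≠ 0) :
    ENNReal.ofReal (∑ i, -(log (τ i) / 2)) ≤
      klDiv (μ.map fun ω => (G ω, Z ω)) ((μ.map G).prod (μ.map Z)) := by
  have := Measure.isProbabilityMeasure_map (μ := μ) hG.aemeasurable
  have := Measure.isProbabilityMeasure_map (μ := μ) hZ.aemeasurable
  have := Measure.isProbabilityMeasure_map (μ := μ) (hG.prodMk hZ).aemeasurable
  have h1 := integral_sum_gaussianLogRatio hG hZ hlaw ht hL hτ hτ0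
  have h2 := withDensity_prod_gaussianLogRatio (μ.map G) ht hτ0
  have hm : Measurable fun p : 𝒢 × (ι → ℝ) => ∑ i, gaussianLogRatio (t p.1 i) (τ i) (p.2 i) :=
    Finset.measurable_sum _ fun i _ => measurable_gaussianLogRatio _ (by fun_prop) (by fun_prop)
  have h3 := integrable_exp_and_tilted hm (by
    rw [h2]; exact Measure.isProbabilityMeasure_map (by fun_prop))
  rw [← hlaw] at h3
  rw [← h1.2]
  exact integral_le_klDiv_of_integral_exp h1.1 h3.1 h3.2.1

/-- The joint law is exactly the tilted product law here, so the bound of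
`le_klDiv_of_errorVariance` is attained. -/
lemma klDiv_eq_of_gaussian_error {G : Ω → 𝒢} {Z N : Ω → ι → ℝ} (hG : Measurable G)
    (hZ : Measurable Z) (hlaw : μ.map Z = Measure.pi fun _ => gaussianReal 0 1)
    {t : 𝒢 → ι → ℝ} (ht : Measurable t) {τ : ι → ℝ≥0} (hτ0 : ∀ i, τ i ≠ 0)
    (hN : Measurable N) (hZN : ∀ ω, Z ω = t (G ω) + N ω) (hind : IndepFun G N μ)
    (hNlaw : μ.map N = Measure.pi fun i => gaussianReal 0 (τ i)) :
    klDiv (μ.map fun ω => (G ω, Z ω)) ((μ.map G).prod (μ.map Z)) =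
      ENNReal.ofReal (∑ i, -(log (τ i) / 2)) := by
  have := Measure.isProbabilityMeasure_map (μ := μ) hG.aemeasurable
  have := Measure.isProbabilityMeasure_map (μ := μ) hZ.aemeasurable
  have hNL := memLp_of_law_pi hN hNlaw
  have hZL := memLp_of_law_pi hZ (ρ := fun _ => 1) hlaw
  have ht' : ∀ ω i, t (G ω) i = Z ω i - N ω i := fun ω i => by simp [hZN]
  have h1 := integral_sum_gaussianLogRatio hG hZ hlaw ht (τ := τ)
    (fun i => by simp_rw [ht']; exact (hZL i).1.sub (hNL i).1)
    (fun i => by simp_rw [ht', sub_sub_cancel]; exact (hNL i).2.2.1) hτ0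
  have h2 := withDensity_prod_gaussianLogRatio (μ.map G) ht hτ0
  have hm : Measurable fun p : 𝒢 × (ι → ℝ) => ∑ i, gaussianLogRatio (t p.1 i) (τ i) (p.2 i) :=
    Finset.measurable_sum _ fun i _ => measurable_gaussianLogRatio _ (by fun_prop) (by fun_prop)
  have h3 := integrable_exp_and_tilted hm (by
    rw [h2]; exact Measure.isProbabilityMeasure_map (by fun_prop))
  have h4 : μ.map (fun ω => (G ω, Z ω)) = ((μ.map G).prod (μ.map Z)).tilted
      (fun p => ∑ i, gaussianLogRatio (t p.1 i) (τ i) (p.2 i)) := by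
    rw [hlaw, h3.2.2, h2, ← hNlaw,
      ← hind.map_prod_eq_prod_map_map hG.aemeasurable hN.aemeasurable,
      Measure.map_map (by fun_prop) (by fun_prop)]
    congr 1
    ext1 ω
    simp [hZN]
  rw [← hlaw] at h3
  rw [h4] at h1 ⊢
  rw [klDiv_tilted_self h3.1 h3.2.1 h1.1, h1.2]

/-- Finite mutual information with a standard Gaussian vector forces positive error variances. -/
lemma errorVariance_ne_zero {G : Ω → 𝒢} {Z : Ω → ι → ℝ} (hG : Measurable G)
    (hZ : Measurable Z) (hlaw : μ.map Z = Measure.pi fun _ => gaussianReal 0 1)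
    {t : 𝒢 → ι → ℝ} (ht : Measurable t) (hL : ∀ i, MemLp (fun ω => t (G ω) i) 2 μ)
    (hfin : klDiv (μ.map fun ω => (G ω, Z ω)) ((μ.map G).prod (μ.map Z)) ≠ ∞) (i : ι) :
    ∫ ω, (Z ω i - t (G ω) i) ^ 2 ∂μ ≠ 0 := by
  have := Measure.isProbabilityMeasure_map (μ := μ) hG.aemeasurable
  have := Measure.isProbabilityMeasure_map (μ := μ) hZ.aemeasurable
  have := Measure.isProbabilityMeasure_map (μ := μ) (hG.prodMk hZ).aemeasurable
  intro h0
  have hZL := memLp_of_law_pi hZ (ρ := fun _ => 1) hlaw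
  have hsq : Integrable (fun ω => (Z ω i - t (G ω) i) ^ 2) μ :=
    ((hZL i).1.sub (hL i)).integrable_sq
  rw [integral_eq_zero_iff_of_nonneg (fun ω => sq_nonneg _) hsq] at h0
  -- Zero error variance would concentrate the joint law on the graph {zᵢ = tᵢ(g)}. This graph is
  -- null for the product law, since `Zᵢ` has no atoms, so absolute continuity would fail and the
  -- divergence would be infinite.
  have hs : MeasurableSet {p : 𝒢 × (ι → ℝ) | p.2 i = t p.1 i} :=
    measurableSet_eq_fun (by fun_prop) (by fun_prop)
  have h1 : (μ.map fun ω => (G ω, Z ω)) {p | p.2 i = t p.1 i} = 1 := by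
    rw [prob_compl_eq_zero_iff hs |>.symm, Measure.map_apply (by fun_prop) hs.compl]
    refine measure_mono_null ?_ h0
    intro ω hω hω'
    apply hω
    have : (Z ω i - t (G ω) i) ^ 2 = 0 := hω'
    simp only [Set.mem_ofPred_eq]
    linarith [pow_eq_zero_iff (two_ne_zero) |>.1 this]
  have h2 : ((μ.map G).prod (μ.map Z)) {p | p.2 i = t p.1 i} = 0 := by
    rw [Measure.prod_apply hs]
    refine (lintegral_congr fun g => ?_).trans lintegral_zero
    have : (Prod.mk g ⁻¹' {p : 𝒢 × (ι → ℝ) | p.2 i = t p.1 i}) =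
        (fun z : ι → ℝ => z i) ⁻¹' {t g i} := rfl
    rw [this, Measure.map_apply hZ ((measurableSet_singleton _).preimage (by fun_prop))]
    have h3 := (hZL i).2.2.2
    have h4 : (μ.map fun ω => Z ω i) {t g i} = 0 := by
      rw [h3]
      have := nullSingletonClass_gaussianReal (μ := 0) (v := 1) one_ne_zero
      exact measure_singleton _
    rw [Measure.map_apply (by fun_prop) (measurableSet_singleton _)] at h4
    exact h4
  have h3 := (klDiv_ne_top_iff.1 hfin).1 h2
  rw [h3] at h1
  exact zero_ne_one h1

end GaussianKL

/-! ### Factorization and simultaneous diagonalization of covariance matrices. -/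

section LinearAlgebra

open Matrix

lemma exists_diagonalization {σ : Type} [Fintype σ] [DecidableEq σ] {A : Matrix σ σ ℝ}
    (hA : Aᵀ = A) : ∃ (O : Matrix σ σ ℝ) (d : σ → ℝ),
      Oᵀ * O = 1 ∧ O * Oᵀ = 1 ∧ Oᵀ * A * O = diagonal d ∧ A = O * diagonal d * Oᵀ ∧
      (A.PosSemidef → ∀ i, 0 ≤ d i) := by
  have hH : A.IsHermitian := by rw [IsHermitian, conjTranspose_eq_transpose_of_trivial, hA]
  let O : Matrix σ σ ℝ := hH.eigenvectorUnitary
  have h1 : Oᵀ * O = 1 := by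
    have := Unitary.coe_star_mul_self hH.eigenvectorUnitary
    rwa [star_eq_conjTranspose, conjTranspose_eq_transpose_of_trivial] at this
  have h2 : O * Oᵀ = 1 := by
    have := Unitary.coe_mul_star_self hH.eigenvectorUnitary
    rwa [Unitary.coe_star, star_eq_conjTranspose, conjTranspose_eq_transpose_of_trivial] at this
  have h3 : A = O * diagonal hH.eigenvalues * Oᵀ := by
    have := hH.spectral_theorem
    rw [Unitary.conjStarAlgAut_apply, star_eq_conjTranspose,
      conjTranspose_eq_transpose_of_trivial] at this
    exact this
  refine ⟨O, hH.eigenvalues, h1, h2, ?_, h3, fun h => h.eigenvalues_nonneg⟩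
  calc Oᵀ * A * O = Oᵀ * (O * diagonal hH.eigenvalues * Oᵀ) * O := congrArg (Oᵀ * · * O) h3
    _ = (Oᵀ * O) * diagonal hH.eigenvalues * (Oᵀ * O) := by simp only [Matrix.mul_assoc]
    _ = _ := by rw [h1]; simp

/-- Discard the zero eigenvalues in K = O diag(d) Oᵀ: the columns of `S` are the remaining
eigenvectors scaled by √d, and `P` scales them by 1/√d. Since `r` indexes the nonzero eigenvalues
only, degenerate covariances need no separate treatment. -/
lemma exists_factorization {σ : Type} [Fintype σ] [DecidableEq σ] {K : Matrix σ σ ℝ}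
    (hK : K.PosSemidef) : ∃ (r : Type) (_ : Fintype r) (_ : DecidableEq r) (S : Matrix σ r ℝ)
      (P : Matrix r σ ℝ), P * S = 1 ∧ S * Sᵀ = K := by
  obtain ⟨O, d, h1, -, -, h4, h5⟩ := exists_diagonalization (A := K) (by
    have := hK.isHermitian
    rwa [IsHermitian, conjTranspose_eq_transpose_of_trivial] at this)
  have hd := h5 hK
  classical
  refine ⟨{i // d i ≠ 0}, inferInstance, inferInstance, of fun i s => O i s * √(d s),
    of fun s j => (√(d s))⁻¹ * O j s, ?_, ?_⟩
  · ext s s'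
    have h := congrFun (congrFun h1 s) s'
    simp only [mul_apply, transpose_apply, of_apply, one_apply] at h ⊢
    calc ∑ j, (√(d s))⁻¹ * O j s * (O j s' * √(d s'))
        = (√(d s))⁻¹ * √(d s') * ∑ j, O j s * O j s' := by
          rw [Finset.mul_sum]; exact Finset.sum_congr rfl fun j _ => by ring
      _ = _ := by
          rw [h]
          by_cases hs : s = s'
          · subst hs
            have : √(d s) ≠ 0 := (Real.sqrt_pos.2 (lt_of_le_of_ne (hd s) (Ne.symm s.2))).ne'
            simp [this]
          · simp [hs, Subtype.coe_injective.ne hs]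
  · conv_rhs => rw [h4]
    ext i j
    rw [mul_apply, mul_apply, ← Fintype.sum_subtype_add_sum_subtype (fun s => d s ≠ 0)]
    simp only [mul_diagonal, transpose_apply, of_apply]
    have h0 : ∑ s : {s // ¬ d s ≠ 0}, O i s * d s * O j s = 0 :=
      Finset.sum_eq_zero fun s _ => by simp [not_not.1 s.2]
    rw [h0, add_zero]
    refine Finset.sum_congr rfl fun s _ => ?_
    rw [← Real.mul_self_sqrt (hd s)]
    simp only [Real.sqrt_mul_self (Real.sqrt_nonneg _)]
    ring

/-- Simultaneous reduction of a positive semidefinite matrix to the identity on its range and of a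
symmetric matrix to a diagonal one. -/
lemma exists_simultaneous_diagonalization {σ : Type} [Fintype σ] [DecidableEq σ]
    {K A : Matrix σ σ ℝ} (hK : K.PosSemidef) (hA : Aᵀ = A) :
    ∃ (r : Type) (_ : Fintype r) (_ : DecidableEq r) (S : Matrix σ r ℝ) (P : Matrix r σ ℝ)
      (d : r → ℝ), P * S = 1 ∧ S * Sᵀ = K ∧ P * A * Pᵀ = diagonal d := by
  obtain ⟨r, i1, i2, S, P, h1, h2⟩ := exists_factorization hK
  obtain ⟨O, d, h3, h4, h5, -, -⟩ := exists_diagonalization (A := P * A * Pᵀ) (by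
    simp [transpose_mul, hA, Matrix.mul_assoc])
  -- Rotating the coordinates in `r` by an orthogonal matrix preserves P S = 1 and S Sᵀ = K, which
  -- leaves the freedom to diagonalize P A Pᵀ.
  refine ⟨r, i1, i2, S * O, Oᵀ * P, d, ?_, ?_, ?_⟩
  · calc Oᵀ * P * (S * O) = Oᵀ * (P * S) * O := by simp only [Matrix.mul_assoc]
      _ = 1 := by rw [h1]; simp [h3]
  · calc S * O * (S * O)ᵀ = S * (O * Oᵀ) * Sᵀ := by simp only [transpose_mul, Matrix.mul_assoc]
      _ = K := by rw [h4]; simp [h2]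
  · rw [← h5]; simp only [transpose_mul, transpose_transpose, Matrix.mul_assoc]

end LinearAlgebra

/-! ### Calculus of mixed second moments, linear regression. -/

section SecondMoments

open Matrix

variable {Ω : Type*} {mΩ : MeasurableSpace Ω} {ι κ σ : Type*}

/-- The coordinates of the random vector are square integrable. -/
def L2 (μ : Measure Ω) (A : Ω → ι → ℝ) : Prop := ∀ i, MemLp (fun ω => A ω i) 2 μ

/-- The matrix of mixed second moments. -/
def cc (μ : Measure Ω) (A : Ω → ι → ℝ) (B : Ω → κ → ℝ) : Matrix ι κ ℝ :=
  of fun i j => ∫ ω, A ω i * B ω j ∂μ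

/-- The linear image of a random vector under a matrix. -/
def mv [Fintype ι] (M : Matrix κ ι ℝ) (A : Ω → ι → ℝ) : Ω → κ → ℝ := fun ω => M *ᵥ A ω

/-- The concatenation of two random vectors. -/
def joinV (A : Ω → ι → ℝ) (B : Ω → κ → ℝ) : Ω → ι ⊕ κ → ℝ := fun ω => Sum.elim (A ω) (B ω)

variable {μ : Measure Ω} {A A' : Ω → ι → ℝ} {B B' : Ω → κ → ℝ} {C : Ω → σ → ℝ}

lemma L2.add (h : L2 μ A) (h' : L2 μ A') : L2 μ (A + A') := fun i => (h i).add (h' i)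

lemma L2.sub (h : L2 μ A) (h' : L2 μ A') : L2 μ (A - A') := fun i => (h i).sub (h' i)

lemma L2.mv [Fintype ι] (h : L2 μ A) (M : Matrix κ ι ℝ) : L2 μ (mv M A) := fun i => by
  simp only [SideInfo.mv, mulVec, dotProduct]
  exact memLp_finsetSum _ fun j _ => (h j).const_mul _

lemma L2.congr (h : L2 μ A) (hA : A =ᵐ[μ] A') : L2 μ A' := fun i =>
  (memLp_congr_ae (hA.mono fun ω hω => by simp [hω])).1 (h i)

lemma L2.integrable_mul (h : L2 μ A) (h' : L2 μ B) (i : ι) (j : κ) :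
    Integrable (fun ω => A ω i * B ω j) μ := (h i).integrable_mul (h' j)

lemma cc_congr (hA : A =ᵐ[μ] A') (hB : B =ᵐ[μ] B') : cc μ A B = cc μ A' B' := by
  ext i j
  exact integral_congr_ae (by filter_upwards [hA, hB] with ω h1 h2; simp [h1, h2])

lemma cc_transpose : (cc μ A B)ᵀ = cc μ B A := by
  ext i j
  simp [cc, mul_comm]

lemma cc_add_left (h : L2 μ A) (h' : L2 μ A') (hB : L2 μ B) :
    cc μ (A + A') B = cc μ A B + cc μ A' B := by
  ext i j
  simp only [cc, of_apply, Matrix.add_apply, Pi.add_apply, add_mul]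
  exact integral_add (h.integrable_mul hB i j) (h'.integrable_mul hB i j)

lemma cc_sub_left (h : L2 μ A) (h' : L2 μ A') (hB : L2 μ B) :
    cc μ (A - A') B = cc μ A B - cc μ A' B := by
  ext i j
  simp only [cc, of_apply, Matrix.sub_apply, Pi.sub_apply, sub_mul]
  exact integral_sub (h.integrable_mul hB i j) (h'.integrable_mul hB i j)

lemma cc_mv_left [Fintype ι] (h : L2 μ A) (hB : L2 μ B) (M : Matrix σ ι ℝ) :
    cc μ (mv M A) B = M * cc μ A B := by
  ext i j
  simp only [cc, mv, of_apply, mul_apply, mulVec, dotProduct, Finset.sum_mul]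
  rw [integral_finsetSum _ fun l _ => by
    simpa only [mul_assoc] using (h.integrable_mul hB l j).const_mul (M i l)]
  simp_rw [mul_assoc, integral_const_mul]

lemma cc_add_right (h : L2 μ B) (h' : L2 μ B') (hA : L2 μ A) :
    cc μ A (B + B') = cc μ A B + cc μ A B' := by
  rw [← cc_transpose, cc_add_left h h' hA, transpose_add, cc_transpose, cc_transpose]

lemma cc_sub_right (h : L2 μ B) (h' : L2 μ B') (hA : L2 μ A) :
    cc μ A (B - B') = cc μ A B - cc μ A B' := by
  rw [← cc_transpose, cc_sub_left h h' hA, transpose_sub, cc_transpose, cc_transpose]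

lemma cc_mv_right [Fintype κ] (h : L2 μ B) (hA : L2 μ A) (M : Matrix σ κ ℝ) :
    cc μ A (mv M B) = cc μ A B * Mᵀ := by
  rw [← cc_transpose, cc_mv_left h hA, transpose_mul, cc_transpose]

lemma L2.joinV (h : L2 μ A) (h' : L2 μ B) : L2 μ (joinV A B)
  | .inl i => h i
  | .inr j => h' j

lemma cc_joinV_right_eq_zero (h : cc μ C A = 0) (h' : cc μ C B = 0) : cc μ C (joinV A B) = 0 := by
  ext i j
  cases j with
  | inl j => exact congrFun (congrFun h i) j
  | inr j => exact congrFun (congrFun h' i) j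

lemma dotProduct_cc_self [Fintype ι] (h : L2 μ A) (v : ι → ℝ) :
    v ⬝ᵥ (cc μ A A *ᵥ v) = ∫ ω, (v ⬝ᵥ A ω) ^ 2 ∂μ := by
  have h1 : cc μ (mv (replicateRow Unit v) A) (mv (replicateRow Unit v) A) () () =
      v ⬝ᵥ (cc μ A A *ᵥ v) := by
    rw [cc_mv_left h (h.mv _), cc_mv_right h h]
    simp [mul_apply, dotProduct, mulVec, replicateRow, Finset.mul_sum]
  rw [← h1]
  simp only [cc, of_apply, mv]
  refine integral_congr_ae (Filter.Eventually.of_forall fun ω => ?_)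
  simp [mulVec, replicateRow, sq]

lemma posSemidef_cc_self [Fintype ι] (h : L2 μ A) : (cc μ A A).PosSemidef := by
  refine PosSemidef.of_dotProduct_mulVec_nonneg ?_ fun v => ?_
  · rw [IsHermitian, conjTranspose_eq_transpose_of_trivial, cc_transpose]
  · rw [star_trivial, dotProduct_cc_self h]
    exact integral_nonneg fun ω => sq_nonneg _

lemma ae_eq_zero_of_cc_self_eq_zero [Finite ι] (h : L2 μ A) (h0 : cc μ A A = 0) : A =ᵐ[μ] 0 := by
  have h1 : ∀ i, ∀ᵐ ω ∂μ, A ω i = 0 := fun i => by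
    have h2 := congrFun (congrFun h0 i) i
    simp only [cc, of_apply, Matrix.zero_apply] at h2
    rw [integral_eq_zero_iff_of_nonneg (fun ω => mul_self_nonneg _) (h.integrable_mul h i i)] at h2
    filter_upwards [h2] with ω hω
    exact mul_self_eq_zero.1 hω
  filter_upwards [ae_all_iff.2 h1] with ω hω
  exact funext hω

/-- A random vector lies almost surely in the range of its second moment matrix. -/
lemma ae_eq_mv_of_factorization [Fintype ι] [DecidableEq ι] [Fintype σ] [DecidableEq σ]
    (h : L2 μ A) {S : Matrix ι σ ℝ} {P : Matrix σ ι ℝ} (hPS : P * S = 1)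
    (hS : S * Sᵀ = cc μ A A) : A =ᵐ[μ] mv S (mv P A) := by
  have h1 : A - mv S (mv P A) =ᵐ[μ] 0 := by
    refine ae_eq_zero_of_cc_self_eq_zero (h.sub ((h.mv _).mv _)) ?_
    have hL := (h.mv P).mv S
    -- S P is a projection fixing the range of the second moment matrix, so the residual A - S P A
    -- has zero second moments.
    have hZ : S * P * (S * Sᵀ) = S * Sᵀ := by
      calc S * P * (S * Sᵀ) = S * (P * S) * Sᵀ := by simp only [Matrix.mul_assoc]
        _ = _ := by rw [hPS, Matrix.mul_one]
    have hZ' : S * Sᵀ * Pᵀ * Sᵀ = S * Sᵀ := by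
      have := congrArg transpose hZ
      simpa only [transpose_mul, transpose_transpose, Matrix.mul_assoc] using this
    have e : cc μ (mv S (mv P A)) A = S * Sᵀ := by
      rw [cc_mv_left (h.mv P) h, cc_mv_left h h, ← hS, ← Matrix.mul_assoc, hZ]
    rw [cc_sub_left h hL (h.sub hL), cc_sub_right h hL h, cc_sub_right h hL hL, e,
      ← cc_transpose (A := mv S (mv P A)), e, cc_mv_left (h.mv P) hL, cc_mv_left h hL,
      ← cc_transpose (A := mv S (mv P A)), e, ← hS]
    simp only [transpose_mul, transpose_transpose]
    rw [← Matrix.mul_assoc, hZ]; simp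
  filter_upwards [h1] with ω hω
  exact sub_eq_zero.1 hω

/-- Linear regression. -/
lemma exists_regression {κ : Type} {B : Ω → κ → ℝ} [Fintype ι] [Fintype κ] (hA : L2 μ A)
    (hB : L2 μ B) : ∃ L : Matrix ι κ ℝ, cc μ (A - mv L B) B = 0 := by
  classical
  obtain ⟨r, i1, i2, S, P, h1, h2⟩ := exists_factorization (posSemidef_cc_self hB)
  have h3 := ae_eq_mv_of_factorization hB h1 h2
  -- Pᵀ P is a generalized inverse of S Sᵀ, the possibly singular second moment matrix of `B`.
  refine ⟨cc μ A B * Pᵀ * P, ?_⟩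
  rw [cc_sub_left hA (hB.mv _) hB, cc_mv_left hB hB, ← h2]
  have h4 : cc μ A B = cc μ A B * Pᵀ * Sᵀ := by
    conv_lhs => rw [cc_congr (Filter.EventuallyEq.refl _ A) h3,
      cc_mv_right (hB.mv _) hA, cc_mv_right hB hA]
  have h5 : cc μ A B * Pᵀ * P * (S * Sᵀ) = cc μ A B * Pᵀ * (P * S) * Sᵀ := by
    simp only [Matrix.mul_assoc]
  rw [h5, h1, Matrix.mul_one, ← h4, sub_self]

end SecondMoments

/-! ### Markov chains as vanishing conditional mutual information. -/

section Markov

variable {Ω : Type*} {mΩ : MeasurableSpace Ω} {μ : Measure Ω} [IsProbabilityMeasure μ]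
  {α β γ δ ε : Type*} [MeasurableSpace α] [MeasurableSpace β] [MeasurableSpace γ]
  [MeasurableSpace δ] [MeasurableSpace ε]
  [StandardBorelSpace α] [Nonempty α] [StandardBorelSpace β] [Nonempty β]

lemma isMarkovChain_iff_condMutualInfo_eq_zero [StandardBorelSpace Ω] {A : Ω → α} {B : Ω → β}
    {C : Ω → γ} (hA : Measurable A) (hB : Measurable B) (hC : Measurable C) :
    IsMarkovChain μ A C B ↔ condMutualInfo μ A B C = 0 := by
  have := Measure.isProbabilityMeasure_map (μ := μ) hC.aemeasurable
  have := Measure.isProbabilityMeasure_map (μ := μ) (hC.prodMk (hA.prodMk hB)).aemeasurable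
  rw [condMutualInfo, klDiv_eq_zero_iff, Measure.compProd_eq_comp_prod,
    ← condIndepFun_iff_map_prod_eq_prod_condDistrib_prod_condDistrib hA hB hC]
  exact ⟨fun ⟨_, h⟩ => h, fun h => ⟨hC, h⟩⟩

/-- Conditional independence as a resampling rule: redrawing `G` from its conditional law given `C`
does not change its joint law with functions of (C, T). -/
lemma lintegral_of_condMutualInfo_eq_zero {G : Ω → α} {T : Ω → β} {C : Ω → γ} (hG : Measurable G)
    (hT : Measurable T) (hC : Measurable C) (h : condMutualInfo μ G T C = 0) {D : γ × β → δ}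
    (hD : Measurable D) {f : (γ × δ) × α → ℝ≥0∞} (hf : Measurable f) :
    ∫⁻ ω, f ((C ω, D (C ω, T ω)), G ω) ∂μ =
      ∫⁻ ω, ∫⁻ g, f ((C ω, D (C ω, T ω)), g) ∂(condDistrib G C μ (C ω)) ∂μ := by
  have := Measure.isProbabilityMeasure_map (μ := μ) (hC.prodMk hT).aemeasurable
  have := Measure.isProbabilityMeasure_map (μ := μ) ((hC.prodMk hT).prodMk hG).aemeasurable
  rw [condMutualInfo_eq_klDiv μ hG hT hC, klDiv_eq_zero_iff] at h
  have h1 := congrArg (fun ρ => ∫⁻ p, f ((p.1.1, D p.1), p.2) ∂ρ) h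
  rw [lintegral_map (by fun_prop) (by fun_prop), Measure.lintegral_compProd (by fun_prop)] at h1
  rw [lintegral_map (Measurable.lintegral_kernel_prod_right'
    (f := fun p => f ((p.1.1, D p.1), p.2)) (by fun_prop)) (by fun_prop)] at h1
  exact h1

/-- If `G` and `T` are conditionally independent given `C`, a function `N` of `(C, T)` that is
independent of `(C, D)` is independent of `((C, D), G)`. -/
lemma indepFun_of_condMutualInfo_eq_zero {G : Ω → α} {T : Ω → β} {C : Ω → γ} {D : Ω → δ}
    {N : Ω → ε} (hG : Measurable G) (hT : Measurable T) (hC : Measurable C)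
    (h : condMutualInfo μ G T C = 0) {d : γ × β → δ} (hd : Measurable d) {n : γ × β → ε}
    (hn : Measurable n) (hD : ∀ ω, D ω = d (C ω, T ω)) (hN : ∀ ω, N ω = n (C ω, T ω))
    (hind : IndepFun (fun ω => (C ω, D ω)) N μ) :
    IndepFun (fun ω => ((C ω, D ω), G ω)) N μ := by
  obtain rfl : D = fun ω => d (C ω, T ω) := funext hD
  obtain rfl : N = fun ω => n (C ω, T ω) := funext hN
  rw [indepFun_iff_map_prod_eq_prod_map_map (by fun_prop) (by fun_prop)] at hind ⊢
  have := Measure.isProbabilityMeasure_map (μ := μ) (hn.comp (hC.prodMk hT)).aemeasurable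
  refine Measure.ext_of_lintegral _ fun f hf => ?_
  -- `F` averages out `G` given `C`. What remains depends only on (C, D) and `N`, whose independence
  -- is assumed.
  let F : (γ × δ) × ε → ℝ≥0∞ := fun p => ∫⁻ g, f ((p.1, g), p.2) ∂(condDistrib G C μ p.1.1)
  have hF : Measurable F := Measurable.lintegral_kernel_prod_right'
    (κ := (condDistrib G C μ).comap (fun p : (γ × δ) × ε => p.1.1) (by fun_prop))
    (f := fun p => f ((p.1.1, p.2), p.1.2)) (by fun_prop)
  have h1 : ∫⁻ p, f p ∂(μ.map fun ω => (((C ω, d (C ω, T ω)), G ω), n (C ω, T ω))) =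
      ∫⁻ ω, F ((C ω, d (C ω, T ω)), n (C ω, T ω)) ∂μ := by
    rw [lintegral_map hf (by fun_prop)]
    exact lintegral_of_condMutualInfo_eq_zero hG hT hC h (D := fun p => (d p, n p)) (by fun_prop)
      (f := fun p => f (((p.1.1, p.1.2.1), p.2), p.1.2.2)) (by fun_prop)
  rw [h1, lintegral_prod_symm _ hf.aemeasurable]
  have h2 := congrArg (fun ρ => ∫⁻ p, F p ∂ρ) hind
  rw [lintegral_map hF (by fun_prop), lintegral_prod_symm _ hF.aemeasurable] at h2
  refine h2.trans (lintegral_congr fun e => ?_)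
  rw [lintegral_map (by fun_prop) (by fun_prop), lintegral_map (by fun_prop) (by fun_prop)]
  exact (lintegral_of_condMutualInfo_eq_zero hG hT hC h hd
      (f := fun p => f (p, e)) (by fun_prop)).symm

end Markov

/-! ### Optimal estimation errors and their uniqueness. -/

section Errors

open Matrix

variable {Ω : Type*} {mΩ : MeasurableSpace Ω} {μ : Measure Ω}
  {𝒢 ℋ : Type*} [MeasurableSpace 𝒢] [MeasurableSpace ℋ] {ι κ : Type*}

/-- `ρ` is the error in the optimal estimation of `A` from `G`. -/
def IsErr (μ : Measure Ω) (G : Ω → 𝒢) (A ρ : Ω → ι → ℝ) : Prop :=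
  L2 μ ρ ∧ (∃ t : 𝒢 → ι → ℝ, Measurable t ∧ A =ᵐ[μ] fun ω => t (G ω) + ρ ω) ∧
    ∀ h : 𝒢 → ℝ, Measurable h → MemLp (fun ω => h (G ω)) 2 μ → ∀ i, ∫ ω, ρ ω i * h (G ω) ∂μ = 0

variable {G : Ω → 𝒢} {A A' ρ ρ' : Ω → ι → ℝ} {B : Ω → κ → ℝ}

/-- The random vector `X`, as a function on the index set. -/
def vc {k : ℕ} (X : Ω → Vec k) : Ω → Fin k → ℝ := fun ω => (X ω).ofLp

/-- The conditional mean factors through `G`, and pulling a function of `G` out of the conditional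
expectation shows that the error is orthogonal to it. -/
lemma isErr_condExp [IsProbabilityMeasure μ] [Finite ι] (hG : Measurable G) (hA : L2 μ A) :
    IsErr μ G A fun ω i => A ω i -
      (μ[fun ω' => A ω' i | MeasurableSpace.comap G inferInstance]) ω := by
  have hm : MeasurableSpace.comap G inferInstance ≤ mΩ := hG.comap_le
  have hL : ∀ i, MemLp (μ[fun ω' => A ω' i | MeasurableSpace.comap G inferInstance]) 2 μ :=
    fun i => (hA i).condExp (by norm_num)
  refine ⟨fun i => (hA i).sub (hL i), ?_, fun h hh hhL i => ?_⟩
  · choose t ht htG using fun i => (stronglyMeasurable_condExp (μ := μ)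
      (m := MeasurableSpace.comap G inferInstance) (f := fun ω => A ω i)).exists_eq_measurable_comp
    refine ⟨fun g i => t i g, measurable_pi_lambda _ fun i => (ht i).measurable,
      Filter.Eventually.of_forall fun ω => funext fun i => ?_⟩
    simp only [Pi.add_apply]
    rw [htG i]
    simp
  · have e : ∀ ω, (A ω i - (μ[fun ω' => A ω' i | MeasurableSpace.comap G inferInstance]) ω) *
        h (G ω) = ((fun ω => A ω i) * fun ω => h (G ω)) ω -
          (μ[fun ω' => A ω' i | MeasurableSpace.comap G inferInstance] * fun ω => h (G ω)) ω :=
      fun ω => by simp only [Pi.mul_apply]; ring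
    have hi : Integrable ((fun ω => A ω i) * fun ω => h (G ω)) μ := (hA i).integrable_mul hhL
    have hp := condExp_mul_of_stronglyMeasurable_right
      (m := MeasurableSpace.comap G inferInstance) (μ := μ) (f := fun ω => A ω i)
      (g := fun ω => h (G ω)) (hh.comp (comap_measurable G)).stronglyMeasurable hi
      ((hA i).integrable (by norm_num))
    simp_rw [e]
    rw [integral_sub hi ((hL i).integrable_mul hhL), ← integral_congr_ae hp, integral_condExp hm,
      sub_self]

/-- The difference of two errors is a function of `G`, hence orthogonal to both errors and so to
itself. -/
lemma IsErr.ae_eq [Finite ι] (h : IsErr μ G A ρ) (h' : IsErr μ G A ρ') : ρ =ᵐ[μ] ρ' := by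
  obtain ⟨hL, ⟨t, ht, htA⟩, ho⟩ := h
  obtain ⟨hL', ⟨t', ht', htA'⟩, ho'⟩ := h'
  have h1 : ρ - ρ' =ᵐ[μ] fun ω => t' (G ω) - t (G ω) := by
    filter_upwards [htA, htA'] with ω h1 h2
    rw [h1] at h2
    simp only [Pi.sub_apply]
    rw [sub_eq_sub_iff_add_eq_add, add_comm, h2]
  have hD := (hL.sub hL').congr h1
  have h2 : cc μ (ρ - ρ') (ρ - ρ') = 0 := by
    rw [cc_congr (Filter.EventuallyEq.refl _ _) h1, cc_sub_left hL hL' hD]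
    ext i j
    have e1 := ho (fun g => t' g j - t g j) (by fun_prop) (hD j) i
    have e2 := ho' (fun g => t' g j - t g j) (by fun_prop) (hD j) i
    simp only [cc, of_apply, Matrix.sub_apply, Matrix.zero_apply, Pi.sub_apply] at e1 e2 ⊢
    rw [e1, e2, sub_self]
  filter_upwards [ae_eq_zero_of_cc_self_eq_zero (hL.sub hL') h2] with ω hω
  exact sub_eq_zero.1 hω

/-- Conditional covariances may be computed from any representative of the error, in particular from
an explicit Gaussian one. -/
lemma condCov_eq [IsProbabilityMeasure μ] {k : ℕ} {X : Ω → Vec k} {ρ : Ω → Fin k → ℝ}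
    (hG : Measurable G)
    (hX : L2 μ (vc X)) (h : IsErr μ G (vc X) ρ) : condCov μ X G = cc μ ρ ρ := by
  have h1 := (isErr_condExp hG hX).ae_eq h
  rw [← cc_congr h1 h1]
  rfl

lemma IsErr.congr (h : IsErr μ G A ρ) (hA : A =ᵐ[μ] A') : IsErr μ G A' ρ := by
  obtain ⟨hL, ⟨t, ht, htA⟩, ho⟩ := h
  exact ⟨hL, ⟨t, ht, hA.symm.trans htA⟩, ho⟩

lemma IsErr.add (h : IsErr μ G A ρ) (h' : IsErr μ G A' ρ') : IsErr μ G (A + A') (ρ + ρ') := by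
  obtain ⟨hL, ⟨t, ht, htA⟩, ho⟩ := h
  obtain ⟨hL', ⟨t', ht', htA'⟩, ho'⟩ := h'
  refine ⟨hL.add hL', ⟨fun g => t g + t' g, by fun_prop, ?_⟩, fun h hh hhL i => ?_⟩
  · filter_upwards [htA, htA'] with ω h1 h2
    simp only [Pi.add_apply, h1, h2]
    abel
  · simp only [Pi.add_apply, add_mul]
    have h1 : Integrable (fun ω => ρ ω i * h (G ω)) μ := (hL i).integrable_mul hhL
    have h2 : Integrable (fun ω => ρ' ω i * h (G ω)) μ := (hL' i).integrable_mul hhL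
    rw [integral_add h1 h2, ho h hh hhL, ho' h hh hhL, add_zero]

lemma IsErr.mv [Fintype ι] [Finite κ] (h : IsErr μ G A ρ) (M : Matrix κ ι ℝ) :
    IsErr μ G (mv M A) (mv M ρ) := by
  obtain ⟨hL, ⟨t, ht, htA⟩, ho⟩ := h
  refine ⟨hL.mv M, ⟨fun g => M *ᵥ t g, ?_, ?_⟩, fun h hh hhL i => ?_⟩
  · refine measurable_pi_lambda _ fun i => ?_
    simp only [mulVec, dotProduct]
    fun_prop
  · filter_upwards [htA] with ω h1
    simp only [SideInfo.mv, h1, mulVec_add]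
  · simp only [SideInfo.mv, mulVec, dotProduct, Finset.sum_mul]
    have hi : ∀ j, Integrable (fun ω => M i j * ρ ω j * h (G ω)) μ := fun j => by
      have : Integrable (fun ω => ρ ω j * h (G ω)) μ := (hL j).integrable_mul hhL
      simpa only [mul_assoc] using this.const_mul (M i j)
    rw [integral_finsetSum _ fun j _ => hi j]
    refine Finset.sum_eq_zero fun j _ => ?_
    simp_rw [mul_assoc, integral_const_mul, ho h hh hhL, mul_zero]

/-- A function of the observation is estimated without error. -/
lemma isErr_comp {s : 𝒢 → ι → ℝ} (hs : Measurable s) :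
    IsErr μ G (fun ω => s (G ω)) 0 :=
  ⟨fun _ => MemLp.zero, ⟨s, hs, by simp⟩, fun h hh hhL i => by simp⟩

lemma IsErr.add_comp (h : IsErr μ G A ρ) {s : 𝒢 → ι → ℝ} (hs : Measurable s) :
    IsErr μ G (A + fun ω => s (G ω)) ρ := by
  simpa using h.add (isErr_comp hs)

/-- The way errors are exhibited for Gaussian vectors, where they are independent of the observation
and not merely orthogonal to its functions. -/
lemma isErr_of_indepFun (hG : Measurable G) (hρm : ∀ i, AEStronglyMeasurable (fun ω => ρ ω i) μ)
    (hρ : L2 μ ρ) (h0 : ∀ i, ∫ ω, ρ ω i ∂μ = 0)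
    (hind : IndepFun G ρ μ) {t : 𝒢 → ι → ℝ} (ht : Measurable t)
    (hA : A =ᵐ[μ] fun ω => t (G ω) + ρ ω) : IsErr μ G A ρ := by
  refine ⟨hρ, ⟨t, ht, hA⟩, fun h hh hhL i => ?_⟩
  have h1 : IndepFun (fun ω => ρ ω i) (fun ω => h (G ω)) μ :=
    (hind.comp hh (measurable_pi_apply i)).symm
  rw [h1.integral_fun_mul_eq_mul_integral (hρm i) (hh.comp hG).aestronglyMeasurable, h0, zero_mul]

lemma IsErr.of_leftInverse {e : 𝒢 → ℋ} {e' : ℋ → 𝒢} (he : Measurable e) (he' : Measurable e')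
    (hee : Function.LeftInverse e' e) (h : IsErr μ G A ρ) : IsErr μ (fun ω => e (G ω)) A ρ := by
  obtain ⟨hL, ⟨t, ht, htA⟩, ho⟩ := h
  refine ⟨hL, ⟨fun x => t (e' x), by fun_prop, ?_⟩, fun h hh hhL i => ?_⟩
  · simpa only [hee _] using htA
  · exact ho (fun g => h (e g)) (by fun_prop) hhL i

lemma IsErr.cc_comp_eq_zero (h : IsErr μ G A ρ) {s : 𝒢 → κ → ℝ} (hs : Measurable s)
    (hL : L2 μ fun ω => s (G ω)) : cc μ ρ (fun ω => s (G ω)) = 0 := by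
  ext i j
  exact h.2.2 (fun g => s g j) (by fun_prop) (hL j) i

lemma cc_eq_zero_of_indepFun (hA : L2 μ A) (hB : L2 μ B) (h0 : ∀ j, ∫ ω, B ω j ∂μ = 0)
    (hind : IndepFun A B μ) : cc μ A B = 0 := by
  ext i j
  have h1 : IndepFun (fun ω => A ω i) (fun ω => B ω j) μ :=
    hind.comp (measurable_pi_apply i) (measurable_pi_apply j)
  simp only [cc, of_apply, Matrix.zero_apply]
  rw [h1.integral_fun_mul_eq_mul_integral (hA i).1 (hB j).1, h0, mul_zero]

/-- Additional independent observations do not help. -/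
lemma IsErr.prodMk_indepFun [IsProbabilityMeasure μ] {N : Ω → ℋ} (hG : Measurable G)
    (hA : Measurable A) (hN : Measurable N)
    (hind : IndepFun (fun ω => (G ω, A ω)) N μ) (hE : IsErr μ G A ρ) :
    IsErr μ (fun ω => (G ω, N ω)) A ρ := by
  obtain ⟨hL, ⟨t, ht, htA⟩, ho⟩ := hE
  refine ⟨hL, ⟨fun p => t p.1, by fun_prop, htA⟩, fun h hh hhL i => ?_⟩
  have := Measure.isProbabilityMeasure_map (μ := μ) (hG.prodMk hA).aemeasurable
  have := Measure.isProbabilityMeasure_map (μ := μ) hG.aemeasurable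
  have := Measure.isProbabilityMeasure_map (μ := μ) hN.aemeasurable
  have hρ : ∀ᵐ ω ∂μ, ρ ω i = A ω i - t (G ω) i := by
    filter_upwards [htA] with ω hω
    simp [hω]
  let f : (𝒢 × (ι → ℝ)) × ℋ → ℝ := fun p => (p.1.2 i - t p.1.1 i) * h (p.1.1, p.2)
  have hf : Measurable f := by fun_prop
  have hlaw := (indepFun_iff_map_prod_eq_prod_map_map (hG.prodMk hA).aemeasurable
    hN.aemeasurable).1 hind
  have hlaw' := (indepFun_iff_map_prod_eq_prod_map_map hG.aemeasurable hN.aemeasurable).1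
    (hind.comp (φ := Prod.fst) (ψ := id) measurable_fst measurable_id)
  have hfμ : (fun ω => ρ ω i * h (G ω, N ω)) =ᵐ[μ] fun ω => f ((G ω, A ω), N ω) := by
    filter_upwards [hρ] with ω hω
    simp [f, hω]
  have hint : Integrable f ((μ.map fun ω => (G ω, A ω)).prod (μ.map N)) := by
    rw [← hlaw, integrable_map_measure hf.aestronglyMeasurable (by fun_prop)]
    exact ((hL i).integrable_mul hhL).congr hfμ
  have hsq : Integrable (fun p => h p ^ 2) ((μ.map G).prod (μ.map N)) := by
    have := hhL.integrable_sq
    rw [show (μ.map G).prod (μ.map N) = μ.map fun ω => (G ω, N ω) from hlaw'.symm,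
      integrable_map_measure (by fun_prop) (by fun_prop)]
    exact this
  -- For almost every value n of `N` the slice h(·, n) is square integrable under the law of `G`, so
  -- orthogonality of `ρ` applies to it. Fubini then gives the claim.
  have hs : ∀ᵐ n ∂(μ.map N), ∫ p, f (p, n) ∂(μ.map fun ω => (G ω, A ω)) = 0 := by
    filter_upwards [hsq.prod_left_ae] with n hn
    have hh : Measurable fun g => h (g, n) := by fun_prop
    rw [integrable_map_measure (hh.pow_const 2).aestronglyMeasurable (by fun_prop)] at hn
    have hn2 : MemLp (fun ω => h (G ω, n)) 2 μ :=
      (memLp_two_iff_integrable_sq (hh.comp hG).aestronglyMeasurable).2 hn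
    have hfn : Measurable fun p => f (p, n) := by fun_prop
    rw [integral_map (by fun_prop) hfn.aestronglyMeasurable,
      ← ho (fun g => h (g, n)) hh hn2 i]
    refine integral_congr_ae ?_
    filter_upwards [hρ] with ω hω
    simp [f, hω]
  rw [integral_congr_ae hfμ,
    ← integral_map (φ := fun ω => ((G ω, A ω), N ω)) (by fun_prop) hf.aestronglyMeasurable, hlaw,
    integral_prod_symm _ hint, integral_congr_ae hs, integral_zero]

end Errors

/-! ### Linear functions of a centered Gaussian sample. -/

section GaussianLinear

open Matrix NNReal

variable {E F : Type*} [NormedAddCommGroup E] [NormedSpace ℝ E] [NormedAddCommGroup F]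
  [NormedSpace ℝ F] {ι κ σ : Type*}

/-- The random vector is a continuous linear function of the sample. -/
def IsLin (A : E → ι → ℝ) : Prop := ∀ i, ∃ L : E →L[ℝ] ℝ, ∀ ω, A ω i = L ω

variable {A A' : E → ι → ℝ} {B : E → κ → ℝ} {N : E → σ → ℝ}

lemma IsLin.add (h : IsLin A) (h' : IsLin A') : IsLin (A + A') := fun i => by
  obtain ⟨L, hL⟩ := h i
  obtain ⟨L', hL'⟩ := h' i
  exact ⟨L + L', fun ω => by simp [hL, hL']⟩

lemma IsLin.sub (h : IsLin A) (h' : IsLin A') : IsLin (A - A') := fun i => by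
  obtain ⟨L, hL⟩ := h i
  obtain ⟨L', hL'⟩ := h' i
  exact ⟨L - L', fun ω => by simp [hL, hL']⟩

lemma IsLin.mv [Fintype ι] (h : IsLin A) (M : Matrix κ ι ℝ) : IsLin (mv M A) := fun i => by
  choose L hL using h
  exact ⟨∑ j, M i j • L j, fun ω => by simp [SideInfo.mv, mulVec, dotProduct, hL]⟩

lemma IsLin.joinV (h : IsLin A) (h' : IsLin B) : IsLin (joinV A B)
  | .inl i => h i
  | .inr j => h' j

lemma IsLin.comp_continuousLinearMap (h : IsLin A) (f : F →L[ℝ] E) : IsLin fun ω => A (f ω) :=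
  fun i => by
    obtain ⟨L, hL⟩ := h i
    exact ⟨L.comp f, fun ω => by simp [hL]⟩

lemma IsLin.exists_eq (h : IsLin A) : ∃ L : E →L[ℝ] (ι → ℝ), A = L := by
  choose L hL using h
  exact ⟨ContinuousLinearMap.pi L, funext fun ω => funext fun i => by simp [hL]⟩

lemma isLin_vc {k : ℕ} (f : E →L[ℝ] Vec k) : IsLin (vc f) := fun i =>
  ⟨(EuclideanSpace.proj i).comp f, fun ω => by simp [vc]⟩

variable [MeasurableSpace E] [BorelSpace E]

lemma IsLin.measurable [Countable ι] (h : IsLin A) : Measurable A :=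
  measurable_pi_lambda _ fun i => by
    obtain ⟨L, hL⟩ := h i
    simp_rw [hL]
    fun_prop

variable {Q : Measure E}

lemma IsLin.l2 (hQ : IsCenteredGaussian Q) (h : IsLin A) : L2 Q A := fun i => by
  obtain ⟨L, hL⟩ := h i
  have := hQ.1
  simp_rw [hL]
  exact (IsGaussian.hasGaussianLaw_id.map L).memLp_two

variable [CompleteSpace E] [SecondCountableTopology E]

lemma IsLin.integral_eq_zero (hQ : IsCenteredGaussian Q) (h : IsLin A) (i : ι) :
    ∫ ω, A ω i ∂Q = 0 := by
  obtain ⟨L, hL⟩ := h i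
  have := hQ.1
  simp_rw [hL]
  rw [L.integral_comp_comm (φ := fun ω => ω) IsGaussian.hasGaussianLaw_id.integrable, hQ.2,
    map_zero]

lemma IsLin.covariance_eq (hQ : IsCenteredGaussian Q) (hA : IsLin A) (hB : IsLin B) (i : ι)
    (j : κ) : cov[fun ω => A ω i, fun ω => B ω j; Q] = cc Q A B i j := by
  have := hQ.1
  rw [covariance_eq_sub (hA.l2 hQ i) (hB.l2 hQ j), hA.integral_eq_zero hQ, zero_mul, sub_zero]
  rfl

/-- Both vectors are linear images of one Gaussian sample, hence jointly Gaussian, and then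
vanishing covariance means independence. -/
lemma IsLin.indepFun [Finite ι] [Finite κ] (hQ : IsCenteredGaussian Q) (hA : IsLin A)
    (hB : IsLin B) (h : cc Q A B = 0) : IndepFun A B Q := by
  have := hQ.1
  refine HasGaussianLaw.indepFun_of_covariance_eval (X := fun i ω => A ω i)
    (Y := fun j ω => B ω j) ?_ fun i j => by rw [hA.covariance_eq hQ hB, h]; rfl
  obtain ⟨L, rfl⟩ := hA.exists_eq
  obtain ⟨L', rfl⟩ := hB.exists_eq
  have := Fintype.ofFinite ι
  have := Fintype.ofFinite κ
  exact (IsGaussian.hasGaussianLaw_id (μ := Q)).map (L.prod L')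

lemma IsLin.indepFun_prodMk [Finite ι] [Finite κ] [Finite σ] (hQ : IsCenteredGaussian Q)
    (hA : IsLin A) (hB : IsLin B) (hN : IsLin N) (h : cc Q N A = 0) (h' : cc Q N B = 0) :
    IndepFun (fun ω => (A ω, B ω)) N Q := by
  have h1 := hN.indepFun hQ (hA.joinV hB) (cc_joinV_right_eq_zero h h')
  exact h1.symm.comp (φ := fun v => (fun i => v (.inl i), fun j => v (.inr j))) (ψ := id)
    (by fun_prop) measurable_id

lemma IsLin.map_eq_pi [Fintype ι] [DecidableEq ι] (hQ : IsCenteredGaussian Q) (hA : IsLin A)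
    {τ : ι → ℝ≥0} (h : cc Q A A = diagonal fun i => (τ i : ℝ)) :
    Q.map A = Measure.pi fun i => gaussianReal 0 (τ i) := by
  have := hQ.1
  have hG : HasGaussianLaw (fun ω i => A ω i) Q := by
    obtain ⟨L, rfl⟩ := hA.exists_eq
    exact (IsGaussian.hasGaussianLaw_id (μ := Q)).map L
  have h1 : iIndepFun (fun i ω => A ω i) Q :=
    HasGaussianLaw.iIndepFun_of_covariance_eq_zero hG fun i j hij => by
      rw [hA.covariance_eq hQ hA, h, diagonal_apply_ne _ hij]
  have hm := hA.measurable
  rw [iIndepFun_iff_map_fun_eq_pi_map (fun i => by fun_prop)] at h1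
  refine h1.trans (congrArg _ (funext fun i => ?_))
  have h2 : HasGaussianLaw (fun ω => A ω i) Q := hG.eval (X := fun i ω => A ω i) i
  rw [h2.map_eq_gaussianReal, hA.integral_eq_zero hQ, ← covariance_self (by fun_prop),
    hA.covariance_eq hQ hA, h, diagonal_apply_eq, Real.toNNReal_coe]

end GaussianLinear

/-! ### Moments and independence pulled back to an extension of the sample space. -/

section Transfer

variable {Ω Ω' : Type*} {mΩ : MeasurableSpace Ω} {mΩ' : MeasurableSpace Ω'} {ν : Measure Ω}
  {π : Ω → Ω'} {ι κ : Type*} {A : Ω' → ι → ℝ} {B : Ω' → κ → ℝ}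

lemma L2.comp_map (hπ : Measurable π) (hA : L2 (ν.map π) A) : L2 ν fun ω => A (π ω) := fun i =>
  (hA i).comp_of_map hπ.aemeasurable

lemma cc_map (hπ : Measurable π) (hA : L2 (ν.map π) A) (hB : L2 (ν.map π) B) :
    cc ν (fun ω => A (π ω)) (fun ω => B (π ω)) = cc (ν.map π) A B := by
  ext i j
  exact (integral_map hπ.aemeasurable (hA.integrable_mul hB i j).1).symm

lemma indepFun_of_map {α β : Type*} [MeasurableSpace α] [MeasurableSpace β] {f : Ω' → α}
    {g : Ω' → β} [IsFiniteMeasure ν] (hπ : Measurable π) (hf : Measurable f) (hg : Measurable g)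
    (h : IndepFun f g (ν.map π)) : IndepFun (fun ω => f (π ω)) (fun ω => g (π ω)) ν := by
  rw [indepFun_iff_measure_inter_preimage_eq_mul] at h ⊢
  intro s t hs ht
  have := h s t hs ht
  rw [Measure.map_apply hπ ((hf hs).inter (hg ht)), Measure.map_apply hπ (hf hs),
    Measure.map_apply hπ (hg ht)] at this
  exact this

end Transfer

/-! ### Regressions within the source and the standardized innovation. -/

section Rate

open Matrix

variable {E : Type*} [NormedAddCommGroup E] [NormedSpace ℝ E] [MeasurableSpace E] [BorelSpace E]
  {Q : Measure E} {k k₁ m : ℕ}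
  {X : E →L[ℝ] Vec k} {Y : E →L[ℝ] Vec m} {Y₁ : E →L[ℝ] Vec k₁}

lemma mv_joinV {Ω ι κ σ : Type*} [Fintype ι] [Fintype κ] (M : Matrix σ (ι ⊕ κ) ℝ)
    (A : Ω → ι → ℝ) (B : Ω → κ → ℝ) : mv M (joinV A B) = mv M.toCols₁ A + mv M.toCols₂ B := by
  ext ω i
  simp [mv, joinV, mulVec, dotProduct]

@[fun_prop]
lemma measurable_mulVec {Ω ι κ : Type*} [MeasurableSpace Ω] [Fintype ι] {A : Ω → ι → ℝ}
    (hA : Measurable A) (M : Matrix κ ι ℝ) : Measurable fun ω => M *ᵥ A ω :=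
  measurable_pi_lambda _ fun i => by
    simp only [mulVec, dotProduct]
    fun_prop

/-- The linear regressions between the components of the source `(X, Y, Y₁)`. -/
structure Regression (Q : Measure E) (X : E →L[ℝ] Vec k) (Y : E →L[ℝ] Vec m)
    (Y₁ : E →L[ℝ] Vec k₁) where
  A : Matrix (Fin m) (Fin k) ℝ
  B : Matrix (Fin m) (Fin k₁) ℝ
  F : Matrix (Fin k₁) (Fin m) ℝ
  L₀ : Matrix (Fin k) (Fin k₁) ℝ
  L : Matrix (Fin k) (Fin m) ℝ
  L₁ : Matrix (Fin m) (Fin k₁) ℝ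
  cc_noise_X : cc Q (vc Y - mv A (vc X) - mv B (vc Y₁)) (vc X) = 0
  cc_noise_Y₁ : cc Q (vc Y - mv A (vc X) - mv B (vc Y₁)) (vc Y₁) = 0
  cc_F : cc Q (vc Y₁ - mv F (vc Y)) (vc Y) = 0
  cc_L₀ : cc Q (vc X - mv L₀ (vc Y₁)) (vc Y₁) = 0
  cc_L : cc Q (vc X - mv L (vc Y)) (vc Y) = 0
  cc_L₁ : cc Q (vc Y - mv L₁ (vc Y₁)) (vc Y₁) = 0

lemma exists_regressions (hQ : IsCenteredGaussian Q) : Nonempty (Regression Q X Y Y₁) := by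
  have hX := (isLin_vc X).l2 hQ
  have hY := (isLin_vc Y).l2 hQ
  have hY₁ := (isLin_vc Y₁).l2 hQ
  -- A single regression of `Y` on the concatenation (X, Y₁); its column blocks are the matrices `A`
  -- and `B`.
  obtain ⟨M, hM⟩ := exists_regression hY (hX.joinV hY₁)
  obtain ⟨F, hF⟩ := exists_regression hY₁ hY
  obtain ⟨L₀, hL₀⟩ := exists_regression hX hY₁
  obtain ⟨L, hL⟩ := exists_regression hX hY
  obtain ⟨L₁, hL₁⟩ := exists_regression hY hY₁
  rw [mv_joinV, ← sub_sub] at hM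
  refine ⟨⟨M.toCols₁, M.toCols₂, F, L₀, L, L₁, ?_, ?_, hF, hL₀, hL, hL₁⟩⟩
  · ext i j
    exact congrFun (congrFun hM i) (.inl j)
  · ext i j
    exact congrFun (congrFun hM i) (.inr j)

variable [CompleteSpace E] [SecondCountableTopology E]
  {Ω : Type*} [MeasurableSpace Ω] {ν : Measure Ω} [IsProbabilityMeasure ν] {π : Ω → E}

/-- Mutual information as a divergence involving the standardized innovation. -/
lemma condMutualInfo_eq_klDiv_innovation {𝒢 : Type*} [MeasurableSpace 𝒢] [StandardBorelSpace 𝒢]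
    [Nonempty 𝒢] {G : Ω → 𝒢} (hQ : IsCenteredGaussian Q) (hπ : Measurable π) (hν : ν.map π = Q)
    (hG : Measurable G) {L : Matrix (Fin k) (Fin m) ℝ}
    (hL : cc Q (vc X - mv L (vc Y)) (vc Y) = 0) {r : Type} [Fintype r] [DecidableEq r]
    {S : Matrix (Fin k) r ℝ} {P : Matrix r (Fin k) ℝ} (hPS : P * S = 1)
    (hS : S * Sᵀ = cc Q (vc X - mv L (vc Y)) (vc X - mv L (vc Y))) :
    (ν.map (fun ω => mv P (vc X - mv L (vc Y)) (π ω)) = Measure.pi fun _ => gaussianReal 0 1) ∧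
    condMutualInfo ν (fun ω => X (π ω)) G (fun ω => Y (π ω)) =
      klDiv (ν.map fun ω => ((Y (π ω), G ω), mv P (vc X - mv L (vc Y)) (π ω)))
        ((ν.map fun ω => (Y (π ω), G ω)).prod
          (ν.map fun ω => mv P (vc X - mv L (vc Y)) (π ω))) := by
  have hx := isLin_vc X
  have hy := isLin_vc Y
  have hr := hx.sub (hy.mv L)
  have hz := hr.mv P
  have hzm := hz.measurable
  constructor
  · have h1 : cc Q (mv P (vc X - mv L (vc Y))) (mv P (vc X - mv L (vc Y))) =
        diagonal fun _ => ((1 : NNReal) : ℝ) := by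
      rw [cc_mv_left (hr.l2 hQ) (hz.l2 hQ), cc_mv_right (hr.l2 hQ) (hr.l2 hQ), ← hS]
      have : P * (S * Sᵀ * Pᵀ) = (P * S) * (P * S)ᵀ := by
        simp only [transpose_mul, Matrix.mul_assoc]
      rw [this, hPS]
      simp
    rw [← hz.map_eq_pi hQ h1, ← hν, Measure.map_map hzm hπ]
    rfl
  · have h1 : ∀ᵐ e ∂Q, (vc X - mv L (vc Y)) e = mv S (mv P (vc X - mv L (vc Y))) e :=
      ae_eq_mv_of_factorization (hr.l2 hQ) hPS hS
    have h2 : cc Q (mv P (vc X - mv L (vc Y))) (vc Y) = 0 := by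
      rw [cc_mv_left (hr.l2 hQ) (hy.l2 hQ), hL, Matrix.mul_zero]
    have h3 := hz.indepFun hQ hy h2
    -- Given Y = c, almost surely X = L c + S z with the innovation z independent of `Y`, and P (x -
    -- L c) recovers z.
    refine condMutualInfo_eq_klDiv_prod ν (φ := fun p => WithLp.toLp 2 (L *ᵥ p.1.ofLp + S *ᵥ p.2))
      (ψ := fun p => P *ᵥ (p.2.ofLp - L *ᵥ p.1.ofLp)) (by fun_prop) hG (by fun_prop)
      (by fun_prop) (by fun_prop) (by fun_prop) (fun c z => ?_) ?_ ?_
    · simp [mulVec_mulVec, hPS]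
    · rw [← hν] at h1
      filter_upwards [ae_of_ae_map hπ.aemeasurable h1] with ω hω
      simp only [Pi.sub_apply, mv, vc] at hω ⊢
      rw [← hω]
      simp
    · rw [← hν] at h3
      have h4 := indepFun_of_map hπ hzm hy.measurable h3
      exact h4.symm.comp (φ := WithLp.toLp 2) (ψ := id) (by fun_prop) measurable_id

end Rate

/-! ### Decomposition of the rate for arbitrary observations of a Gaussian source. -/

section SideObservation

open Matrix

variable {E : Type*} [NormedAddCommGroup E] [NormedSpace ℝ E] [MeasurableSpace E]
  {Q : Measure E} {k k₁ m : ℕ}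
  {X : E →L[ℝ] Vec k} {Y : E →L[ℝ] Vec m} {Y₁ : E →L[ℝ] Vec k₁}

/-- The part of `Y` that is independent of `(X, Y₁)`. -/
def Regression.noise (R : Regression Q X Y Y₁) : E → Fin m → ℝ :=
  vc Y - mv R.A (vc X) - mv R.B (vc Y₁)

lemma Regression.isLin_noise (R : Regression Q X Y Y₁) : IsLin R.noise :=
  ((isLin_vc Y).sub ((isLin_vc X).mv _)).sub ((isLin_vc Y₁).mv _)

variable [BorelSpace E] {Ω : Type*} [MeasurableSpace Ω] {ν : Measure Ω} [IsProbabilityMeasure ν]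
  {π : Ω → E}
  {𝒢₁ 𝒢₂ : Type*} [MeasurableSpace 𝒢₁] [StandardBorelSpace 𝒢₁] [Nonempty 𝒢₁]
  [MeasurableSpace 𝒢₂] [StandardBorelSpace 𝒢₂] [Nonempty 𝒢₂] {G₁ : Ω → 𝒢₁} {G₂ : Ω → 𝒢₂}

/-- `(X, Y, Y₁)` is a Gaussian source with `X ↔ Y ↔ Y₁`, and `(G₁, G₂)` are observations on an
extension of the sample space with `(G₁, G₂) ↔ X ↔ (Y₁, Y)`. -/
structure Observation (Q : Measure E) (X : E →L[ℝ] Vec k) (Y : E →L[ℝ] Vec m)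
    (Y₁ : E →L[ℝ] Vec k₁) (ν : Measure Ω) [IsProbabilityMeasure ν] (π : Ω → E) (G₁ : Ω → 𝒢₁)
    (G₂ : Ω → 𝒢₂) : Prop where
  gaussian : IsCenteredGaussian Q
  measurable_π : Measurable π
  map_π : ν.map π = Q
  measurable_G₁ : Measurable G₁
  measurable_G₂ : Measurable G₂
  markov_Y : condMutualInfo ν (fun ω => X (π ω)) (fun ω => Y₁ (π ω)) (fun ω => Y (π ω)) = 0
  markov_X : condMutualInfo ν (fun ω => (G₁ ω, G₂ ω)) (fun ω => (Y₁ (π ω), Y (π ω)))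
    (fun ω => X (π ω)) = 0

namespace Observation

variable (hO : Observation Q X Y Y₁ ν π G₁ G₂)
  (R : Regression Q X Y Y₁)
include hO

lemma measurable_X : Measurable fun ω => X (π ω) := X.measurable.comp hO.measurable_π
lemma measurable_Y : Measurable fun ω => Y (π ω) := Y.measurable.comp hO.measurable_π
lemma measurable_Y₁ : Measurable fun ω => Y₁ (π ω) := Y₁.measurable.comp hO.measurable_π

variable [CompleteSpace E] [SecondCountableTopology E]

lemma indepFun_comp {ι κ : Type*} [Fintype ι] [Fintype κ] {f : E → ι → ℝ} {g : E → κ → ℝ}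
    (hf : IsLin f) (hg : IsLin g) (h : cc Q g f = 0) :
    IndepFun (fun ω => f (π ω)) (fun ω => g (π ω)) ν := by
  have h1 := hg.indepFun hO.gaussian hf h
  rw [← hO.map_π] at h1
  exact (indepFun_of_map hO.measurable_π hg.measurable hf.measurable h1).symm

/-- Independence from (X, Y₁) comes from Gaussianity of the source. The observations may be
non-Gaussian; they join because, given `X`, they are independent of (Y₁, Y), and the noise is a
function of (X, Y₁, Y). -/
lemma indepFun_noise :
    IndepFun (fun ω => ((X (π ω), Y₁ (π ω)), (G₁ ω, G₂ ω))) (fun ω => R.noise (π ω)) ν := by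
  have hX := isLin_vc X
  have hY₁ := isLin_vc Y₁
  have h1 : IndepFun (fun ω => (X (π ω), Y₁ (π ω))) (fun ω => R.noise (π ω)) ν := by
    have := hO.indepFun_comp (hX.joinV hY₁) R.isLin_noise
      (cc_joinV_right_eq_zero R.cc_noise_X R.cc_noise_Y₁)
    exact this.comp (φ := fun v => (WithLp.toLp 2 fun i => v (.inl i),
      WithLp.toLp 2 fun i => v (.inr i))) (ψ := id) (by fun_prop) measurable_id
  refine indepFun_of_condMutualInfo_eq_zero (hO.measurable_G₁.prodMk hO.measurable_G₂)
    (hO.measurable_Y₁.prodMk hO.measurable_Y) hO.measurable_X hO.markov_X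
    (d := fun p => p.2.1) (by fun_prop)
    (n := fun p => p.2.2.ofLp - R.A *ᵥ p.1.ofLp - R.B *ᵥ p.2.1.ofLp) (by fun_prop)
    (fun _ => rfl) (fun _ => rfl) h1

/-- Two enlargements of independence from `Y`: `X` joins by the chain X - Y - Y₁, then (G₁, G₂) by
the chain (G₁, G₂) - X - (Y₁, Y). -/
lemma indepFun_Y₁_sub : IndepFun (fun ω => ((X (π ω), Y (π ω)), (G₁ ω, G₂ ω)))
    (fun ω => (vc Y₁ - mv R.F (vc Y)) (π ω)) ν := by
  have hY := isLin_vc Y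
  have hY₁ := isLin_vc Y₁
  have h1 : IndepFun (fun ω => (Y (π ω), Y (π ω))) (fun ω => (vc Y₁ - mv R.F (vc Y)) (π ω)) ν := by
    have := hO.indepFun_comp hY (hY₁.sub (hY.mv _)) R.cc_F
    exact this.comp (φ := fun v => (WithLp.toLp 2 v, WithLp.toLp 2 v)) (ψ := id) (by fun_prop)
      measurable_id
  have h2 := indepFun_of_condMutualInfo_eq_zero hO.measurable_X hO.measurable_Y₁ hO.measurable_Y
    hO.markov_Y (d := fun p => p.1) (by fun_prop) (n := fun p => p.2.ofLp - R.F *ᵥ p.1.ofLp)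
    (by fun_prop) (fun _ => rfl) (fun _ => rfl) h1
  refine indepFun_of_condMutualInfo_eq_zero (hO.measurable_G₁.prodMk hO.measurable_G₂)
    (hO.measurable_Y₁.prodMk hO.measurable_Y) hO.measurable_X hO.markov_X
    (d := fun p => p.2.2) (by fun_prop)
    (n := fun p => p.2.1.ofLp - R.F *ᵥ p.2.2.ofLp) (by fun_prop)
    (fun _ => rfl) (fun _ => rfl) ?_
  exact h2.comp (φ := fun p => (p.2, p.1.1)) (ψ := id) (by fun_prop) measurable_id

include R in
lemma rate_eq : condMutualInfo ν (fun ω => X (π ω)) G₁ (fun ω => Y₁ (π ω)) +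
      condMutualInfo ν (fun ω => X (π ω)) G₂ (fun ω => (Y (π ω), G₁ ω)) =
    condMutualInfo ν (fun ω => Y (π ω)) G₁ (fun ω => Y₁ (π ω)) +
      condMutualInfo ν (fun ω => X (π ω)) (fun ω => (G₁ ω, G₂ ω)) (fun ω => Y (π ω)) := by
  have hX := hO.measurable_X
  have hY := hO.measurable_Y
  have hY₁ := hO.measurable_Y₁
  have hG₁ := hO.measurable_G₁
  have hG₂ := hO.measurable_G₂
  have h2 := hO.indepFun_Y₁_sub R
  have hm : Measurable fun ω => (vc Y₁ - mv R.F (vc Y)) (π ω) :=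
    ((isLin_vc Y₁).sub ((isLin_vc Y).mv _)).measurable.comp hO.measurable_π
  -- In each vanishing term the first argument is a function of the condition and of an independent
  -- noise: Y = A X + B Y₁ + noise in the first, Y₁ = F Y + residual in the other two.
  refine condMutualInfo_add_eq ν hX hY hY₁ hG₁ hG₂ ?_ ?_ ?_
  · refine condMutualInfo_eq_zero ν hY hG₁ (hY₁.prodMk hX)
      (R.isLin_noise.measurable.comp hO.measurable_π)
      (φ := fun p => WithLp.toLp 2 (R.A *ᵥ p.1.2.ofLp + R.B *ᵥ p.1.1.ofLp + p.2)) (by fun_prop)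
      (Filter.Eventually.of_forall fun ω => ?_)
      ((hO.indepFun_noise R).comp (φ := fun p => ((p.1.2, p.1.1), p.2.1)) (ψ := id)
        (by fun_prop) measurable_id)
    simp only [Regression.noise, vc, mv, Pi.sub_apply, Function.comp_apply]
    ext i
    simp
  · refine condMutualInfo_eq_zero ν hY₁ hX (hY.prodMk hG₁) hm
      (φ := fun p => WithLp.toLp 2 (R.F *ᵥ p.1.1.ofLp + p.2)) (by fun_prop)
      (Filter.Eventually.of_forall fun ω => ?_)
      (h2.comp (φ := fun p => ((p.1.2, p.2.1), p.1.1)) (ψ := id) (by fun_prop) measurable_id)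
    simp only [vc, mv, Pi.sub_apply]
    ext i
    simp
  · refine condMutualInfo_eq_zero ν hY₁ hX hY hm
      (φ := fun p => WithLp.toLp 2 (R.F *ᵥ p.1.ofLp + p.2)) (by fun_prop)
      (Filter.Eventually.of_forall fun ω => ?_)
      (h2.comp (φ := fun p => (p.1.2, p.1.1)) (ψ := id) (by fun_prop) measurable_id)
    simp only [vc, mv, Pi.sub_apply]
    ext i
    simp

end Observation
end SideObservation

/-! ### Error covariances entering the rate. -/

section ErrorBounds

open Matrix

/-- A - ρ is a function of the observation, hence uncorrelated with `ρ`. -/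
lemma IsErr.cc_self {Ω ι 𝒢 : Type*} [MeasurableSpace Ω] [MeasurableSpace 𝒢] {μ : Measure Ω}
    {G : Ω → 𝒢} {A ρ : Ω → ι → ℝ} (h : IsErr μ G A ρ) (hA : L2 μ A) : cc μ ρ A = cc μ ρ ρ := by
  have h' := h
  obtain ⟨hL, ⟨t, ht, htA⟩, -⟩ := h'
  have ht2 : L2 μ fun ω => t (G ω) := (hA.sub hL).congr (by
    filter_upwards [htA] with ω hω
    simp [hω])
  rw [cc_congr (Filter.EventuallyEq.refl _ _) htA]
  exact (cc_add_right ht2 hL hL).trans (by rw [h.cc_comp_eq_zero ht ht2, zero_add])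

/-- Bounds on the mutual information in terms of a diagonal error covariance. -/
lemma IsErr.exists_le_klDiv {Ω 𝒢 : Type*} [MeasurableSpace Ω] [MeasurableSpace 𝒢] {μ : Measure Ω}
    [IsProbabilityMeasure μ] {r : Type} [Fintype r] [DecidableEq r] {G : Ω → 𝒢} {Z ρ : Ω → r → ℝ}
    (h : IsErr μ G Z ρ) (hG : Measurable G) (hZ : Measurable Z)
    (hlaw : μ.map Z = Measure.pi fun _ => gaussianReal 0 1) {d : r → ℝ}
    (hd : cc μ ρ ρ = diagonal d)
    (hfin : klDiv (μ.map fun ω => (G ω, Z ω)) ((μ.map G).prod (μ.map Z)) ≠ ∞) :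
    ∃ τ : r → NNReal, (d = fun i => (τ i : ℝ)) ∧ (∀ i, τ i ≠ 0) ∧
      ENNReal.ofReal (∑ i, -(Real.log (τ i) / 2)) ≤
        klDiv (μ.map fun ω => (G ω, Z ω)) ((μ.map G).prod (μ.map Z)) := by
  have hZL : L2 μ Z := fun i => (memLp_of_law_pi hZ (ρ := fun _ => 1) hlaw i).1
  obtain ⟨hL, ⟨t, ht, htA⟩, -⟩ := h
  have ht2 : L2 μ fun ω => t (G ω) := (hZL.sub hL).congr (by
    filter_upwards [htA] with ω hω
    simp [hω])
  have hdi : ∀ i, ∫ ω, (Z ω i - t (G ω) i) ^ 2 ∂μ = d i := fun i => by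
    have := congrFun (congrFun hd i) i
    rw [diagonal_apply_eq] at this
    rw [← this]
    refine integral_congr_ae ?_
    filter_upwards [htA] with ω hω
    simp [hω, sq]
  have h0 : ∀ i, 0 ≤ d i := fun i => by
    rw [← hdi]
    exact integral_nonneg fun _ => sq_nonneg _
  have hne : ∀ i, d i ≠ 0 := fun i => by
    rw [← hdi]
    exact errorVariance_ne_zero hG hZ hlaw ht ht2 hfin i
  have hne' : ∀ i, (d i).toNNReal ≠ 0 := fun i => by
    simpa using lt_of_le_of_ne (h0 i) (hne i).symm
  exact ⟨fun i => (d i).toNNReal, funext fun i => (Real.coe_toNNReal _ (h0 i)).symm, hne',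
    le_klDiv_of_errorVariance hG hZ hlaw ht ht2
      (fun i => by rw [hdi, Real.coe_toNNReal _ (h0 i)]) hne'⟩

namespace Observation

variable {E : Type*} [NormedAddCommGroup E] [NormedSpace ℝ E] [MeasurableSpace E]
  {Q : Measure E} {k k₁ m : ℕ}
  {X : E →L[ℝ] Vec k} {Y : E →L[ℝ] Vec m} {Y₁ : E →L[ℝ] Vec k₁}
  [BorelSpace E] {Ω : Type*} [MeasurableSpace Ω] {ν : Measure Ω} [IsProbabilityMeasure ν]
  {π : Ω → E}
  {𝒢₁ 𝒢₂ : Type*} [MeasurableSpace 𝒢₁] [StandardBorelSpace 𝒢₁] [Nonempty 𝒢₁]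
  [MeasurableSpace 𝒢₂] [StandardBorelSpace 𝒢₂] [Nonempty 𝒢₂] {G₁ : Ω → 𝒢₁} {G₂ : Ω → 𝒢₂}
  (hO : Observation Q X Y Y₁ ν π G₁ G₂)
  (R : Regression Q X Y Y₁) {ι κ : Type*}
include hO

lemma l2_comp {f : E → ι → ℝ} (hf : IsLin f) : L2 ν fun ω => f (π ω) :=
  L2.comp_map hO.measurable_π (hO.map_π ▸ hf.l2 hO.gaussian)

lemma cc_comp {f : E → ι → ℝ} (hf : IsLin f) {g : E → κ → ℝ} (hg : IsLin g) :
    cc ν (fun ω => f (π ω)) (fun ω => g (π ω)) = cc Q f g := by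
  have h := hO.map_π
  subst h
  exact cc_map hO.measurable_π (hf.l2 hO.gaussian) (hg.l2 hO.gaussian)

variable [CompleteSpace E] [SecondCountableTopology E]

lemma integral_comp_eq_zero [Countable ι] {f : E → ι → ℝ} (hf : IsLin f) (j : ι) :
    ∫ ω, f (π ω) j ∂ν = 0 := by
  have h := hf.integral_eq_zero hO.gaussian j
  have hm : Measurable fun e => f e j := (measurable_pi_apply j).comp hf.measurable
  rwa [← hO.map_π, integral_map hO.measurable_π.aemeasurable hm.aestronglyMeasurable] at h

/-- The error is a function of (X, Y₁, G₁), of which the noise is independent. -/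
lemma cc_err_noise {ρ : Ω → Fin k → ℝ}
    (hρ : IsErr ν (fun ω => (Y₁ (π ω), G₁ ω)) (fun ω => vc X (π ω)) ρ) :
    cc ν ρ (fun ω => R.noise (π ω)) = 0 := by
  obtain ⟨hL, ⟨t, ht, htA⟩, -⟩ := hρ
  have h1 : ρ =ᵐ[ν] fun ω => vc X (π ω) - t (Y₁ (π ω), G₁ ω) := by
    filter_upwards [htA] with ω hω
    simp [hω]
  rw [cc_congr h1 (Filter.EventuallyEq.refl _ _)]
  refine cc_eq_zero_of_indepFun (hL.congr h1) (hO.l2_comp R.isLin_noise)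
    (hO.integral_comp_eq_zero R.isLin_noise) ?_
  exact (hO.indepFun_noise R).comp (φ := fun p => p.1.1.ofLp - t (p.1.2, p.2.1)) (ψ := id)
      (by fun_prop) measurable_id

lemma isErr_noise : IsErr ν (fun ω => (Y₁ (π ω), G₁ ω)) (fun ω => R.noise (π ω))
    (fun ω => R.noise (π ω)) := by
  refine isErr_of_indepFun (hO.measurable_Y₁.prodMk hO.measurable_G₁)
    (fun i => (hO.l2_comp R.isLin_noise i).1)
    (hO.l2_comp R.isLin_noise)
    (hO.integral_comp_eq_zero R.isLin_noise)
    ((hO.indepFun_noise R).comp (φ := fun p => (p.1.2, p.2.1)) (ψ := id) (by fun_prop)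
      measurable_id) (t := 0) (by fun_prop) (by simp)

/-- The error in the estimation of the standardized innovation of `Y`. -/
lemma isErr_innovation_Y {ρ : Ω → Fin k → ℝ}
    (hρ : IsErr ν (fun ω => (Y₁ (π ω), G₁ ω)) (fun ω => vc X (π ω)) ρ) {r : Type} [Finite r]
    (P : Matrix r (Fin m) ℝ) :
    IsErr ν (fun ω => (Y₁ (π ω), G₁ ω)) (fun ω => mv P (vc Y - mv R.L₁ (vc Y₁)) (π ω))
      (mv P (mv R.A ρ + fun ω => R.noise (π ω))) ∧
    cc ν (mv P (mv R.A ρ + fun ω => R.noise (π ω))) (mv P (mv R.A ρ + fun ω => R.noise (π ω))) =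
      P * (R.A * cc ν ρ ρ * R.Aᵀ + cc Q R.noise R.noise) * Pᵀ := by
  have hN := hO.l2_comp R.isLin_noise
  constructor
  -- Up to a function of Y₁, Y - L₁ Y₁ equals A X + noise. Estimating `X` leaves A ρ, and the noise
  -- cannot be estimated at all.
  · have h1 := (((hρ.mv R.A).add (hO.isErr_noise R)).add_comp
      (s := fun p => R.B *ᵥ p.1.ofLp - R.L₁ *ᵥ p.1.ofLp) (by fun_prop)).mv P
    refine h1.congr (Filter.Eventually.of_forall fun ω => ?_)
    simp only [mv, Pi.add_apply, Regression.noise, Pi.sub_apply, vc]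
    congr 1
    abel
  · have h0 := hO.cc_err_noise R hρ
    have h0' : cc ν (fun ω => R.noise (π ω)) ρ = 0 := by rw [← cc_transpose, h0, transpose_zero]
    have hA := hρ.1.mv R.A
    have hS := hA.add hN
    rw [cc_mv_left hS (hS.mv P), cc_mv_right hS hS, cc_add_left hA hN hS, cc_add_right hA hN hA,
      cc_add_right hA hN hN, cc_mv_left hρ.1 hN, h0, cc_mv_right hρ.1 hN, h0',
      cc_mv_left hρ.1 hA, cc_mv_right hρ.1 hρ.1, hO.cc_comp R.isLin_noise R.isLin_noise]
    simp [Matrix.mul_assoc]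

end Observation
end ErrorBounds

/-! ### Lower bound on the rate in terms of the two error covariances. -/

section LowerBound

open Matrix

variable {E : Type*} [NormedAddCommGroup E] [NormedSpace ℝ E] [MeasurableSpace E]
  {Q : Measure E} {k k₁ m : ℕ}
  {X : E →L[ℝ] Vec k} {Y : E →L[ℝ] Vec m} {Y₁ : E →L[ℝ] Vec k₁}

namespace Regression

variable (R : Regression Q X Y Y₁)

/-- The error in the linear estimation of `X` from `Y₁`. -/
def errX₁ : E → Fin k → ℝ := vc X - mv R.L₀ (vc Y₁)

/-- The error in the linear estimation of `X` from `Y`. -/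
def errX : E → Fin k → ℝ := vc X - mv R.L (vc Y)

/-- The error in the linear estimation of `Y` from `Y₁`. -/
def errY : E → Fin m → ℝ := vc Y - mv R.L₁ (vc Y₁)

lemma isLin_errX₁ : IsLin R.errX₁ := (isLin_vc X).sub ((isLin_vc Y₁).mv _)
lemma isLin_errX : IsLin R.errX := (isLin_vc X).sub ((isLin_vc Y).mv _)
lemma isLin_errY : IsLin R.errY := (isLin_vc Y).sub ((isLin_vc Y₁).mv _)

lemma isErr_errX {Ω 𝒢 : Type*} [MeasurableSpace Ω] [MeasurableSpace 𝒢] {ν : Measure Ω}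
    {π : Ω → E} {G : Ω → 𝒢} {ρ : Ω → Fin k → ℝ}
    (hρ : IsErr ν (fun ω => (Y (π ω), G ω)) (fun ω => vc X (π ω)) ρ) {r : Type} [Fintype r]
    (P : Matrix r (Fin k) ℝ) :
    IsErr ν (fun ω => (Y (π ω), G ω)) (fun ω => mv P R.errX (π ω)) (mv P ρ) := by
  have h1 := (hρ.add_comp (s := fun p => - (R.L *ᵥ p.1.ofLp)) (by fun_prop)).mv P
  refine h1.congr (Filter.Eventually.of_forall fun ω => ?_)
  simp only [mv, Pi.add_apply, Regression.errX, Pi.sub_apply, vc]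
  congr 1

end Regression

/-- A description of the optimal rate for Gaussian observations under which `X` has error
covariance `Ka` given the first observation and `Y₁`, and `Kb` given all observations and `Y`. -/
structure RateSpec (R : Regression Q X Y Y₁) (Ka Kb : Matrix (Fin k) (Fin k) ℝ) where
  r : Type
  fintype_r : Fintype r
  decEq_r : DecidableEq r
  S : Matrix (Fin k) r ℝ
  P : Matrix r (Fin k) ℝ
  τ : r → NNReal
  r₁ : Type
  fintype_r₁ : Fintype r₁
  decEq_r₁ : DecidableEq r₁
  S₁ : Matrix (Fin m) r₁ ℝ
  P₁ : Matrix r₁ (Fin m) ℝ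
  τ₁ : r₁ → NNReal
  P_mul_S : P * S = 1
  S_mul_S : S * Sᵀ = cc Q R.errX R.errX
  S_mul_τ : S * diagonal (fun i => (τ i : ℝ)) * Sᵀ = Kb
  τ_ne_zero : ∀ i, τ i ≠ 0
  P₁_mul_S₁ : P₁ * S₁ = 1
  S₁_mul_S₁ : S₁ * S₁ᵀ = cc Q R.errY R.errY
  τ₁_eq : P₁ * (R.A * Ka * R.Aᵀ + cc Q R.noise R.noise) * P₁ᵀ = diagonal fun i => (τ₁ i : ℝ)
  τ₁_ne_zero : ∀ i, τ₁ i ≠ 0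
  isUnit : IsUnit Ka
  -- These conditions supply the Gaussian channels. The first matrix is the precision gain due to
  -- G₁. In the second, τ⁻¹ - 1 is the gain due to (G₁, G₂) in standardized coordinates, from which
  -- the part already supplied by G₁ is subtracted.
  posSemidef_first : (Ka⁻¹ - (cc Q R.errX₁ R.errX₁)⁻¹).PosSemidef
  posSemidef_second : ((diagonal fun i => (τ i : ℝ)⁻¹) - 1 -
    Sᵀ * (Ka⁻¹ - (cc Q R.errX₁ R.errX₁)⁻¹) * S).PosSemidef

attribute [instance] RateSpec.fintype_r RateSpec.decEq_r RateSpec.fintype_r₁ RateSpec.decEq_r₁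

/-- The rate described by a rate specification. -/
def RateSpec.rate {R : Regression Q X Y Y₁} {Ka Kb : Matrix (Fin k) (Fin k) ℝ}
    (s : RateSpec R Ka Kb) : ℝ≥0∞ :=
  ENNReal.ofReal (∑ i, -(Real.log (s.τ₁ i) / 2)) + ENNReal.ofReal (∑ i, -(Real.log (s.τ i) / 2))

namespace Observation

variable [BorelSpace E] {Ω : Type*} [MeasurableSpace Ω] {ν : Measure Ω} [IsProbabilityMeasure ν]
  {π : Ω → E}
  {𝒢₁ 𝒢₂ : Type*} [MeasurableSpace 𝒢₁] [StandardBorelSpace 𝒢₁] [Nonempty 𝒢₁]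
  [MeasurableSpace 𝒢₂] [StandardBorelSpace 𝒢₂] [Nonempty 𝒢₂] {G₁ : Ω → 𝒢₁} {G₂ : Ω → 𝒢₂}
  (hO : Observation Q X Y Y₁ ν π G₁ G₂) (R : Regression Q X Y Y₁) {ρ ρ' : Ω → Fin k → ℝ}
  (hρ : IsErr ν (fun ω => (Y₁ (π ω), G₁ ω)) (fun ω => vc X (π ω)) ρ)
  [CompleteSpace E] [SecondCountableTopology E]
include hO

omit [BorelSpace E] [CompleteSpace E] [SecondCountableTopology E] in
lemma ae_comp {p : E → Prop} (h : ∀ᵐ e ∂Q, p e) : ∀ᵐ ω ∂ν, p (π ω) :=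
  ae_of_ae_map hO.measurable_π.aemeasurable (hO.map_π ▸ h)

include hρ

omit [CompleteSpace E] [SecondCountableTopology E] in
lemma cc_err_Y₁ : cc ν ρ (fun ω => vc Y₁ (π ω)) = 0 :=
  hρ.cc_comp_eq_zero (s := fun p => p.1.ofLp) (by fun_prop) (hO.l2_comp (isLin_vc Y₁))

/-- A finite rate makes every error variance of the standardized innovation nonzero. Since K_{X|Y₁}
is invertible, `S` and `P` are mutually inverse, so the error covariance is congruent to an
invertible diagonal matrix. -/
lemma isUnit_cc_err (hK : IsUnit (cc Q R.errX₁ R.errX₁))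
    (hfin : condMutualInfo ν (fun ω => X (π ω)) G₁ (fun ω => Y₁ (π ω)) ≠ ∞) :
    IsUnit (cc ν ρ ρ) := by
  have hr := R.isLin_errX₁.l2 hO.gaussian
  obtain ⟨r, i1, i2, S, P, d, hPS, hS, hd⟩ :=
    exists_simultaneous_diagonalization (posSemidef_cc_self hr) (cc_transpose (A := ρ) (μ := ν))
  obtain ⟨hlaw, hI⟩ := condMutualInfo_eq_klDiv_innovation hO.gaussian hO.measurable_π hO.map_π
    hO.measurable_G₁ R.cc_L₀ hPS hS
  rw [hI] at hfin
  have hE : IsErr ν (fun ω => (Y₁ (π ω), G₁ ω))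
      (fun ω => mv P (vc X - mv R.L₀ (vc Y₁)) (π ω)) (mv P ρ) := by
    have h1 := (hρ.add_comp (s := fun p => - (R.L₀ *ᵥ p.1.ofLp)) (by fun_prop)).mv P
    refine h1.congr (Filter.Eventually.of_forall fun ω => ?_)
    simp only [mv, Pi.add_apply, Pi.sub_apply, vc]
    congr 1
  have hcc : cc ν (mv P ρ) (mv P ρ) = diagonal d := by
    rw [cc_mv_left hρ.1 (hρ.1.mv P), cc_mv_right hρ.1 hρ.1, ← hd, Matrix.mul_assoc]
  obtain ⟨τ, rfl, hτ0, -⟩ := hE.exists_le_klDiv (hO.measurable_Y₁.prodMk hO.measurable_G₁)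
    ((R.isLin_errX₁.mv P).measurable.comp hO.measurable_π) hlaw hcc hfin
  obtain ⟨K', hK', -⟩ := isUnit_iff_exists.1 hK
  have hSP : S * P = 1 := by
    have h1 : P = Sᵀ * K' := by
      calc P = P * (S * Sᵀ * K') := by rw [hS, hK', Matrix.mul_one]
        _ = P * S * Sᵀ * K' := by simp only [Matrix.mul_assoc]
        _ = _ := by rw [hPS, Matrix.one_mul]
    rw [h1, ← Matrix.mul_assoc, hS, hK']
  refine (isUnit_iff_exists_inv).2 ⟨Pᵀ * (diagonal fun i => (τ i : ℝ)⁻¹) * P, ?_⟩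
  have h2 : (diagonal fun i => (τ i : ℝ)) * (diagonal fun i => (τ i : ℝ)⁻¹) = 1 := by
    rw [diagonal_mul_diagonal, ← diagonal_one]
    congr 1
    funext i
    exact mul_inv_cancel₀ (by simpa using hτ0 i)
  calc cc ν ρ ρ * (Pᵀ * (diagonal fun i => (τ i : ℝ)⁻¹) * P)
      = (S * P) * cc ν ρ ρ * (Pᵀ * (diagonal fun i => (τ i : ℝ)⁻¹) * P) := by
        rw [hSP, Matrix.one_mul]
    _ = S * (P * cc ν ρ ρ * Pᵀ) * (diagonal fun i => (τ i : ℝ)⁻¹) * P := by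
        simp only [Matrix.mul_assoc]
    _ = S * ((diagonal fun i => (τ i : ℝ)) * (diagonal fun i => (τ i : ℝ)⁻¹)) * P := by
        rw [hd]; simp only [Matrix.mul_assoc]
    _ = 1 := by rw [h2, Matrix.mul_one, hSP]

omit [CompleteSpace E] [SecondCountableTopology E] in
lemma cc_err_X : cc ν ρ (fun ω => vc X (π ω)) = cc ν ρ ρ :=
  hρ.cc_self (hO.l2_comp (isLin_vc X))

omit hρ [CompleteSpace E] [SecondCountableTopology E] in
lemma cc_errX₁_X :
    cc ν (fun ω => R.errX₁ (π ω)) (fun ω => vc X (π ω)) = cc Q R.errX₁ R.errX₁ := by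
  have hx := (isLin_vc X).l2 hO.gaussian
  have hy := (isLin_vc Y₁).l2 hO.gaussian
  have hr := R.isLin_errX₁.l2 hO.gaussian
  rw [hO.cc_comp R.isLin_errX₁ (isLin_vc X)]
  conv_rhs => rw [show cc Q R.errX₁ R.errX₁ = cc Q R.errX₁ (vc X - mv R.L₀ (vc Y₁)) from rfl]
  rw [cc_sub_right hx (hy.mv _) hr, cc_mv_right hy hr,
    show cc Q R.errX₁ (vc Y₁) = 0 from R.cc_L₀]
  simp

/-- The vector `K_{X|Y₁}⁻¹ (X - E[X|Y₁]) - Ka⁻¹ (X - E[X|G₁,Y₁])` has second moment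
`Ka⁻¹ - K_{X|Y₁}⁻¹` and is uncorrelated with the source. -/
lemma cc_gain (hK : IsUnit (cc Q R.errX₁ R.errX₁)) (hKa : IsUnit (cc ν ρ ρ)) {D : Ω → Fin k → ℝ}
    (hD : D = mv (cc Q R.errX₁ R.errX₁)⁻¹ (fun ω => R.errX₁ (π ω)) - mv (cc ν ρ ρ)⁻¹ ρ) :
    L2 ν D ∧ cc ν D D = (cc ν ρ ρ)⁻¹ - (cc Q R.errX₁ R.errX₁)⁻¹ ∧
      cc ν D (fun ω => vc X (π ω)) = 0 ∧ cc ν D (fun ω => vc Y (π ω)) = 0 := by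
  have hx := hO.l2_comp (isLin_vc X)
  have hy := hO.l2_comp (isLin_vc Y)
  have hy₁ := hO.l2_comp (isLin_vc Y₁)
  have hr := hO.l2_comp R.isLin_errX₁
  have hN := hO.l2_comp R.isLin_noise
  have h1 := hr.mv (cc Q R.errX₁ R.errX₁)⁻¹
  have h2 := hρ.1.mv (cc ν ρ ρ)⁻¹
  have hL : L2 ν D := hD ▸ h1.sub h2
  have hKi : (cc Q R.errX₁ R.errX₁)⁻¹ * cc Q R.errX₁ R.errX₁ = 1 :=
    nonsing_inv_mul _ ((isUnit_iff_isUnit_det _).1 hK)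
  have hKai : (cc ν ρ ρ)⁻¹ * cc ν ρ ρ = 1 := nonsing_inv_mul _ ((isUnit_iff_isUnit_det _).1 hKa)
  have hKai' : cc ν ρ ρ * (cc ν ρ ρ)⁻¹ = 1 := mul_nonsing_inv _ ((isUnit_iff_isUnit_det _).1 hKa)
  have hr₁ : cc ν (fun ω => R.errX₁ (π ω)) (fun ω => vc Y₁ (π ω)) = 0 := by
    rw [hO.cc_comp R.isLin_errX₁ (isLin_vc Y₁)]
    exact R.cc_L₀
  have eX : cc ν D (fun ω => vc X (π ω)) = 0 := by
    rw [hD, cc_sub_left h1 h2 hx, cc_mv_left hr hx, cc_mv_left hρ.1 hx, hO.cc_errX₁_X R,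
      hO.cc_err_X hρ, hKi, hKai, sub_self]
  have eY₁ : cc ν D (fun ω => vc Y₁ (π ω)) = 0 := by
    rw [hD, cc_sub_left h1 h2 hy₁, cc_mv_left hr hy₁, cc_mv_left hρ.1 hy₁, hr₁,
      hO.cc_err_Y₁ hρ]
    simp
  have eN : cc ν D (fun ω => R.noise (π ω)) = 0 := by
    have h3 : cc ν (fun ω => R.errX₁ (π ω)) (fun ω => R.noise (π ω)) = 0 := by
      rw [hO.cc_comp R.isLin_errX₁ R.isLin_noise, ← cc_transpose]
      have hN := R.isLin_noise.l2 hO.gaussian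
      have hy := (isLin_vc Y₁).l2 hO.gaussian
      rw [Regression.errX₁, cc_sub_right ((isLin_vc X).l2 hO.gaussian) (hy.mv _) hN,
        cc_mv_right hy hN, show cc Q R.noise (vc X) = 0 from R.cc_noise_X,
        show cc Q R.noise (vc Y₁) = 0 from R.cc_noise_Y₁]
      simp
    rw [hD, cc_sub_left h1 h2 hN, cc_mv_left hr hN, cc_mv_left hρ.1 hN, h3,
      hO.cc_err_noise R hρ]
    simp
  have eD : cc ν D D = (cc ν ρ ρ)⁻¹ - (cc Q R.errX₁ R.errX₁)⁻¹ := by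
    -- `D` is uncorrelated with X - L₀ Y₁, which reduces E[D Dᵀ] to -E[D ρᵀ] Ka⁻¹.
    have e1 : cc ν D (fun ω => R.errX₁ (π ω)) = 0 := by
      have : (fun ω => R.errX₁ (π ω)) =
          (fun ω => vc X (π ω)) - mv R.L₀ (fun ω => vc Y₁ (π ω)) := rfl
      rw [this, cc_sub_right hx (hy₁.mv _) hL, cc_mv_right hy₁ hL, eX, eY₁]
      simp
    have e2 : cc ν (fun ω => R.errX₁ (π ω)) ρ = cc ν ρ ρ := by
      have : (fun ω => R.errX₁ (π ω)) =
          (fun ω => vc X (π ω)) - mv R.L₀ (fun ω => vc Y₁ (π ω)) := rfl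
      rw [← cc_transpose, this, cc_sub_right hx (hy₁.mv _) hρ.1, cc_mv_right hy₁ hρ.1,
        hO.cc_err_Y₁ hρ, hO.cc_err_X hρ, Matrix.zero_mul, sub_zero, cc_transpose]
    have e3 : cc ν D ρ = (cc Q R.errX₁ R.errX₁)⁻¹ * cc ν ρ ρ - 1 := by
      rw [hD, cc_sub_left h1 h2 hρ.1, cc_mv_left hr hρ.1, cc_mv_left hρ.1 hρ.1, e2, hKai]
    have e4 : cc ν D D = cc ν D (mv (cc Q R.errX₁ R.errX₁)⁻¹ (fun ω => R.errX₁ (π ω)) -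
        mv (cc ν ρ ρ)⁻¹ ρ) := by rw [← hD]
    rw [e4, cc_sub_right h1 h2 hL, cc_mv_right hr hL, cc_mv_right hρ.1 hL, e1, e3,
      transpose_nonsing_inv, transpose_nonsing_inv, cc_transpose, cc_transpose, Matrix.sub_mul,
      Matrix.mul_assoc, hKai']
    simp
  refine ⟨hL, eD, eX, ?_⟩
  -- `Y` is a linear combination of X, Y₁ and the noise, and `D` is uncorrelated with each of them.
  have : (fun ω => vc Y (π ω)) = mv R.A (fun ω => vc X (π ω)) + mv R.B (fun ω => vc Y₁ (π ω)) +
      fun ω => R.noise (π ω) := by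
    funext ω
    simp only [Pi.add_apply, Regression.noise, Pi.sub_apply, mv]
    abel
  rw [this, cc_add_right ((hx.mv _).add (hy₁.mv _)) hN hL, cc_add_right (hx.mv _) (hy₁.mv _) hL,
    cc_mv_right hx hL, cc_mv_right hy₁ hL, eX, eY₁, eN]
  simp

/-- With T = diag(τ), z the standardized innovation and `D` the vector of `cc_gain`, the matrix is
the second moment matrix of T⁻¹ ρ' - (z - Sᵀ D): T⁻¹ ρ' has second moments T⁻¹, while z - Sᵀ D has
second moments 1 + Sᵀ M S, equal to its mixed moments with T⁻¹ ρ'. The inequality thus holds for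
non-Gaussian observations too. -/
lemma posSemidef_gain (hK : IsUnit (cc Q R.errX₁ R.errX₁)) (hKa : IsUnit (cc ν ρ ρ))
    {r : Type} [Fintype r] [DecidableEq r] {S : Matrix (Fin k) r ℝ} {P : Matrix r (Fin k) ℝ}
    (hPS : P * S = 1) (hS : S * Sᵀ = cc Q R.errX R.errX) {ρ' : Ω → r → ℝ}
    (hρ' : IsErr ν (fun ω => (Y (π ω), (G₁ ω, G₂ ω))) (fun ω => mv P R.errX (π ω)) ρ')
    {τ : r → ℝ} (hτ : ∀ i, τ i ≠ 0) (hcc : cc ν ρ' ρ' = diagonal τ) :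
    ((diagonal fun i => (τ i)⁻¹) - 1 -
      Sᵀ * ((cc ν ρ ρ)⁻¹ - (cc Q R.errX₁ R.errX₁)⁻¹) * S).PosSemidef := by
  obtain ⟨D, hD⟩ : ∃ D, D = mv (cc Q R.errX₁ R.errX₁)⁻¹ (fun ω => R.errX₁ (π ω)) -
    mv (cc ν ρ ρ)⁻¹ ρ := ⟨_, rfl⟩
  obtain ⟨hDL, hDD, hDX, hDY⟩ := hO.cc_gain R hρ hK hKa hD
  set M := (cc ν ρ ρ)⁻¹ - (cc Q R.errX₁ R.errX₁)⁻¹ with hM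
  have hx := hO.l2_comp (isLin_vc X)
  have hy := hO.l2_comp (isLin_vc Y)
  have hr := hO.l2_comp R.isLin_errX
  have hz := hO.l2_comp (R.isLin_errX.mv P)
  have hrQ := R.isLin_errX.l2 hO.gaussian
  have hMt : Mᵀ = M := by rw [← hDD, cc_transpose]
  have hzz : cc ν (fun ω => mv P R.errX (π ω)) (fun ω => mv P R.errX (π ω)) = 1 := by
    rw [hO.cc_comp (R.isLin_errX.mv P) (R.isLin_errX.mv P), cc_mv_left hrQ (hrQ.mv P),
      cc_mv_right hrQ hrQ, ← hS]
    have : P * (S * Sᵀ * Pᵀ) = (P * S) * (P * S)ᵀ := by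
      simp only [transpose_mul, Matrix.mul_assoc]
    rw [this, hPS]
    simp
  have hDz : cc ν D (fun ω => mv P R.errX (π ω)) = 0 := by
    have : (fun ω => mv P R.errX (π ω)) =
        mv P ((fun ω => vc X (π ω)) - mv R.L (fun ω => vc Y (π ω))) := rfl
    rw [this, cc_mv_right (hx.sub (hy.mv _)) hDL, cc_sub_right hx (hy.mv _) hDL,
      cc_mv_right hy hDL, hDX, hDY]
    simp
  have hzD : cc ν (fun ω => mv P R.errX (π ω)) D = 0 := by rw [← cc_transpose, hDz, transpose_zero]
  have hρY : cc ν ρ' (fun ω => vc Y (π ω)) = 0 :=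
    hρ'.cc_comp_eq_zero (s := fun p => p.1.ofLp) (by fun_prop) hy
  have hρz : cc ν ρ' (fun ω => mv P R.errX (π ω)) = diagonal τ := by rw [hρ'.cc_self hz, hcc]
  have hrz : (fun ω => R.errX (π ω)) =ᵐ[ν] mv S (fun ω => mv P R.errX (π ω)) :=
    hO.ae_comp (ae_eq_mv_of_factorization hrQ hPS hS)
  have hρX : cc ν ρ' (fun ω => vc X (π ω)) = diagonal τ * Sᵀ := by
    have : (fun ω => vc X (π ω)) =
        (fun ω => R.errX (π ω)) + mv R.L (fun ω => vc Y (π ω)) := by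
      funext ω
      simp only [Pi.add_apply, Regression.errX, Pi.sub_apply, mv]
      abel
    rw [this, cc_add_right hr (hy.mv _) hρ'.1, cc_mv_right hy hρ'.1, hρY,
      cc_congr (Filter.EventuallyEq.refl _ _) hrz, cc_mv_right hz hρ'.1, hρz]
    simp
  -- D + M X is a function of (Y₁, G₁). Once `ρ'` is orthogonal to it, E[ρ' Dᵀ] = -E[ρ' Xᵀ] M.
  have hρD : cc ν ρ' D = - (diagonal τ * Sᵀ * M) := by
    obtain ⟨hL, ⟨t, ht, htA⟩, -⟩ := hρ
    let s : Vec k₁ × 𝒢₁ → Fin k → ℝ := fun p =>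
      (cc ν ρ ρ)⁻¹ *ᵥ t p - (cc Q R.errX₁ R.errX₁)⁻¹ *ᵥ (R.L₀ *ᵥ p.1.ofLp)
    have hs : Measurable s := by fun_prop
    have e1 : D + mv M (fun ω => vc X (π ω)) =ᵐ[ν] fun ω => s (Y₁ (π ω), G₁ ω) := by
      filter_upwards [htA] with ω hω
      have hρω : ρ ω = vc X (π ω) - t (Y₁ (π ω), G₁ ω) := by rw [hω]; simp
      simp only [hD, Pi.add_apply, Pi.sub_apply, mv, hρω, hM, Regression.errX₁, mulVec_sub,
        sub_mulVec, s, vc]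
      abel
    have hsL : L2 ν fun ω => s (Y₁ (π ω), G₁ ω) := (hDL.add (hx.mv M)).congr e1
    -- Y₁ is F Y plus a residual independent of X, Y and the observations. Adding the residual to
    -- the observation leaves `ρ'` an optimal error, and the function at hand becomes a function of
    -- the enlarged observation.
    have e2 : cc ν ρ' (fun ω => s (Y₁ (π ω), G₁ ω)) = 0 := by
      have hm : Measurable fun ω => (vc Y₁ - mv R.F (vc Y)) (π ω) :=
        ((isLin_vc Y₁).sub ((isLin_vc Y).mv _)).measurable.comp hO.measurable_π
      have h1 := hρ'.prodMk_indepFun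
        (hO.measurable_Y.prodMk (hO.measurable_G₁.prodMk hO.measurable_G₂))
        ((R.isLin_errX.mv P).measurable.comp hO.measurable_π) hm
        ((hO.indepFun_Y₁_sub R).comp
          (φ := fun p => ((p.1.2, p.2), P *ᵥ (p.1.1.ofLp - R.L *ᵥ p.1.2.ofLp))) (ψ := id)
          (by fun_prop) measurable_id)
      have h2 : ∀ ω, Y₁ (π ω) = WithLp.toLp 2 (R.F *ᵥ (Y (π ω)).ofLp +
          (vc Y₁ - mv R.F (vc Y)) (π ω)) := fun ω => by
        simp only [Pi.sub_apply, vc, mv]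
        ext i
        simp
      have h3 : (fun ω => s (Y₁ (π ω), G₁ ω)) = fun ω => s (WithLp.toLp 2 (R.F *ᵥ (Y (π ω)).ofLp +
          (vc Y₁ - mv R.F (vc Y)) (π ω)), G₁ ω) := by
        funext ω
        rw [← h2]
      rw [h3] at hsL ⊢
      exact h1.cc_comp_eq_zero
        (s := fun p => s (WithLp.toLp 2 (R.F *ᵥ p.1.1.ofLp + p.2), p.1.2.1)) (by fun_prop) hsL
    have e3 := cc_congr (Filter.EventuallyEq.refl _ ρ') e1
    rw [e2, cc_add_right hDL (hx.mv M) hρ'.1, cc_mv_right hx hρ'.1, hρX, hMt] at e3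
    exact eq_neg_of_add_eq_zero_left e3
  have hξ := hz.sub (hDL.mv Sᵀ)
  have hT : (diagonal fun i => (τ i)⁻¹) * diagonal τ = (1 : Matrix r r ℝ) := by
    rw [diagonal_mul_diagonal, ← diagonal_one]
    congr 1
    funext i
    exact inv_mul_cancel₀ (hτ i)
  have h1 := hρ'.1.mv (diagonal fun i => (τ i)⁻¹)
  have e1 : cc ν ρ' ((fun ω => mv P R.errX (π ω)) - mv Sᵀ D) =
      diagonal τ * (1 + Sᵀ * M * S) := by
    rw [cc_sub_right hz (hDL.mv _) hρ'.1, cc_mv_right hDL hρ'.1, hρD, hρz, transpose_transpose,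
      Matrix.mul_add, Matrix.mul_one]
    simp only [Matrix.mul_assoc, Matrix.neg_mul, sub_neg_eq_add]
  have e2 : cc ν ((fun ω => mv P R.errX (π ω)) - mv Sᵀ D)
      ((fun ω => mv P R.errX (π ω)) - mv Sᵀ D) = 1 + Sᵀ * M * S := by
    rw [cc_sub_left hz (hDL.mv _) hξ, cc_sub_right hz (hDL.mv _) hz, cc_mv_left hDL hξ,
      cc_sub_right hz (hDL.mv _) hDL, cc_mv_right hDL hz, cc_mv_right hDL hDL, hzz, hzD, hDz, hDD]
    simp [Matrix.mul_assoc]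
  have e3 : cc ν (mv (diagonal fun i => (τ i)⁻¹) ρ')
      ((fun ω => mv P R.errX (π ω)) - mv Sᵀ D) = 1 + Sᵀ * M * S := by
    rw [cc_mv_left hρ'.1 hξ, e1, ← Matrix.mul_assoc, hT, Matrix.one_mul]
  have e4 : cc ν (mv (diagonal fun i => (τ i)⁻¹) ρ') (mv (diagonal fun i => (τ i)⁻¹) ρ') =
      diagonal fun i => (τ i)⁻¹ := by
    rw [cc_mv_left hρ'.1 h1, cc_mv_right hρ'.1 hρ'.1, hcc, ← Matrix.mul_assoc, hT]
    simp
  have e5 : (1 + Sᵀ * M * S)ᵀ = 1 + Sᵀ * M * S := by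
    simp [transpose_mul, hMt, Matrix.mul_assoc]
  have h2 := posSemidef_cc_self (h1.sub hξ)
  have e6 : cc ν (mv (diagonal fun i => (τ i)⁻¹) ρ' - ((fun ω => mv P R.errX (π ω)) - mv Sᵀ D))
      (mv (diagonal fun i => (τ i)⁻¹) ρ' - ((fun ω => mv P R.errX (π ω)) - mv Sᵀ D)) =
      (diagonal fun i => (τ i)⁻¹) - 1 - Sᵀ * M * S := by
    rw [cc_sub_left h1 hξ (h1.sub hξ), cc_sub_right h1 hξ h1, cc_sub_right h1 hξ hξ, e4, e3, e2,
      ← cc_transpose (A := mv (diagonal fun i => (τ i)⁻¹) ρ'), e3, e5]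
    abel
  rwa [e6] at h2

/-- The rate is bounded below by the one of a Gaussian specification with the same errors. -/
theorem exists_rateSpec (hK : IsUnit (cc Q R.errX₁ R.errX₁))
    (hρ' : IsErr ν (fun ω => (Y (π ω), (G₁ ω, G₂ ω))) (fun ω => vc X (π ω)) ρ')
    (hfin : condMutualInfo ν (fun ω => X (π ω)) G₁ (fun ω => Y₁ (π ω)) +
      condMutualInfo ν (fun ω => X (π ω)) G₂ (fun ω => (Y (π ω), G₁ ω)) ≠ ∞) :
    ∃ s : RateSpec R (cc ν ρ ρ) (cc ν ρ' ρ'), s.rate ≤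
      condMutualInfo ν (fun ω => X (π ω)) G₁ (fun ω => Y₁ (π ω)) +
      condMutualInfo ν (fun ω => X (π ω)) G₂ (fun ω => (Y (π ω), G₁ ω)) := by
  have hKa := hO.isUnit_cc_err R hρ hK (fun h => hfin (by rw [h, top_add]))
  rw [hO.rate_eq R] at hfin ⊢
  have hrX := R.isLin_errX.l2 hO.gaussian
  have hrY := R.isLin_errY.l2 hO.gaussian
  have hGm := hO.measurable_G₁.prodMk hO.measurable_G₂
  obtain ⟨r, i1, i2, S, P, d, hPS, hS, hd⟩ :=
    exists_simultaneous_diagonalization (posSemidef_cc_self hrX) (cc_transpose (A := ρ') (μ := ν))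
  obtain ⟨r₁, i3, i4, S₁, P₁, d₁, hPS₁, hS₁, hd₁⟩ :=
    exists_simultaneous_diagonalization (A := R.A * cc ν ρ ρ * R.Aᵀ + cc Q R.noise R.noise)
      (posSemidef_cc_self hrY) (by
        simp only [transpose_add, transpose_mul, transpose_transpose, cc_transpose,
          Matrix.mul_assoc])
  obtain ⟨hlaw, hI⟩ := condMutualInfo_eq_klDiv_innovation hO.gaussian hO.measurable_π hO.map_π
    hGm R.cc_L hPS hS
  obtain ⟨hlaw₁, hI₁⟩ := condMutualInfo_eq_klDiv_innovation hO.gaussian hO.measurable_π hO.map_π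
    hO.measurable_G₁ R.cc_L₁ hPS₁ hS₁
  rw [hI, hI₁] at hfin ⊢
  obtain ⟨hE₁, hcc₁⟩ := hO.isErr_innovation_Y R hρ P₁
  have hE := R.isErr_errX hρ' P
  have hcc : cc ν (mv P ρ') (mv P ρ') = diagonal d := by
    rw [cc_mv_left hρ'.1 (hρ'.1.mv P), cc_mv_right hρ'.1 hρ'.1, ← hd, Matrix.mul_assoc]
  obtain ⟨τ, rfl, hτ0, hτ⟩ := hE.exists_le_klDiv (hO.measurable_Y.prodMk hGm)
    ((R.isLin_errX.mv P).measurable.comp hO.measurable_π) hlaw hcc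
    (ENNReal.add_ne_top.1 hfin).2
  obtain ⟨τ₁, rfl, hτ₁0, hτ₁⟩ := hE₁.exists_le_klDiv (hO.measurable_Y₁.prodMk hO.measurable_G₁)
    ((R.isLin_errY.mv P₁).measurable.comp hO.measurable_π) hlaw₁ (hcc₁.trans hd₁)
    (ENNReal.add_ne_top.1 hfin).1
  have hτ0' : ∀ i, (τ i : ℝ) ≠ 0 := fun i => by simpa using hτ0 i
  -- S times the error of the standardized innovation is an error of `X`, and errors are unique, so
  -- `τ` determines the error covariance of `X`.
  have hSτ : S * diagonal (fun i => (τ i : ℝ)) * Sᵀ = cc ν ρ' ρ' := by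
    have hrz : mv S (fun ω => mv P R.errX (π ω)) =ᵐ[ν] fun ω => R.errX (π ω) :=
      (hO.ae_comp (ae_eq_mv_of_factorization hrX hPS hS)).mono fun _ h => h.symm
    have h1 := ((hE.mv S).congr hrz).add_comp (s := fun p => R.L *ᵥ p.1.ofLp) (by fun_prop)
    have h2 : ((fun ω => R.errX (π ω)) + fun ω => R.L *ᵥ (Y (π ω)).ofLp) =
        fun ω => vc X (π ω) := by
      funext ω
      simp only [Pi.add_apply, Regression.errX, Pi.sub_apply, mv, vc]
      abel
    rw [h2] at h1
    have h3 := hρ'.ae_eq h1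
    rw [cc_congr h3 h3, cc_mv_left hE.1 (hE.1.mv S), cc_mv_right hE.1 hE.1, hcc, Matrix.mul_assoc]
  exact ⟨⟨r, i1, i2, S, P, τ, r₁, i3, i4, S₁, P₁, τ₁, hPS, hS, hSτ, hτ0, hPS₁, hS₁, hd₁, hτ₁0, hKa,
    (hO.cc_gain R hρ hK hKa rfl).2.1 ▸ posSemidef_cc_self (hO.cc_gain R hρ hK hKa rfl).1,
    hO.posSemidef_gain R hρ hK hKa hPS hS hE hτ0' hcc⟩, add_le_add hτ₁ hτ⟩

end Observation
end LowerBound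

/-! ### Gaussian test channels attain the lower bound. -/

section Achievability

open Matrix

variable {E : Type*} [NormedAddCommGroup E] [NormedSpace ℝ E] [MeasurableSpace E]
  {Q : Measure E} {k k₁ m : ℕ}
  {X : E →L[ℝ] Vec k} {Y : E →L[ℝ] Vec m} {Y₁ : E →L[ℝ] Vec k₁} [BorelSpace E]
  [CompleteSpace E] [SecondCountableTopology E]
  {F : Type*} [NormedAddCommGroup F] [NormedSpace ℝ F] [MeasurableSpace F] [BorelSpace F]
  [CompleteSpace F] [SecondCountableTopology F] {ν : Measure F} [IsProbabilityMeasure ν]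
  {π : F →L[ℝ] E}
  {𝒢₁ 𝒢₂ : Type*} [MeasurableSpace 𝒢₁] [StandardBorelSpace 𝒢₁] [Nonempty 𝒢₁]
  [MeasurableSpace 𝒢₂] [StandardBorelSpace 𝒢₂] [Nonempty 𝒢₂] {G₁ : F → 𝒢₁} {G₂ : F → 𝒢₂}

/-- The noises of the Gaussian test channels: standard, uncorrelated, and uncorrelated with the
source. -/
structure IsTestNoise (ν : Measure F) (π : F →L[ℝ] E) (n n' : F → Fin k → ℝ) : Prop where
  isLin : IsLin n
  isLin' : IsLin n'
  cc_self : cc ν n n = 1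
  cc_self' : cc ν n' n' = 1
  cc_cross : cc ν n n' = 0
  cc_source : ∀ (j : ℕ) (f : E → Fin j → ℝ), IsLin f → cc ν n (fun ω => f (π ω)) = 0
  cc_source' : ∀ (j : ℕ) (f : E → Fin j → ℝ), IsLin f → cc ν n' (fun ω => f (π ω)) = 0

/-- The random vector `G` carries the same information as `u`. -/
def IsRecoding {ι : Type*} (u : F → ι → ℝ) {𝒢 : Type*} [MeasurableSpace 𝒢] (G : F → 𝒢) : Prop :=
  ∃ (γ : (ι → ℝ) → 𝒢) (δ : 𝒢 → ι → ℝ), Measurable γ ∧ Measurable δ ∧ (∀ ω, G ω = γ (u ω)) ∧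
    ∀ ω, u ω = δ (G ω)

namespace Observation

variable (hO : Observation Q X Y Y₁ ν π G₁ G₂) (hν : IsCenteredGaussian ν)
  {R : Regression Q X Y Y₁} (hK : IsUnit (cc Q R.errX₁ R.errX₁))
  {Ka Kb : Matrix (Fin k) (Fin k) ℝ} (s : RateSpec R Ka Kb)
  {n n' : F → Fin k → ℝ} (hn : IsTestNoise ν π n n') {H H' : Matrix (Fin k) (Fin k) ℝ}
  (hH : Hᵀ * H = Ka⁻¹ - (cc Q R.errX₁ R.errX₁)⁻¹)
  (hG₁ : IsRecoding (fun ω => mv H (vc X) (π ω) + n ω) G₁)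

include hO hν s hn hH hK hG₁

omit [CompleteSpace E] [SecondCountableTopology E] [CompleteSpace F] [SecondCountableTopology F] in
/-- The estimation error from the first Gaussian test channel. -/
lemma exists_err_first : ∃ N : F → Fin k → ℝ, IsLin N ∧ cc ν N N = Ka ∧
    cc ν N (fun ω => vc Y₁ (π ω)) = 0 ∧ cc ν N (fun ω => mv H (vc X) (π ω) + n ω) = 0 ∧
    (∃ t : Vec k₁ × 𝒢₁ → Fin k → ℝ, Measurable t ∧
      ∀ ω, vc X (π ω) = t (Y₁ (π ω), G₁ ω) + N ω) := by
  set K₁ := cc Q R.errX₁ R.errX₁ with hK₁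
  have hLx : IsLin fun ω => vc X (π ω) := (isLin_vc X).comp_continuousLinearMap π
  have hLy₁ : IsLin fun ω => vc Y₁ (π ω) := (isLin_vc Y₁).comp_continuousLinearMap π
  have hLr : IsLin fun ω => R.errX₁ (π ω) := R.isLin_errX₁.comp_continuousLinearMap π
  have hLu : IsLin (fun ω => mv H (vc X) (π ω) + n ω) := (hLx.mv H).add hn.isLin
  have hx := hLx.l2 hν
  have hy₁ := hLy₁.l2 hν
  have hr := hLr.l2 hν
  have hn2 := hn.isLin.l2 hν
  have hKa := mul_nonsing_inv Ka ((isUnit_iff_isUnit_det _).1 s.isUnit)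
  -- Precisions add: `Y₁` contributes K₁⁻¹ and the channel H X + n contributes Hᵀ H, with sum Ka⁻¹.
  -- The resulting linear estimate of X has error Ka (K₁⁻¹ (X - L₀ Y₁) - Hᵀ n).
  let N : F → Fin k → ℝ := mv (Ka * K₁⁻¹) (fun ω => R.errX₁ (π ω)) - mv (Ka * Hᵀ) n
  have hLN : IsLin N := (hLr.mv _).sub (hn.isLin.mv _)
  have hN := hLN.l2 hν
  have a1 := hr.mv (Ka * K₁⁻¹)
  have a2 := hn2.mv (Ka * Hᵀ)
  have hid : Ka * K₁⁻¹ + Ka * (Hᵀ * H) = 1 := by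
    rw [hH, ← Matrix.mul_add, add_sub_cancel, hKa]
  have hKs : K₁⁻¹ᵀ = K₁⁻¹ := by rw [transpose_nonsing_inv, hK₁, cc_transpose]
  have hMs : (Ka⁻¹ᵀ) = Ka⁻¹ := by
    have h1 : Ka⁻¹ = Hᵀ * H + K₁⁻¹ := by rw [hH]; abel
    rw [h1, transpose_add, hKs]
    simp [transpose_mul]
  have hKas : Kaᵀ = Ka := by
    have h1 : Ka⁻¹⁻¹ = Ka := nonsing_inv_nonsing_inv _ ((isUnit_iff_isUnit_det _).1 s.isUnit)
    rw [← h1, transpose_nonsing_inv, hMs]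
  have hrx : cc ν (fun ω => R.errX₁ (π ω)) (fun ω => vc X (π ω)) = K₁ := hO.cc_errX₁_X R
  have hry : cc ν (fun ω => R.errX₁ (π ω)) (fun ω => vc Y₁ (π ω)) = 0 := by
    rw [hO.cc_comp R.isLin_errX₁ (isLin_vc Y₁)]
    exact R.cc_L₀
  have hrr : cc ν (fun ω => R.errX₁ (π ω)) (fun ω => R.errX₁ (π ω)) = K₁ :=
    hO.cc_comp R.isLin_errX₁ R.isLin_errX₁
  have hnr := hn.cc_source _ _ R.isLin_errX₁
  have hrn : cc ν (fun ω => R.errX₁ (π ω)) n = 0 := by rw [← cc_transpose, hnr, transpose_zero]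
  have hKi := nonsing_inv_mul K₁ ((isUnit_iff_isUnit_det _).1 hK)
  have hKi' := mul_nonsing_inv K₁ ((isUnit_iff_isUnit_det _).1 hK)
  have e1 : cc ν N (fun ω => vc X (π ω)) = Ka := by
    rw [cc_sub_left a1 a2 hx, cc_mv_left hr hx, cc_mv_left hn2 hx, hrx,
      hn.cc_source _ _ (isLin_vc X), Matrix.mul_assoc, hKi]
    simp
  have e2 : cc ν N n = - (Ka * Hᵀ) := by
    rw [cc_sub_left a1 a2 hn2, cc_mv_left hr hn2, cc_mv_left hn2 hn2, hrn, hn.cc_self]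
    simp
  have e3 : cc ν N (fun ω => R.errX₁ (π ω)) = Ka := by
    rw [cc_sub_left a1 a2 hr, cc_mv_left hr hr, cc_mv_left hn2 hr, hrr, hnr, Matrix.mul_assoc, hKi]
    simp
  refine ⟨N, hLN, ?_, ?_, ?_, ?_⟩
  · have : cc ν N N = cc ν N (mv (Ka * K₁⁻¹) (fun ω => R.errX₁ (π ω)) - mv (Ka * Hᵀ) n) := rfl
    rw [this, cc_sub_right a1 a2 hN, cc_mv_right hr hN, cc_mv_right hn2 hN, e2, e3]
    calc Ka * (Ka * K₁⁻¹)ᵀ - -(Ka * Hᵀ) * (Ka * Hᵀ)ᵀ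
        = (Ka * K₁⁻¹ + Ka * (Hᵀ * H)) * Ka := by
          simp only [transpose_mul, transpose_transpose, hKs, hKas, Matrix.add_mul,
            Matrix.neg_mul, sub_neg_eq_add, Matrix.mul_assoc]
      _ = Ka := by rw [hid, Matrix.one_mul]
  · rw [cc_sub_left a1 a2 hy₁, cc_mv_left hr hy₁, cc_mv_left hn2 hy₁, hry,
      hn.cc_source _ _ (isLin_vc Y₁)]
    simp
  · have : (fun ω => mv H (vc X) (π ω) + n ω) = mv H (fun ω => vc X (π ω)) + n := rfl
    rw [this, cc_add_right (hx.mv H) hn2 hN, cc_mv_right hx hN, e1, e2, add_neg_cancel]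
  · obtain ⟨γ, δ, hγ, hδ, -, hδG⟩ := hG₁
    refine ⟨fun p => (Ka * K₁⁻¹) *ᵥ (R.L₀ *ᵥ p.1.ofLp) + (Ka * Hᵀ) *ᵥ (δ p.2), by fun_prop,
      fun ω => ?_⟩
    have h1 : vc X (π ω) = (Ka * K₁⁻¹ + Ka * (Hᵀ * H)) *ᵥ vc X (π ω) := by rw [hid, one_mulVec]
    simp only [← hδG, N, Pi.sub_apply, Regression.errX₁, mv, vc, mulVec_sub, mulVec_add,
      mulVec_mulVec, Matrix.mul_assoc] at h1 ⊢
    conv_lhs => rw [h1, add_mulVec]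
    abel

omit [CompleteSpace E] [SecondCountableTopology E] [CompleteSpace F] [SecondCountableTopology F]
  hK in
/-- The estimation error of the standardized innovation of `X` from both test channels. -/
lemma exists_err_second (hH' : H'ᵀ * H' = s.Pᵀ * ((diagonal fun i => (s.τ i : ℝ)⁻¹) - 1 -
      s.Sᵀ * (Ka⁻¹ - (cc Q R.errX₁ R.errX₁)⁻¹) * s.S) * s.P)
    (hG₂ : IsRecoding (fun ω => mv H' (vc X) (π ω) + n' ω) G₂) :
    ∃ N : F → s.r → ℝ, IsLin N ∧ cc ν N N = diagonal (fun i => (s.τ i : ℝ)) ∧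
    cc ν N (fun ω => vc Y (π ω)) = 0 ∧ cc ν N (fun ω => mv H (vc X) (π ω) + n ω) = 0 ∧
    cc ν N (fun ω => mv H' (vc X) (π ω) + n' ω) = 0 ∧
    (∃ t : Vec m × 𝒢₁ × 𝒢₂ → s.r → ℝ, Measurable t ∧
      ∀ ω, mv s.P R.errX (π ω) = t (Y (π ω), G₁ ω, G₂ ω) + N ω) := by
  set T : Matrix s.r s.r ℝ := diagonal (fun i => (s.τ i : ℝ)) with hT
  have hTt : Tᵀ = T := diagonal_transpose _
  have hLx : IsLin fun ω => vc X (π ω) := (isLin_vc X).comp_continuousLinearMap π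
  have hLy : IsLin fun ω => vc Y (π ω) := (isLin_vc Y).comp_continuousLinearMap π
  have hLr : IsLin fun ω => R.errX (π ω) := R.isLin_errX.comp_continuousLinearMap π
  have hx := hLx.l2 hν
  have hy := hLy.l2 hν
  have hr := hLr.l2 hν
  have hn2 := hn.isLin.l2 hν
  have hn2' := hn.isLin'.l2 hν
  -- With channel outputs u and v, the estimate of z = P (X - L Y) is T Sᵀ (Hᵀ (u - H L Y) + H'ᵀ (v
  -- - H' L Y)). `C` is the coefficient of X - L Y that remains in the error.
  obtain ⟨C, hC⟩ : ∃ C, C = s.P - T * s.Sᵀ * (Hᵀ * H + H'ᵀ * H') := ⟨_, rfl⟩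
  have hCS : C * s.S = T := by
    have h1 : T * (diagonal fun i => (s.τ i : ℝ)⁻¹) = 1 := by
      rw [hT, diagonal_mul_diagonal, ← diagonal_one]
      congr 1
      funext i
      exact mul_inv_cancel₀ (by simpa using s.τ_ne_zero i)
    have hSP : s.Sᵀ * s.Pᵀ = 1 := by rw [← transpose_mul, s.P_mul_S, transpose_one]
    -- In the coordinates z the two channels have total precision gain T⁻¹ - 1: `H'` fills the gap
    -- left by `H`, and P S = 1 removes `P`.
    have h2 : s.Sᵀ * (Hᵀ * H + H'ᵀ * H') * s.S = (diagonal fun i => (s.τ i : ℝ)⁻¹) - 1 := by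
      rw [hH', hH]
      set M := Ka⁻¹ - (cc Q R.errX₁ R.errX₁)⁻¹
      calc s.Sᵀ * (M + s.Pᵀ * ((diagonal fun i => (s.τ i : ℝ)⁻¹) - 1 - s.Sᵀ * M * s.S) * s.P) * s.S
          = s.Sᵀ * M * s.S + (s.Sᵀ * s.Pᵀ) *
            ((diagonal fun i => (s.τ i : ℝ)⁻¹) - 1 - s.Sᵀ * M * s.S) * (s.P * s.S) := by
            simp only [Matrix.mul_add, Matrix.add_mul, Matrix.mul_assoc]
        _ = _ := by rw [hSP, s.P_mul_S, Matrix.one_mul, Matrix.mul_one]; abel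
    calc C * s.S = s.P * s.S - T * (s.Sᵀ * (Hᵀ * H + H'ᵀ * H') * s.S) := by
          rw [hC, Matrix.sub_mul]; simp only [Matrix.mul_assoc]
      _ = T := by rw [h2, s.P_mul_S, Matrix.mul_sub, h1, Matrix.mul_one, sub_sub_cancel]
  let N : F → s.r → ℝ := mv C (fun ω => R.errX (π ω)) - mv (T * s.Sᵀ * Hᵀ) n -
    mv (T * s.Sᵀ * H'ᵀ) n'
  have hLN : IsLin N := ((hLr.mv _).sub (hn.isLin.mv _)).sub (hn.isLin'.mv _)
  have hN := hLN.l2 hν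
  have a1 := hr.mv C
  have a2 := hn2.mv (T * s.Sᵀ * Hᵀ)
  have a3 := hn2'.mv (T * s.Sᵀ * H'ᵀ)
  have hrr : cc ν (fun ω => R.errX (π ω)) (fun ω => R.errX (π ω)) = s.S * s.Sᵀ := by
    rw [hO.cc_comp R.isLin_errX R.isLin_errX, s.S_mul_S]
  have hry : cc ν (fun ω => R.errX (π ω)) (fun ω => vc Y (π ω)) = 0 := by
    rw [hO.cc_comp R.isLin_errX (isLin_vc Y)]
    exact R.cc_L
  have hnr := hn.cc_source _ _ R.isLin_errX
  have hnr' := hn.cc_source' _ _ R.isLin_errX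
  have hrn : cc ν (fun ω => R.errX (π ω)) n = 0 := by rw [← cc_transpose, hnr, transpose_zero]
  have hrn' : cc ν (fun ω => R.errX (π ω)) n' = 0 := by rw [← cc_transpose, hnr', transpose_zero]
  have hnn : cc ν n' n = 0 := by rw [← cc_transpose, hn.cc_cross, transpose_zero]
  have hsplit {κ : Type} {B : F → κ → ℝ} (hB : L2 ν B) : cc ν N B =
      C * cc ν (fun ω => R.errX (π ω)) B - T * s.Sᵀ * Hᵀ * cc ν n B -
        T * s.Sᵀ * H'ᵀ * cc ν n' B := by
    rw [cc_sub_left (a1.sub a2) a3 hB, cc_sub_left a1 a2 hB, cc_mv_left hr hB, cc_mv_left hn2 hB,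
      cc_mv_left hn2' hB]
  have e0 : cc ν N (fun ω => R.errX (π ω)) = T * s.Sᵀ := by
    rw [hsplit hr, hrr, hnr, hnr', ← Matrix.mul_assoc, hCS]
    simp
  have e1 : cc ν N (fun ω => vc Y (π ω)) = 0 := by
    rw [hsplit hy, hry, hn.cc_source _ _ (isLin_vc Y), hn.cc_source' _ _ (isLin_vc Y)]
    simp
  have e2 : cc ν N n = - (T * s.Sᵀ * Hᵀ) := by
    rw [hsplit hn2, hrn, hnn, hn.cc_self]
    simp
  have e3 : cc ν N n' = - (T * s.Sᵀ * H'ᵀ) := by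
    rw [hsplit hn2', hrn', hn.cc_cross, hn.cc_self']
    simp
  have e4 : cc ν N (fun ω => vc X (π ω)) = T * s.Sᵀ := by
    have : (fun ω => vc X (π ω)) =
        (fun ω => R.errX (π ω)) + mv R.L (fun ω => vc Y (π ω)) := by
      funext ω
      simp only [Pi.add_apply, Regression.errX, Pi.sub_apply, mv]
      abel
    rw [this, cc_add_right hr (hy.mv _) hN, cc_mv_right hy hN, e0, e1]
    simp
  refine ⟨N, hLN, ?_, e1, ?_, ?_, ?_⟩
  · have : cc ν N N = cc ν N (mv C (fun ω => R.errX (π ω)) - mv (T * s.Sᵀ * Hᵀ) n -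
      mv (T * s.Sᵀ * H'ᵀ) n') := rfl
    rw [this, cc_sub_right (a1.sub a2) a3 hN, cc_sub_right a1 a2 hN, cc_mv_right hr hN,
      cc_mv_right hn2 hN, cc_mv_right hn2' hN, e0, e2, e3]
    have h1 : Cᵀ = s.Pᵀ - (Hᵀ * H + H'ᵀ * H') * s.S * T := by
      rw [hC]
      simp only [transpose_sub, transpose_mul, transpose_add, transpose_transpose, hTt,
        Matrix.mul_assoc]
    have hSP : s.Sᵀ * s.Pᵀ = 1 := by rw [← transpose_mul, s.P_mul_S, transpose_one]
    calc T * s.Sᵀ * Cᵀ - -(T * s.Sᵀ * Hᵀ) * (T * s.Sᵀ * Hᵀ)ᵀ -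
          -(T * s.Sᵀ * H'ᵀ) * (T * s.Sᵀ * H'ᵀ)ᵀ = T * (s.Sᵀ * s.Pᵀ) := by
          rw [h1]
          simp only [transpose_mul, transpose_transpose, hTt, Matrix.mul_sub, Matrix.add_mul,
            Matrix.mul_add, Matrix.neg_mul, sub_neg_eq_add, Matrix.mul_assoc]
          abel
      _ = T := by rw [hSP, Matrix.mul_one]
  · have : (fun ω => mv H (vc X) (π ω) + n ω) = mv H (fun ω => vc X (π ω)) + n := rfl
    rw [this, cc_add_right (hx.mv H) hn2 hN, cc_mv_right hx hN, e4, e2, add_neg_cancel]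
  · have : (fun ω => mv H' (vc X) (π ω) + n' ω) = mv H' (fun ω => vc X (π ω)) + n' := rfl
    rw [this, cc_add_right (hx.mv H') hn2' hN, cc_mv_right hx hN, e4, e3, add_neg_cancel]
  · obtain ⟨γ, δ, hγ, hδ, -, hδG⟩ := hG₁
    obtain ⟨γ', δ', hγ', hδ', -, hδG'⟩ := hG₂
    refine ⟨fun p => (T * s.Sᵀ * Hᵀ) *ᵥ (δ p.2.1 - H *ᵥ (R.L *ᵥ p.1.ofLp)) +
      (T * s.Sᵀ * H'ᵀ) *ᵥ (δ' p.2.2 - H' *ᵥ (R.L *ᵥ p.1.ofLp)), by fun_prop, fun ω => ?_⟩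
    have h1 : ∀ v, s.P *ᵥ v = C *ᵥ v + (T * s.Sᵀ * (Hᵀ * H + H'ᵀ * H')) *ᵥ v := fun v => by
      rw [← add_mulVec, hC, sub_add_cancel]
    simp only [← hδG, ← hδG', N, Pi.sub_apply, Regression.errX, mv, vc, h1]
    simp only [mulVec_sub, mulVec_add, add_mulVec, Matrix.mul_add, Matrix.add_mul,
      mulVec_mulVec, Matrix.mul_assoc]
    abel

/-- The Gaussian test channels attain the specified errors and rate. -/
theorem rate_eq_rateSpec (hH' : H'ᵀ * H' = s.Pᵀ * ((diagonal fun i => (s.τ i : ℝ)⁻¹) - 1 -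
      s.Sᵀ * (Ka⁻¹ - (cc Q R.errX₁ R.errX₁)⁻¹) * s.S) * s.P)
    (hG₂ : IsRecoding (fun ω => mv H' (vc X) (π ω) + n' ω) G₂) :
    (∃ ρ, IsErr ν (fun ω => (Y₁ (π ω), G₁ ω)) (fun ω => vc X (π ω)) ρ ∧ cc ν ρ ρ = Ka) ∧
    (∃ ρ, IsErr ν (fun ω => (Y (π ω), (G₁ ω, G₂ ω))) (fun ω => vc X (π ω)) ρ ∧ cc ν ρ ρ = Kb) ∧
    condMutualInfo ν (fun ω => X (π ω)) G₁ (fun ω => Y₁ (π ω)) +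
      condMutualInfo ν (fun ω => X (π ω)) G₂ (fun ω => (Y (π ω), G₁ ω)) = s.rate := by
  have hLx : IsLin fun ω => vc X (π ω) := (isLin_vc X).comp_continuousLinearMap π
  have hLy : IsLin fun ω => vc Y (π ω) := (isLin_vc Y).comp_continuousLinearMap π
  have hLy₁ : IsLin fun ω => vc Y₁ (π ω) := (isLin_vc Y₁).comp_continuousLinearMap π
  have hLN : IsLin fun ω => R.noise (π ω) := R.isLin_noise.comp_continuousLinearMap π
  have hLu : IsLin fun ω => mv H (vc X) (π ω) + n ω := (hLx.mv H).add hn.isLin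
  have hLv : IsLin fun ω => mv H' (vc X) (π ω) + n' ω := (hLx.mv H').add hn.isLin'
  have hrX := R.isLin_errX.l2 hO.gaussian
  have hGm := hO.measurable_G₁.prodMk hO.measurable_G₂
  obtain ⟨N₀, hN₀, hN₀₀, hN₀y, hN₀u, t₀, ht₀, hx₀⟩ :=
    hO.exists_err_first hν hK s hn hH hG₁
  obtain ⟨N, hN, hNN, hNy, hNu, hNv, t, ht, hz⟩ :=
    hO.exists_err_second hν s hn hH hG₁ hH' hG₂
  obtain ⟨γ, δ, hγ, hδ, hγG, hδG⟩ := hG₁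
  obtain ⟨γ', δ', hγ', hδ', hγG', hδG'⟩ := hG₂
  -- Joint Gaussianity turns zero correlation with `Y₁` and with the channel output into
  -- independence, which `γ` carries over to `G₁`.
  have hind₁ {σ : Type} [Finite σ] {A : F → σ → ℝ} (hA : IsLin A)
      (h1 : cc ν A (fun ω => vc Y₁ (π ω)) = 0)
      (h2 : cc ν A (fun ω => mv H (vc X) (π ω) + n ω) = 0) :
      IndepFun (fun ω => (Y₁ (π ω), G₁ ω)) A ν := by
    have := (hLy₁.indepFun_prodMk hν hLu hA h1 h2).comp
      (φ := fun p => (WithLp.toLp 2 p.1, γ p.2)) (ψ := id) (by fun_prop) measurable_id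
    simp only [Function.comp_def, ← hγG] at this
    exact this
  have hind₂ : IndepFun (fun ω => (Y (π ω), (G₁ ω, G₂ ω))) N ν := by
    have := (hLy.indepFun_prodMk hν (hLu.joinV hLv) hN hNy
      (cc_joinV_right_eq_zero hNu hNv)).comp
      (φ := fun p => (WithLp.toLp 2 p.1, (γ fun i => p.2 (.inl i), γ' fun i => p.2 (.inr i))))
      (ψ := id) (by fun_prop) measurable_id
    simp only [Function.comp_def, joinV, Sum.elim_inl, Sum.elim_inr, ← hγG, ← hγG'] at this
    exact this
  have hE₀ : IsErr ν (fun ω => (Y₁ (π ω), G₁ ω)) (fun ω => vc X (π ω)) N₀ :=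
    isErr_of_indepFun (hO.measurable_Y₁.prodMk hO.measurable_G₁) (fun i => (hN₀.l2 hν i).1)
      (hN₀.l2 hν) (hN₀.integral_eq_zero hν) (hind₁ hN₀ hN₀y hN₀u) ht₀
      (Filter.Eventually.of_forall hx₀)
  have hE : IsErr ν (fun ω => (Y (π ω), (G₁ ω, G₂ ω))) (fun ω => mv s.P R.errX (π ω)) N :=
    isErr_of_indepFun (hO.measurable_Y.prodMk hGm) (fun i => (hN.l2 hν i).1)
      (hN.l2 hν) (hN.integral_eq_zero hν) hind₂ ht (Filter.Eventually.of_forall hz)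
  refine ⟨⟨N₀, hE₀, hN₀₀⟩, ⟨mv s.S N, ?_, ?_⟩, ?_⟩
  · have hrz : mv s.S (fun ω => mv s.P R.errX (π ω)) =ᵐ[ν] fun ω => R.errX (π ω) :=
      (hO.ae_comp (ae_eq_mv_of_factorization hrX s.P_mul_S s.S_mul_S)).mono fun _ h => h.symm
    have h1 := ((hE.mv s.S).congr hrz).add_comp (s := fun p => R.L *ᵥ p.1.ofLp) (by fun_prop)
    refine h1.congr (Filter.Eventually.of_forall fun ω => ?_)
    simp only [Pi.add_apply, Regression.errX, Pi.sub_apply, mv, vc]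
    abel
  · rw [cc_mv_left hE.1 (hE.1.mv _), cc_mv_right hE.1 hE.1, hNN, ← Matrix.mul_assoc]
    exact s.S_mul_τ
  -- In both terms of the decomposed rate the error is Gaussian and independent of the observation,
  -- so `klDiv_eq_of_gaussian_error` yields the two sums defining `RateSpec.rate`.
  · rw [hO.rate_eq R]
    obtain ⟨hlaw, hI⟩ := condMutualInfo_eq_klDiv_innovation hO.gaussian hO.measurable_π hO.map_π
      hGm R.cc_L s.P_mul_S s.S_mul_S
    obtain ⟨hlaw₁, hI₁⟩ := condMutualInfo_eq_klDiv_innovation hO.gaussian hO.measurable_π hO.map_π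
      hO.measurable_G₁ R.cc_L₁ s.P₁_mul_S₁ s.S₁_mul_S₁
    obtain ⟨hE₁, hcc₁⟩ := hO.isErr_innovation_Y R hE₀ s.P₁
    rw [hN₀₀, s.τ₁_eq] at hcc₁
    have hS : IsLin (mv R.A N₀ + fun ω => R.noise (π ω)) := (hN₀.mv R.A).add hLN
    have hN₁ : IsLin (mv s.P₁ (mv R.A N₀ + fun ω => R.noise (π ω))) := hS.mv s.P₁
    have hzero {B : F → Fin k → ℝ} (hB : IsLin B) (h1 : cc ν N₀ B = 0)
        (h2 : cc ν (fun ω => R.noise (π ω)) B = 0) :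
        cc ν (mv s.P₁ (mv R.A N₀ + fun ω => R.noise (π ω))) B = 0 := by
      rw [cc_mv_left (hS.l2 hν) (hB.l2 hν), cc_add_left ((hN₀.mv R.A).l2 hν) (hLN.l2 hν)
        (hB.l2 hν), cc_mv_left (hN₀.l2 hν) (hB.l2 hν), h1, h2]
      simp
    have hNu : cc ν (fun ω => R.noise (π ω)) (fun ω => mv H (vc X) (π ω) + n ω) = 0 := by
      have : (fun ω => mv H (vc X) (π ω) + n ω) = mv H (fun ω => vc X (π ω)) + n := rfl
      rw [this, cc_add_right ((hLx.mv H).l2 hν) (hn.isLin.l2 hν) (hLN.l2 hν),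
        cc_mv_right (hLx.l2 hν) (hLN.l2 hν), hO.cc_comp R.isLin_noise (isLin_vc X),
        show cc Q R.noise (vc X) = 0 from R.cc_noise_X, ← cc_transpose (A := n),
        hn.cc_source _ _ R.isLin_noise]
      simp
    have hNy₁ : cc ν (mv s.P₁ (mv R.A N₀ + fun ω => R.noise (π ω))) (fun ω => vc Y₁ (π ω)) = 0 := by
      rw [cc_mv_left (hS.l2 hν) (hLy₁.l2 hν), cc_add_left ((hN₀.mv R.A).l2 hν) (hLN.l2 hν)
        (hLy₁.l2 hν), cc_mv_left (hN₀.l2 hν) (hLy₁.l2 hν), hN₀y,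
        hO.cc_comp R.isLin_noise (isLin_vc Y₁), show cc Q R.noise (vc Y₁) = 0 from R.cc_noise_Y₁]
      simp
    rw [hI, hI₁, RateSpec.rate]
    congr 1
    · refine klDiv_eq_of_gaussian_error (hO.measurable_Y₁.prodMk hO.measurable_G₁)
        ((R.isLin_errY.mv s.P₁).measurable.comp hO.measurable_π) hlaw₁
        (t := fun p => s.P₁ *ᵥ (R.A *ᵥ t₀ p + R.B *ᵥ p.1.ofLp - R.L₁ *ᵥ p.1.ofLp)) (by fun_prop)
        s.τ₁_ne_zero hN₁.measurable (fun ω => ?_) (hind₁ hN₁ hNy₁ (hzero hLu hN₀u hNu))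
        (hN₁.map_eq_pi hν hcc₁)
      have h1 := hx₀ ω
      simp only [Function.comp_apply, Regression.errY, mv, Pi.add_apply, Regression.noise,
        Pi.sub_apply, vc] at h1 ⊢
      rw [h1, ← mulVec_add]
      congr 1
      simp only [mulVec_add]
      abel
    · exact klDiv_eq_of_gaussian_error (hO.measurable_Y.prodMk hGm)
        ((R.isLin_errX.mv s.P).measurable.comp hO.measurable_π) hlaw ht s.τ_ne_zero hN.measurable
        hz hind₂ (hN.map_eq_pi hν hNN)

end Observation
end Achievability

/-! ### Products and linear images of centered Gaussian laws. -/

section Centered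

variable {E F : Type*} [NormedAddCommGroup E] [NormedSpace ℝ E] [MeasurableSpace E] [BorelSpace E]
  [CompleteSpace E] [SecondCountableTopology E] [NormedAddCommGroup F] [NormedSpace ℝ F]
  [MeasurableSpace F] [BorelSpace F] [CompleteSpace F] [SecondCountableTopology F]
  {μ : Measure E} {ν : Measure F}

lemma IsCenteredGaussian.prod (hμ : IsCenteredGaussian μ) (hν : IsCenteredGaussian ν) :
    IsCenteredGaussian (μ.prod ν) := by
  have := hμ.1
  have := hν.1
  have h1 : IsGaussian (μ.prod ν) := inferInstance
  refine ⟨h1, ?_⟩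
  have hi : Integrable (fun p : E × F => p) (μ.prod ν) := IsGaussian.integrable_fun_id
  refine Prod.ext ?_ ?_
  · rw [fst_integral hi, integral_fun_fst (f := fun x : E => x), hμ.2]
    simp
  · rw [snd_integral hi, integral_fun_snd (f := fun x : F => x), hν.2]
    simp

lemma IsCenteredGaussian.map (hμ : IsCenteredGaussian μ) (L : E →L[ℝ] F) :
    IsCenteredGaussian (μ.map L) := by
  have := hμ.1
  refine ⟨inferInstance, ?_⟩
  rw [integral_map (by fun_prop) (by fun_prop),
    L.integral_comp_comm (φ := fun ω => ω) IsGaussian.integrable_fun_id, hμ.2, map_zero]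

lemma isCenteredGaussian_stdGaussian (k : ℕ) : IsCenteredGaussian (stdGaussian (Vec k)) :=
  ⟨inferInstance, integral_id_stdGaussian⟩

lemma cc_stdGaussian (k : ℕ) : cc (stdGaussian (Vec k)) (vc fun x => x) (vc fun x => x) = 1 := by
  have hL : IsLin (vc fun x : Vec k => x) := isLin_vc (ContinuousLinearMap.id ℝ (Vec k))
  ext i j
  rw [← hL.covariance_eq (isCenteredGaussian_stdGaussian k) hL, ← multivariateGaussian_zero_one]
  exact covariance_eval_multivariateGaussian Matrix.PosSemidef.one i j

end Centered

/-! ### Conditional mutual information and Markov chains under maps. -/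

section Channel

variable {Ω Ω' : Type*} {mΩ : MeasurableSpace Ω} {mΩ' : MeasurableSpace Ω'}
  {α β γ : Type*} [MeasurableSpace α] [MeasurableSpace β] [MeasurableSpace γ]
  [StandardBorelSpace α] [Nonempty α] [StandardBorelSpace β] [Nonempty β]

lemma condMutualInfo_map {ν : Measure Ω} [IsProbabilityMeasure ν] {Q : Measure Ω'}
    [IsProbabilityMeasure Q] {π : Ω → Ω'} (hπ : Measurable π) (hQ : ν.map π = Q) {A : Ω' → α}
    {B : Ω' → β} {C : Ω' → γ} (hA : Measurable A) (hB : Measurable B) (hC : Measurable C) :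
    condMutualInfo ν (fun ω => A (π ω)) (fun ω => B (π ω)) (fun ω => C (π ω)) =
      condMutualInfo Q A B C := by
  subst hQ
  have h1 : (ν.map π).map C = ν.map fun ω => C (π ω) := Measure.map_map hC hπ
  have h2 : ((ν.map π).map fun ω => (C ω, A ω)) = ν.map fun ω => (C (π ω), A (π ω)) :=
    Measure.map_map (hC.prodMk hA) hπ
  have h3 : ((ν.map π).map fun ω => (C ω, B ω)) = ν.map fun ω => (C (π ω), B (π ω)) :=
    Measure.map_map (hC.prodMk hB) hπ
  have h4 : ((ν.map π).map fun ω => (C ω, A ω, B ω)) =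
      ν.map fun ω => (C (π ω), A (π ω), B (π ω)) :=
    Measure.map_map (hC.prodMk (hA.prodMk hB)) hπ
  simp only [condMutualInfo, condDistrib, h1, h2, h3, h4]

lemma IsMarkovChain.comp [StandardBorelSpace Ω] {α β γ α' γ' : Type*} [MeasurableSpace α]
    [MeasurableSpace β] [MeasurableSpace γ] [MeasurableSpace α'] [MeasurableSpace γ']
    {μ : Measure Ω} [IsFiniteMeasure μ]
    {A : Ω → α} {B : Ω → β} {C : Ω → γ} (h : IsMarkovChain μ A B C) {φ : α → α'} {ψ : γ → γ'}
    (hφ : Measurable φ) (hψ : Measurable ψ) :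
    IsMarkovChain μ (fun ω => φ (A ω)) B (fun ω => ψ (C ω)) :=
  ⟨h.1, h.2.comp hφ hψ⟩

end Channel

/-! ### The coordinates (X, Y₁, Y₂, Y, W, U, V) as an instance of the abstract setting. -/

section Concrete

open Matrix ContinuousLinearMap

variable {k k₁ k₂ m a b c : ℕ}

/-- The vector `X` as a continuous linear map. -/
def srcX : EnhSpace k k₁ k₂ m →L[ℝ] Vec k := (fst ℝ _ _).comp (fst ℝ _ _)

/-- The vector `Y₁` as a continuous linear map. -/
def srcY₁ : EnhSpace k k₁ k₂ m →L[ℝ] Vec k₁ := (fst ℝ _ _).comp ((snd ℝ _ _).comp (fst ℝ _ _))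

/-- The vector `Y₂` as a continuous linear map. -/
def srcY₂ : EnhSpace k k₁ k₂ m →L[ℝ] Vec k₂ := (snd ℝ _ _).comp ((snd ℝ _ _).comp (fst ℝ _ _))

/-- The vector `Y` as a continuous linear map. -/
def srcY : EnhSpace k k₁ k₂ m →L[ℝ] Vec m := snd ℝ _ _

variable {P : ProbabilityMeasure (SourceSpace k k₁ k₂)}
  {Q : ProbabilityMeasure (EnhSpace k k₁ k₂ m)}
  {ν : ProbabilityMeasure (FullSpace k k₁ k₂ m a b c)}

@[fun_prop] lemma measurable_cX : Measurable (cX : FullSpace k k₁ k₂ m a b c → _) := by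
  unfold cX; fun_prop
@[fun_prop] lemma measurable_cY : Measurable (cY : FullSpace k k₁ k₂ m a b c → _) := by
  unfold cY; fun_prop
@[fun_prop] lemma measurable_cY₁ : Measurable (cY₁ : FullSpace k k₁ k₂ m a b c → _) := by
  unfold cY₁; fun_prop
@[fun_prop] lemma measurable_cY₂ : Measurable (cY₂ : FullSpace k k₁ k₂ m a b c → _) := by
  unfold cY₂; fun_prop
@[fun_prop] lemma measurable_cW : Measurable (cW : FullSpace k k₁ k₂ m a b c → _) := by
  unfold cW; fun_prop
@[fun_prop] lemma measurable_cU : Measurable (cU : FullSpace k k₁ k₂ m a b c → _) := by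
  unfold cU; fun_prop
@[fun_prop] lemma measurable_cV : Measurable (cV : FullSpace k k₁ k₂ m a b c → _) := by
  unfold cV; fun_prop

/-- The roles in the first problem: side information `Y₁`, first observation (W, U), second
observation V. -/
lemma IsAuxiliary.observation₁ (hQ : Q ∈ SG P m) (hν : IsAuxiliary Q ν) :
    Observation (Q : Measure (EnhSpace k k₁ k₂ m)) srcX srcY srcY₁
      (ν : Measure (FullSpace k k₁ k₂ m a b c)) Prod.fst (fun ω => (cW ω, cU ω)) cV where
  gaussian := hQ.2.1
  measurable_π := measurable_fst
  map_π := hν.1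
  measurable_G₁ := by fun_prop
  measurable_G₂ := by fun_prop
  markov_Y := by
    rw [condMutualInfo_map measurable_fst hν.1 srcX.measurable srcY₁.measurable srcY.measurable]
    exact (isMarkovChain_iff_condMutualInfo_eq_zero srcX.measurable srcY₁.measurable
      srcY.measurable).1 (hQ.2.2.comp (φ := id) measurable_id measurable_fst)
  markov_X := (isMarkovChain_iff_condMutualInfo_eq_zero (by fun_prop) (by fun_prop)
      measurable_cX).1 (hν.2.comp (φ := fun p => ((p.1, p.2.1), p.2.2))
        (ψ := fun p => (p.1, p.2.2)) (by fun_prop) (by fun_prop))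

/-- The mirror image: `U` and `V` are exchanged and `Y₂` takes the place of `Y₁`. -/
lemma IsAuxiliary.observation₂ (hQ : Q ∈ SG P m) (hν : IsAuxiliary Q ν) :
    Observation (Q : Measure (EnhSpace k k₁ k₂ m)) srcX srcY srcY₂
      (ν : Measure (FullSpace k k₁ k₂ m a b c)) Prod.fst (fun ω => (cW ω, cV ω)) cU where
  gaussian := hQ.2.1
  measurable_π := measurable_fst
  map_π := hν.1
  measurable_G₁ := by fun_prop
  measurable_G₂ := by fun_prop
  markov_Y := by
    rw [condMutualInfo_map measurable_fst hν.1 srcX.measurable srcY₂.measurable srcY.measurable]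
    exact (isMarkovChain_iff_condMutualInfo_eq_zero srcX.measurable srcY₂.measurable
      srcY.measurable).1 (hQ.2.2.comp (φ := id) measurable_id measurable_snd)
  markov_X := (isMarkovChain_iff_condMutualInfo_eq_zero (by fun_prop) (by fun_prop)
      measurable_cX).1 (hν.2.comp (φ := fun p => ((p.1, p.2.2), p.2.1))
        (ψ := fun p => (p.2.1, p.2.2)) (by fun_prop) (by fun_prop))

/-- Moves `Y` to the front of the condition, the order used in `Observation.rate_eq`. -/
lemma Rlo1_eq : Rlo1 ν =
    condMutualInfo (ν : Measure (FullSpace k k₁ k₂ m a b c)) (fun ω => srcX ω.1)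
      (fun ω => (cW ω, cU ω)) (fun ω => srcY₁ ω.1) +
    condMutualInfo (ν : Measure (FullSpace k k₁ k₂ m a b c)) (fun ω => srcX ω.1) cV
      (fun ω => (srcY ω.1, (cW ω, cU ω))) := by
  rw [Rlo1]
  congr 1
  exact condMutualInfo_equiv_cond (ν : Measure (FullSpace k k₁ k₂ m a b c)) measurable_cX
    measurable_cV (C := fun ω => (cY ω, (cW ω, cU ω))) (by fun_prop)
    (MeasurableEquiv.prodComm.trans MeasurableEquiv.prodAssoc)

lemma Rlo2_eq : Rlo2 ν =
    condMutualInfo (ν : Measure (FullSpace k k₁ k₂ m a b c)) (fun ω => srcX ω.1)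
      (fun ω => (cW ω, cV ω)) (fun ω => srcY₂ ω.1) +
    condMutualInfo (ν : Measure (FullSpace k k₁ k₂ m a b c)) (fun ω => srcX ω.1) cU
      (fun ω => (srcY ω.1, (cW ω, cV ω))) := by
  rw [Rlo2]
  congr 1
  exact condMutualInfo_equiv_cond (ν : Measure (FullSpace k k₁ k₂ m a b c)) measurable_cX
    measurable_cU (C := fun ω => (cY ω, (cW ω, cV ω))) (by fun_prop)
    (MeasurableEquiv.prodComm.trans MeasurableEquiv.prodAssoc)

section Covariances

variable {ρ : FullSpace k k₁ k₂ m a b c → Fin k → ℝ}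

lemma covWUY₁_eq (hX : L2 ν.1 (vc cX))
    (h : IsErr ν.1 (fun ω => (srcY₁ ω.1, (cW ω, cU ω))) (fun ω => vc srcX ω.1) ρ) :
    covWUY₁ ν = cc ν.1 ρ ρ :=
  have h' := h.of_leftInverse (e := fun p : Vec k₁ × Vec a × Vec b => (p.2.1, p.2.2, p.1))
    (e' := fun p => (p.2.2, (p.1, p.2.1))) (by fun_prop) (by fun_prop) fun _ => rfl
  condCov_eq (by fun_prop) hX h'

lemma covWVY₂_eq (hX : L2 ν.1 (vc cX))
    (h : IsErr ν.1 (fun ω => (srcY₂ ω.1, (cW ω, cV ω))) (fun ω => vc srcX ω.1) ρ) :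
    covWVY₂ ν = cc ν.1 ρ ρ :=
  have h' := h.of_leftInverse (e := fun p : Vec k₂ × Vec a × Vec c => (p.2.1, p.2.2, p.1))
    (e' := fun p => (p.2.2, (p.1, p.2.1))) (by fun_prop) (by fun_prop) fun _ => rfl
  condCov_eq (by fun_prop) hX h'

lemma covWUVY_eq (hX : L2 ν.1 (vc cX))
    (h : IsErr ν.1 (fun ω => (srcY ω.1, ((cW ω, cU ω), cV ω))) (fun ω => vc srcX ω.1) ρ) :
    covWUVY ν = cc ν.1 ρ ρ :=
  have h' := h.of_leftInverse
    (e := fun p : Vec m × (Vec a × Vec b) × Vec c => (p.2.1.1, p.2.1.2, p.2.2, p.1))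
    (e' := fun p => (p.2.2.2, ((p.1, p.2.1), p.2.2.1))) (by fun_prop) (by fun_prop) fun _ => rfl
  condCov_eq (by fun_prop) hX h'

lemma covWUVY_eq' (hX : L2 ν.1 (vc cX))
    (h : IsErr ν.1 (fun ω => (srcY ω.1, ((cW ω, cV ω), cU ω))) (fun ω => vc srcX ω.1) ρ) :
    covWUVY ν = cc ν.1 ρ ρ :=
  have h' := h.of_leftInverse
    (e := fun p : Vec m × (Vec a × Vec c) × Vec b => (p.2.1.1, p.2.2, p.2.1.2, p.1))
    (e' := fun p => (p.2.2.2, ((p.1, p.2.2.1), p.2.1))) (by fun_prop) (by fun_prop) fun _ => rfl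
  condCov_eq (by fun_prop) hX h'

end Covariances

/-- `K_{X|Z}` of a linear function `Z` of a Gaussian sample, by regression. -/
lemma condCov_eq_regression {E : Type*} [NormedAddCommGroup E] [NormedSpace ℝ E]
    [MeasurableSpace E] [BorelSpace E] [CompleteSpace E] [SecondCountableTopology E]
    {p : Measure E} [IsProbabilityMeasure p] (hp : IsCenteredGaussian p) (X : E →L[ℝ] Vec k)
    (Z : E →L[ℝ] Vec m) {L : Matrix (Fin k) (Fin m) ℝ}
    (hL : cc p (vc X - mv L (vc Z)) (vc Z) = 0) :
    condCov p X Z = cc p (vc X - mv L (vc Z)) (vc X - mv L (vc Z)) := by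
  have hr := (isLin_vc X).sub ((isLin_vc Z).mv L)
  refine condCov_eq Z.measurable ((isLin_vc X).l2 hp)
    (isErr_of_indepFun Z.measurable (fun i => (hr.l2 hp i).1) (hr.l2 hp) (hr.integral_eq_zero hp)
    ?_ (t := fun z => L *ᵥ z.ofLp) (by fun_prop) (Filter.Eventually.of_forall fun ω => ?_))
  · exact (hr.indepFun hp (isLin_vc Z) hL).symm.comp (φ := WithLp.toLp 2) (ψ := id) (by fun_prop)
      measurable_id
  · simp [mv, vc]

end Concrete

/-! ### Joint law of the Gaussian test channels. -/

section TestChannel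

open Matrix ContinuousLinearMap

variable {k k₁ k₂ m : ℕ}

/-- The linear map sending `((X, Y₁, Y₂), Y)` and the noises `(n, n')` to the sample
`(((X, Y₁, Y₂), Y), (0, Hu X + n, Hv X + n'))`. -/
def testMap (Hu Hv : Matrix (Fin k) (Fin k) ℝ) :
    EnhSpace k k₁ k₂ m × (Vec k × Vec k) →L[ℝ] FullSpace k k₁ k₂ m 0 k k :=
  let p : EnhSpace k k₁ k₂ m × (Vec k × Vec k) →L[ℝ] EnhSpace k k₁ k₂ m := fst ℝ _ _
  let q : EnhSpace k k₁ k₂ m × (Vec k × Vec k) →L[ℝ] Vec k × Vec k := snd ℝ _ _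
  let u : EnhSpace k k₁ k₂ m × (Vec k × Vec k) →L[ℝ] Vec k :=
    (toEuclideanCLM (𝕜 := ℝ) Hu).comp (srcX.comp p) + (fst ℝ (Vec k) (Vec k)).comp q
  let v : EnhSpace k k₁ k₂ m × (Vec k × Vec k) →L[ℝ] Vec k :=
    (toEuclideanCLM (𝕜 := ℝ) Hv).comp (srcX.comp p) + (snd ℝ (Vec k) (Vec k)).comp q
  -- `W` occurs in the rates and constraints only alongside `U` or `V`, so dimension 0 suffices for
  -- it.
  p.prod ((0 : _ →L[ℝ] Vec 0).prod (u.prod v))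

/-- The noises, as functions of the sample. -/
def testNoise (Hu Hv : Matrix (Fin k) (Fin k) ℝ) :
    FullSpace k k₁ k₂ m 0 k k →L[ℝ] Vec k × Vec k :=
  let p : FullSpace k k₁ k₂ m 0 k k →L[ℝ] EnhSpace k k₁ k₂ m := fst ℝ _ _
  let q : FullSpace k k₁ k₂ m 0 k k →L[ℝ] Vec k × Vec k := (snd ℝ (Vec 0) _).comp (snd ℝ _ _)
  q - ContinuousLinearMap.prod ((toEuclideanCLM (𝕜 := ℝ) Hu).comp (srcX.comp p))
    ((toEuclideanCLM (𝕜 := ℝ) Hv).comp (srcX.comp p))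

lemma testNoise_testMap (Hu Hv : Matrix (Fin k) (Fin k) ℝ)
    (p : EnhSpace k k₁ k₂ m × (Vec k × Vec k)) : testNoise Hu Hv (testMap Hu Hv p) = p.2 := by
  simp [testNoise, testMap]

lemma cU_eq (Hu Hv : Matrix (Fin k) (Fin k) ℝ) (ω : FullSpace k k₁ k₂ m 0 k k) :
    vc cU ω = mv Hu (vc srcX) ω.1 + vc (fun ω => (testNoise Hu Hv ω).1) ω := by
  simp [testNoise, vc, mv, cU]

lemma cV_eq (Hu Hv : Matrix (Fin k) (Fin k) ℝ) (ω : FullSpace k k₁ k₂ m 0 k k) :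
    vc cV ω = mv Hv (vc srcX) ω.1 + vc (fun ω => (testNoise Hu Hv ω).2) ω := by
  simp [testNoise, vc, mv, cV]

/-- The joint law of the sample under Gaussian test channels. -/
def testLaw (Q : ProbabilityMeasure (EnhSpace k k₁ k₂ m)) (Hu Hv : Matrix (Fin k) (Fin k) ℝ) :
    ProbabilityMeasure (FullSpace k k₁ k₂ m 0 k k) :=
  ⟨((Q : Measure (EnhSpace k k₁ k₂ m)).prod
      ((stdGaussian (Vec k)).prod (stdGaussian (Vec k)))).map (testMap Hu Hv),
    Measure.isProbabilityMeasure_map (testMap Hu Hv).measurable.aemeasurable⟩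

variable (Q : ProbabilityMeasure (EnhSpace k k₁ k₂ m)) (Hu Hv : Matrix (Fin k) (Fin k) ℝ)

/-- `testNoise` undoes `testMap`, so source and noises recover their original product law. Their
marginals and independence are read off from it. -/
lemma testLaw_map_prodMk :
    (testLaw Q Hu Hv).1.map (fun ω => (ω.1, testNoise Hu Hv ω)) =
      (Q : Measure (EnhSpace k k₁ k₂ m)).prod
        ((stdGaussian (Vec k)).prod (stdGaussian (Vec k))) := by
  change Measure.map _ (Measure.map _ _) = _
  rw [Measure.map_map (by fun_prop) (by fun_prop)]
  convert Measure.map_id using 2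
  funext p
  exact Prod.ext rfl (testNoise_testMap Hu Hv p)

lemma testLaw_map_fst :
    (testLaw Q Hu Hv).1.map Prod.fst = (Q : Measure (EnhSpace k k₁ k₂ m)) := by
  have h := congrArg (Measure.map Prod.fst) (testLaw_map_prodMk Q Hu Hv)
  rwa [Measure.map_map (by fun_prop) (by fun_prop), Measure.map_fst_prod, measure_univ,
    one_smul] at h

lemma testLaw_map_testNoise : (testLaw Q Hu Hv).1.map (testNoise Hu Hv) =
    (stdGaussian (Vec k)).prod (stdGaussian (Vec k)) := by
  have h := congrArg (Measure.map Prod.snd) (testLaw_map_prodMk Q Hu Hv)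
  rwa [Measure.map_map (by fun_prop) (by fun_prop), Measure.map_snd_prod, measure_univ,
    one_smul] at h

lemma indepFun_testNoise : IndepFun (Prod.fst : FullSpace k k₁ k₂ m 0 k k → _)
    (testNoise Hu Hv) (testLaw Q Hu Hv).1 := by
  have : IsProbabilityMeasure (testLaw Q Hu Hv).1 := (testLaw Q Hu Hv).2
  rw [indepFun_iff_map_prod_eq_prod_map_map (by fun_prop) (by fun_prop), testLaw_map_fst,
    testLaw_map_testNoise]
  exact testLaw_map_prodMk Q Hu Hv

variable {Q}

lemma isCenteredGaussian_testLaw (hQ : IsCenteredGaussian (Q : Measure (EnhSpace k k₁ k₂ m))) :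
    IsCenteredGaussian (testLaw Q Hu Hv).1 :=
  (hQ.prod ((isCenteredGaussian_stdGaussian k).prod (isCenteredGaussian_stdGaussian k))).map _

/-- (W, U, V) is a function of `X` and of a noise independent of the whole source. -/
lemma isAuxiliary_testLaw : IsAuxiliary Q (testLaw Q Hu Hv) := by
  refine ⟨testLaw_map_fst Q Hu Hv, ?_⟩
  have : IsProbabilityMeasure (testLaw Q Hu Hv).1 := (testLaw Q Hu Hv).2
  refine (isMarkovChain_iff_condMutualInfo_eq_zero (μ := (testLaw Q Hu Hv).1)
    (by fun_prop) (by fun_prop) measurable_cX).2 ?_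
  refine condMutualInfo_eq_zero _ (by fun_prop) (by fun_prop) measurable_cX
    (testNoise Hu Hv).measurable
    (φ := fun p : Vec k × (Vec k × Vec k) => ((0 : Vec 0),
      toEuclideanCLM (𝕜 := ℝ) Hu p.1 + p.2.1, toEuclideanCLM (𝕜 := ℝ) Hv p.1 + p.2.2))
    (by fun_prop) (Filter.Eventually.of_forall fun ω => ?_) ?_
  · refine Prod.ext (Subsingleton.elim _ _) ?_
    simp [testNoise, srcX, cX, cU, cV]
  · exact (indepFun_testNoise Q Hu Hv).comp
      (φ := fun e => (e.1.1, (e.1.2.1, e.1.2.2, e.2))) (ψ := id) (by fun_prop) measurable_id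

lemma isTestNoise_testLaw (hQ : IsCenteredGaussian (Q : Measure (EnhSpace k k₁ k₂ m))) :
    IsTestNoise (testLaw Q Hu Hv).1 (fst ℝ (EnhSpace k k₁ k₂ m) (Vec 0 × Vec k × Vec k))
      (vc fun ω => (testNoise Hu Hv ω).1) (vc fun ω => (testNoise Hu Hv ω).2) := by
  have : IsProbabilityMeasure (testLaw Q Hu Hv).1 := (testLaw Q Hu Hv).2
  have hν := isCenteredGaussian_testLaw Hu Hv hQ
  have hγ := (isCenteredGaussian_stdGaussian k).prod (isCenteredGaussian_stdGaussian k)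
  have hL : IsLin (vc fun ω : FullSpace k k₁ k₂ m 0 k k => (testNoise Hu Hv ω).1) :=
    isLin_vc ((fst ℝ _ _).comp (testNoise Hu Hv))
  have hL' : IsLin (vc fun ω : FullSpace k k₁ k₂ m 0 k k => (testNoise Hu Hv ω).2) :=
    isLin_vc ((snd ℝ _ _).comp (testNoise Hu Hv))
  have h1 : IsLin (vc fun p : Vec k × Vec k => p.1) := isLin_vc (fst ℝ (Vec k) (Vec k))
  have h2 : IsLin (vc fun p : Vec k × Vec k => p.2) := isLin_vc (snd ℝ (Vec k) (Vec k))
  have h0 : IsLin (vc fun x : Vec k => x) := isLin_vc (ContinuousLinearMap.id ℝ _)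
  have hm := testLaw_map_testNoise Q Hu Hv
  have hfst : ((stdGaussian (Vec k)).prod (stdGaussian (Vec k))).map Prod.fst =
      stdGaussian (Vec k) := by rw [Measure.map_fst_prod, measure_univ, one_smul]
  have hsnd : ((stdGaussian (Vec k)).prod (stdGaussian (Vec k))).map Prod.snd =
      stdGaussian (Vec k) := by rw [Measure.map_snd_prod, measure_univ, one_smul]
  have hstd := h0.l2 (isCenteredGaussian_stdGaussian k)
  refine ⟨hL, hL', ?_, ?_, ?_, fun j f hf => ?_, fun j f hf => ?_⟩
  · have := cc_map (testNoise Hu Hv).measurable (hm ▸ h1.l2 hγ) (hm ▸ h1.l2 hγ)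
    refine this.trans ?_
    rw [hm]
    have := cc_map measurable_fst (hfst ▸ hstd) (hfst ▸ hstd)
    refine this.trans ?_
    rw [hfst, cc_stdGaussian]
  · have := cc_map (testNoise Hu Hv).measurable (hm ▸ h2.l2 hγ) (hm ▸ h2.l2 hγ)
    refine this.trans ?_
    rw [hm]
    have := cc_map measurable_snd (hsnd ▸ hstd) (hsnd ▸ hstd)
    refine this.trans ?_
    rw [hsnd, cc_stdGaussian]
  · have := cc_map (testNoise Hu Hv).measurable (hm ▸ h1.l2 hγ) (hm ▸ h2.l2 hγ)
    refine this.trans ?_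
    rw [hm]
    exact cc_eq_zero_of_indepFun (h1.l2 hγ) (h2.l2 hγ) (h2.integral_eq_zero hγ)
      (indepFun_prod h0.measurable h0.measurable)
  · have hLf := hf.comp_continuousLinearMap (fst ℝ (EnhSpace k k₁ k₂ m) (Vec 0 × Vec k × Vec k))
    exact cc_eq_zero_of_indepFun (hL.l2 hν) (hLf.l2 hν) (hLf.integral_eq_zero hν)
      ((indepFun_testNoise Q Hu Hv).comp hf.measurable h1.measurable).symm
  · have hLf := hf.comp_continuousLinearMap (fst ℝ (EnhSpace k k₁ k₂ m) (Vec 0 × Vec k × Vec k))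
    exact cc_eq_zero_of_indepFun (hL'.l2 hν) (hLf.l2 hν) (hLf.integral_eq_zero hν)
      ((indepFun_testNoise Q Hu Hv).comp hf.measurable h2.measurable).symm

end TestChannel

/-! ### Replacing an arbitrary triple by a Gaussian one. -/

section Optimality

open Matrix ContinuousLinearMap

lemma exists_transpose_mul_self_eq {k : ℕ} {K : Matrix (Fin k) (Fin k) ℝ} (hK : K.PosSemidef) :
    ∃ H : Matrix (Fin k) (Fin k) ℝ, Hᵀ * H = K := by
  obtain ⟨B, rfl⟩ := CStarAlgebra.nonneg_iff_eq_star_mul_self.mp hK.nonneg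
  exact ⟨B, by rw [star_eq_conjTranspose, conjTranspose_eq_transpose_of_trivial]⟩

/-- The channel matrices are square roots of what the specification makes positive semidefinite. -/
lemma RateSpec.exists_gains {E : Type*} [NormedAddCommGroup E] [NormedSpace ℝ E]
    [MeasurableSpace E] {Q : Measure E} {k k₁ m : ℕ} {X : E →L[ℝ] Vec k} {Y : E →L[ℝ] Vec m}
    {Y₁ : E →L[ℝ] Vec k₁} {R : Regression Q X Y Y₁} {Ka Kb : Matrix (Fin k) (Fin k) ℝ}
    (s : RateSpec R Ka Kb) : ∃ H H' : Matrix (Fin k) (Fin k) ℝ,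
      Hᵀ * H = Ka⁻¹ - (cc Q R.errX₁ R.errX₁)⁻¹ ∧
      H'ᵀ * H' = s.Pᵀ * ((diagonal fun i => (s.τ i : ℝ)⁻¹) - 1 -
        s.Sᵀ * (Ka⁻¹ - (cc Q R.errX₁ R.errX₁)⁻¹) * s.S) * s.P := by
  obtain ⟨H, hH⟩ := exists_transpose_mul_self_eq s.posSemidef_first
  obtain ⟨H', hH'⟩ := exists_transpose_mul_self_eq
    (s.posSemidef_second.conjTranspose_mul_mul_same s.P)
  exact ⟨H, H', hH, by rw [hH', conjTranspose_eq_transpose_of_trivial]⟩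

variable {k k₁ k₂ m a b c : ℕ}

lemma IsTestNoise.symm {E F : Type*} [NormedAddCommGroup E] [NormedSpace ℝ E] [MeasurableSpace E]
    [NormedAddCommGroup F] [NormedSpace ℝ F] [MeasurableSpace F] {ν : Measure F} {π : F →L[ℝ] E}
    {n n' : F → Fin k → ℝ} (h : IsTestNoise ν π n n') : IsTestNoise ν π n' n :=
  ⟨h.isLin', h.isLin, h.cc_self', h.cc_self, by rw [← cc_transpose, h.cc_cross, transpose_zero],
    h.cc_source', h.cc_source⟩

lemma isRecoding_vc {F : Type*} [NormedAddCommGroup F] [NormedSpace ℝ F] [MeasurableSpace F]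
    (U : F → Vec k) : IsRecoding (vc U) U :=
  ⟨WithLp.toLp 2, fun g => g.ofLp, by fun_prop, by fun_prop, fun _ => rfl, fun _ => rfl⟩

lemma isRecoding_prodMk {F : Type*} [NormedAddCommGroup F] [NormedSpace ℝ F] [MeasurableSpace F]
    (W : F → Vec 0) (U : F → Vec k) : IsRecoding (vc U) fun ω => (W ω, U ω) :=
  ⟨fun u => (0, WithLp.toLp 2 u), fun g => g.2.ofLp, by fun_prop, by fun_prop,
    fun _ => Prod.ext (Subsingleton.elim _ _) rfl, fun _ => rfl⟩

variable {P : ProbabilityMeasure (SourceSpace k k₁ k₂)}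
  {Q : ProbabilityMeasure (EnhSpace k k₁ k₂ m)}
  {ν : ProbabilityMeasure (FullSpace k k₁ k₂ m a b c)}

/-- Since (X, Y₁, Y₂) has law `P` under `Q`, the regression of `X` on `Z` may be done under `Q`.
This carries the invertibility of K_{X|Y₁} and K_{X|Y₂} over to the regression errors. -/
lemma condCov_source (hP : IsCenteredGaussian (P : Measure (SourceSpace k k₁ k₂)))
    (hQ : Q ∈ SG P m) {j : ℕ} (Z : SourceSpace k k₁ k₂ →L[ℝ] Vec j)
    (R : Regression (Q : Measure (EnhSpace k k₁ k₂ m)) srcX srcY (Z.comp (fst ℝ _ _))) :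
    condCov (P : Measure (SourceSpace k k₁ k₂)) (fun ω => ω.1) Z =
      cc (Q : Measure (EnhSpace k k₁ k₂ m)) R.errX₁ R.errX₁ := by
  let X : SourceSpace k k₁ k₂ →L[ℝ] Vec k := fst ℝ _ _
  have hr : IsLin (vc X - mv R.L₀ (vc Z)) := (isLin_vc X).sub ((isLin_vc Z).mv _)
  have hm : (Q : Measure (EnhSpace k k₁ k₂ m)).map Prod.fst = P := hQ.1
  have h1 := cc_map (ν := (Q : Measure (EnhSpace k k₁ k₂ m))) measurable_fst
    (hm ▸ hr.l2 hP) (hm ▸ (isLin_vc Z).l2 hP)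
  have h2 := cc_map (ν := (Q : Measure (EnhSpace k k₁ k₂ m))) measurable_fst
    (hm ▸ hr.l2 hP) (hm ▸ hr.l2 hP)
  rw [hm] at h1 h2
  exact (condCov_eq_regression hP X Z (h1.symm.trans R.cc_L₀)).trans h2.symm

lemma IsAuxiliary.l2_cX (hQ : Q ∈ SG P m) (hν : IsAuxiliary Q ν) :
    L2 (ν : Measure (FullSpace k k₁ k₂ m a b c)) (vc cX) :=
  (hν.observation₁ hQ).l2_comp (isLin_vc srcX)

/-- The lower bound extracts a specification from the errors of `ν`. The test channels built on it
reproduce both error covariances and attain the rate of the specification. -/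
theorem exists_gaussian₁ (hP : IsCenteredGaussian (P : Measure (SourceSpace k k₁ k₂)))
    (hK : IsUnit (covXgivenY₁ P)) (hQ : Q ∈ SG P m) (hν : IsAuxiliary Q ν) (hfin : Rlo1 ν ≠ ∞) :
    ∃ ν' : ProbabilityMeasure (FullSpace k k₁ k₂ m 0 k k), IsAuxiliary Q ν' ∧
      ν' ∈ JointlyGaussian ∧ covWUY₁ ν' = covWUY₁ ν ∧ covWUVY ν' = covWUVY ν ∧
      Rlo1 ν' ≤ Rlo1 ν := by
  have hO := hν.observation₁ hQ
  have hX := hν.l2_cX hQ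
  obtain ⟨R⟩ := exists_regressions (X := srcX) (Y := srcY) (Y₁ := srcY₁) hQ.2.1
  have hK' : IsUnit (cc (Q : Measure (EnhSpace k k₁ k₂ m)) R.errX₁ R.errX₁) := by
    have h := condCov_source hP hQ
      ((fst ℝ (Vec k₁) (Vec k₂)).comp (snd ℝ (Vec k) (Vec k₁ × Vec k₂))) R
    exact h ▸ hK
  obtain ⟨ρ, hρ⟩ := Exists.intro _ <| isErr_condExp
    (μ := (ν : Measure (FullSpace k k₁ k₂ m a b c)))
    (G := fun ω => (srcY₁ ω.1, (cW ω, cU ω))) (A := vc cX) (by fun_prop) hX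
  obtain ⟨ρ', hρ'⟩ := Exists.intro _ <| isErr_condExp
    (μ := (ν : Measure (FullSpace k k₁ k₂ m a b c)))
    (G := fun ω => (srcY ω.1, ((cW ω, cU ω), cV ω))) (A := vc cX) (by fun_prop) hX
  rw [Rlo1_eq] at hfin
  obtain ⟨s, hs⟩ := hO.exists_rateSpec R hρ hK' hρ' hfin
  obtain ⟨H, H', hH, hH'⟩ := s.exists_gains
  have hg := isCenteredGaussian_testLaw H H' hQ.2.1
  have hν' := isAuxiliary_testLaw (Q := Q) H H'
  have hG₁ := isRecoding_prodMk (cW : FullSpace k k₁ k₂ m 0 k k → Vec 0) cU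
  have hG₂ := isRecoding_vc (cV : FullSpace k k₁ k₂ m 0 k k → Vec k)
  rw [funext (cU_eq H H')] at hG₁
  rw [funext (cV_eq H H')] at hG₂
  have := hg.1.toIsProbabilityMeasure
  have hO' : Observation (Q : Measure (EnhSpace k k₁ k₂ m)) srcX srcY srcY₁
    (testLaw Q H H').1 (fst ℝ (EnhSpace k k₁ k₂ m) (Vec 0 × Vec k × Vec k))
    (fun ω => (cW ω, cU ω)) cV := hν'.observation₁ hQ
  obtain ⟨⟨σ, hσ, hσa⟩, ⟨σ', hσ', hσb⟩, hr⟩ := hO'.rate_eq_rateSpec hg hK' s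
    (isTestNoise_testLaw H H' hQ.2.1) hH hG₁ hH' hG₂
  have hX' := hν'.l2_cX hQ
  refine ⟨testLaw Q H H', hν', hg, ?_, ?_, ?_⟩
  · exact (covWUY₁_eq hX' hσ).trans (hσa.trans (covWUY₁_eq hX hρ).symm)
  · exact (covWUVY_eq hX' hσ').trans (hσb.trans (covWUVY_eq hX hρ').symm)
  · rw [Rlo1_eq, Rlo1_eq]
    exact hr.trans_le hs

theorem exists_gaussian₂ (hP : IsCenteredGaussian (P : Measure (SourceSpace k k₁ k₂)))
    (hK : IsUnit (covXgivenY₂ P)) (hQ : Q ∈ SG P m) (hν : IsAuxiliary Q ν) (hfin : Rlo2 ν ≠ ∞) :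
    ∃ ν' : ProbabilityMeasure (FullSpace k k₁ k₂ m 0 k k), IsAuxiliary Q ν' ∧
      ν' ∈ JointlyGaussian ∧ covWVY₂ ν' = covWVY₂ ν ∧ covWUVY ν' = covWUVY ν ∧
      Rlo2 ν' ≤ Rlo2 ν := by
  have hO := hν.observation₂ hQ
  have hX := hν.l2_cX hQ
  obtain ⟨R⟩ := exists_regressions (X := srcX) (Y := srcY) (Y₁ := srcY₂) hQ.2.1
  have hK' : IsUnit (cc (Q : Measure (EnhSpace k k₁ k₂ m)) R.errX₁ R.errX₁) := by
    have h := condCov_source hP hQ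
      ((snd ℝ (Vec k₁) (Vec k₂)).comp (snd ℝ (Vec k) (Vec k₁ × Vec k₂))) R
    exact h ▸ hK
  obtain ⟨ρ, hρ⟩ := Exists.intro _ <| isErr_condExp
    (μ := (ν : Measure (FullSpace k k₁ k₂ m a b c)))
    (G := fun ω => (srcY₂ ω.1, (cW ω, cV ω))) (A := vc cX) (by fun_prop) hX
  obtain ⟨ρ', hρ'⟩ := Exists.intro _ <| isErr_condExp
    (μ := (ν : Measure (FullSpace k k₁ k₂ m a b c)))
    (G := fun ω => (srcY ω.1, ((cW ω, cV ω), cU ω))) (A := vc cX) (by fun_prop) hX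
  rw [Rlo2_eq] at hfin
  obtain ⟨s, hs⟩ := hO.exists_rateSpec R hρ hK' hρ' hfin
  obtain ⟨H, H', hH, hH'⟩ := s.exists_gains
  -- The first observation is now (W, V), so its matrix `H` is assigned to `V` and `H'` to `U`.
  have hg := isCenteredGaussian_testLaw H' H hQ.2.1
  have hν' := isAuxiliary_testLaw (Q := Q) H' H
  have hG₁ := isRecoding_prodMk (cW : FullSpace k k₁ k₂ m 0 k k → Vec 0) cV
  have hG₂ := isRecoding_vc (cU : FullSpace k k₁ k₂ m 0 k k → Vec k)
  rw [funext (cV_eq H' H)] at hG₁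
  rw [funext (cU_eq H' H)] at hG₂
  have := hg.1.toIsProbabilityMeasure
  have hO' : Observation (Q : Measure (EnhSpace k k₁ k₂ m)) srcX srcY srcY₂
    (testLaw Q H' H).1 (fst ℝ (EnhSpace k k₁ k₂ m) (Vec 0 × Vec k × Vec k))
    (fun ω => (cW ω, cV ω)) cU := hν'.observation₂ hQ
  obtain ⟨⟨σ, hσ, hσa⟩, ⟨σ', hσ', hσb⟩, hr⟩ := hO'.rate_eq_rateSpec hg hK' s
    (isTestNoise_testLaw H' H hQ.2.1).symm hH hG₁ hH' hG₂
  have hX' := hν'.l2_cX hQ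
  refine ⟨testLaw Q H' H, hν', hg, ?_, ?_, ?_⟩
  · exact (covWVY₂_eq hX' hσ).trans (hσa.trans (covWVY₂_eq hX hρ).symm)
  · exact (covWUVY_eq' hX' hσ').trans (hσb.trans (covWUVY_eq' hX hρ').symm)
  · rw [Rlo2_eq, Rlo2_eq]
    exact hr.trans_le hs

/-- Triples of infinite rate do not affect an infimum, so a Gaussian competitor is needed for finite
rates only. -/
lemma infOver_inter_eq
    {R : ∀ {a b c : ℕ}, ProbabilityMeasure (FullSpace k k₁ k₂ m a b c) → ℝ≥0∞}
    {C : ∀ a b c : ℕ, Set (ProbabilityMeasure (FullSpace k k₁ k₂ m a b c))}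
    (h : ∀ a b c, ∀ ν ∈ C a b c, R ν ≠ ∞ →
      ∃ ν' ∈ C 0 k k ∩ JointlyGaussian, R ν' ≤ R ν) :
    infOver R (fun a b c => C a b c ∩ JointlyGaussian) = infOver R C := by
  refine le_antisymm ?_ ?_
  · refine le_iInf fun a => le_iInf fun b => le_iInf fun c => le_iInf₂ fun ν hν => ?_
    by_cases hR : R ν = ∞
    · exact le_top.trans_eq hR.symm
    · obtain ⟨ν', hν', hle⟩ := h a b c ν hν hR
      refine le_trans ?_ hle
      unfold infOver
      exact iInf_le_of_le 0 (iInf_le_of_le k (iInf_le_of_le k (iInf₂_le ν' hν')))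
  · exact iInf_mono fun a => iInf_mono fun b => iInf_mono fun c =>
      le_iInf₂ fun ν hν => iInf₂_le ν hν.1

end Optimality

end SideInfo

end

open SideInfo in
theorem mainTheorem9 {k k₁ k₂ k₀ : ℕ}
    (P : ProbabilityMeasure (SideInfo.SourceSpace k k₁ k₂))
    (hP : SideInfo.IsCenteredGaussian (P : Measure (SideInfo.SourceSpace k k₁ k₂)))
    (hK₁ : IsUnit (SideInfo.covXgivenY₁ P)) (hK₂ : IsUnit (SideInfo.covXgivenY₂ P))
    (Γ₁ Γ₂ : Matrix (Fin k) (Fin k) ℝ → Matrix (Fin k₀) (Fin k₀) ℝ)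
    (hΓ₁ : SideInfo.IsDistortionMap Γ₁) (hΓ₂ : SideInfo.IsDistortionMap Γ₂)
    (D₁ D₂ : Matrix (Fin k₀) (Fin k₀) ℝ) (hD₁ : D₁.PosDef) (hD₂ : D₂.PosDef) :
    -- for every admissible `Y`, the four inner problems keep their optimal values
    (∀ (m : ℕ), ∀ Q ∈ SideInfo.SG P m,
      SideInfo.infOver SideInfo.Rlo1
          (fun a b c => SideInfo.Ctilde1 Γ₁ Γ₂ D₁ D₂ Q a b c ∩ SideInfo.JointlyGaussian) =
        SideInfo.infOver SideInfo.Rlo1 (SideInfo.Ctilde1 Γ₁ Γ₂ D₁ D₂ Q) ∧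
      SideInfo.infOver SideInfo.Rlo2
          (fun a b c => SideInfo.Ctilde2 Γ₁ Γ₂ D₁ D₂ Q a b c ∩ SideInfo.JointlyGaussian) =
        SideInfo.infOver SideInfo.Rlo2 (SideInfo.Ctilde2 Γ₁ Γ₂ D₁ D₂ Q)) ∧
    (∀ (m : ℕ), ∀ Q ∈ SideInfo.SGInv P m,
      SideInfo.infOver SideInfo.Rlo1
          (fun a b c => SideInfo.Cbar1 P Γ₁ Γ₂ D₁ D₂ Q a b c ∩ SideInfo.JointlyGaussian) =
        SideInfo.infOver SideInfo.Rlo1 (SideInfo.Cbar1 P Γ₁ Γ₂ D₁ D₂ Q) ∧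
      SideInfo.infOver SideInfo.Rlo2
          (fun a b c => SideInfo.Cbar2 P Γ₁ Γ₂ D₁ D₂ Q a b c ∩ SideInfo.JointlyGaussian) =
        SideInfo.infOver SideInfo.Rlo2 (SideInfo.Cbar2 P Γ₁ Γ₂ D₁ D₂ Q)) ∧
    -- the optimal values of the two bounds are unchanged
    SideInfo.RELBGauss P Γ₁ Γ₂ D₁ D₂ = SideInfo.RELB P Γ₁ Γ₂ D₁ D₂ ∧
    SideInfo.RE2LBGauss P Γ₁ Γ₂ D₁ D₂ = SideInfo.RE2LB P Γ₁ Γ₂ D₁ D₂ := by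
  have hT : ∀ (m : ℕ), ∀ Q ∈ SG P m,
      infOver Rlo1 (fun a b c => Ctilde1 Γ₁ Γ₂ D₁ D₂ Q a b c ∩ JointlyGaussian) =
        infOver Rlo1 (Ctilde1 Γ₁ Γ₂ D₁ D₂ Q) ∧
      infOver Rlo2 (fun a b c => Ctilde2 Γ₁ Γ₂ D₁ D₂ Q a b c ∩ JointlyGaussian) =
        infOver Rlo2 (Ctilde2 Γ₁ Γ₂ D₁ D₂ Q) := by
    refine fun m Q hQ => ⟨infOver_inter_eq fun a b c ν hν hfin => ?_,
      infOver_inter_eq fun a b c ν hν hfin => ?_⟩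
    · obtain ⟨ν', h1, h2, h3, h4, h5⟩ := exists_gaussian₁ hP hK₁ hQ hν.1 hfin
      refine ⟨ν', ⟨⟨h1, ?_⟩, h2⟩, h5⟩
      -- The distortion constraints depend on the triple only through the two covariances that were
      -- preserved.
      rw [h3, h4]
      exact hν.2
    · obtain ⟨ν', h1, h2, h3, h4, h5⟩ := exists_gaussian₂ hP hK₂ hQ hν.1 hfin
      refine ⟨ν', ⟨⟨h1, ?_⟩, h2⟩, h5⟩
      rw [h3, h4]
      exact hν.2
  have hB : ∀ (m : ℕ), ∀ Q ∈ SGInv P m,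
      infOver Rlo1 (fun a b c => Cbar1 P Γ₁ Γ₂ D₁ D₂ Q a b c ∩ JointlyGaussian) =
        infOver Rlo1 (Cbar1 P Γ₁ Γ₂ D₁ D₂ Q) ∧
      infOver Rlo2 (fun a b c => Cbar2 P Γ₁ Γ₂ D₁ D₂ Q a b c ∩ JointlyGaussian) =
        infOver Rlo2 (Cbar2 P Γ₁ Γ₂ D₁ D₂ Q) := by
    refine fun m Q hQ => ⟨infOver_inter_eq fun a b c ν hν hfin => ?_,
      infOver_inter_eq fun a b c ν hν hfin => ?_⟩
    · obtain ⟨ν', h1, h2, h3, h4, h5⟩ := exists_gaussian₁ hP hK₁ hQ.1 hν.1 hfin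
      refine ⟨ν', ⟨⟨h1, ?_⟩, h2⟩, h5⟩
      -- The enhanced constraints, including the invertibility of K_{X|W,U,V,Y}, also see the triple
      -- only through these covariances; the remaining matrices are fixed by `P` and `Q`.
      rw [h3, h4]
      exact hν.2
    · obtain ⟨ν', h1, h2, h3, h4, h5⟩ := exists_gaussian₂ hP hK₂ hQ.1 hν.1 hfin
      refine ⟨ν', ⟨⟨h1, ?_⟩, h2⟩, h5⟩
      rw [h3, h4]
      exact hν.2
  refine ⟨hT, hB, ?_, ?_⟩
  · unfold RELBGauss RELB
    exact congrArg₂ max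
      (iSup_congr fun m => iSup_congr fun Q => iSup_congr fun hQ => (hT m Q hQ).1)
      (iSup_congr fun m => iSup_congr fun Q => iSup_congr fun hQ => (hT m Q hQ).2)
  · unfold RE2LBGauss RE2LB
    exact congrArg₂ max
      (iSup_congr fun m => iSup_congr fun Q => iSup_congr fun hQ => (hB m Q hQ).1)
      (iSup_congr fun m => iSup_congr fun Q => iSup_congr fun hQ => (hB m Q hQ).2)
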